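/- Let $d\ge 1$, $0<s<1$, $1\le p<\infty$, $0<q\le\infty$ and $-1<\alpha<sp-1$. Write $\mathbb R^{d+1}_+=\mathbb R^d\times(0,\infty)$, let $m_n$ be Lebesgue measure on $\mathbb R^n$, and put $d\mu_\alpha(x)=\min(1,|x_{d+1}|)^\alpha\,dm_{d+1}(x)$ on $\mathbb R^{d+1}_+$. Functions are complex-valued, and $f_{A,\mu}=\mu(A)^{-1}\int_A f\,d\mu$. $L^1_{\rm loc}(\mathbb R^d)$ and $L^1_{\rm loc}(\mathbb R^{d+1}_+)$ denote the functions that are Lebesgue integrable on all bounded subsets of $\mathbb R^d$, respectively of $\mathbb R^{d+1}_+$. A dyadic cube in $\mathbb R^n$ is a set $Q=2^{-k}((0,1]^n+m)$ with $k\in\mathbb Z$, $m\in\mathbb Z^n$; $\ell(Q)=2^{-k}$ is its edge length. Write $Q\sim Q'$ if $\frac12\le\ell(Q)/\ell(Q')\le2$ and $\overline Q\cap\overline{Q'}\ne\emptyset$, and let $Q^x_k$ be the dyadic cube with edge length $2^{-k}$ that contains $x$. For $0<\sigma<1$, $B^{\sigma}_{p,p}(\mathbb R^d)$ is the space of $f\in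 L^1_{\rm loc}(\mathbb R^d)$ for which $$\|f\|_{B^\sigma_{p,p}(\mathbb R^d)}=\|f\|_{L^p(\mathbb R^d)}+\Big(\sum_{k\ge0}2^{k\sigma p}\sum_{\ell(Q)=2^{-k}}m_d(Q)\sum_{Q'\sim Q}|f_{Q,m_d}-f_{Q',m_d}|^p\Big)^{1/p}<\infty .$$ $F^s_{p,q}(\mathbb R^{d+1}_+,\mu_\alpha)$ is the space of $f\in L^1_{\rm loc}(\mathbb R^{d+1}_+)$ for which $$\|f\|_{F^s_{p,q}(\mathbb R^{d+1}_+,\mu_\alpha)}=\|f\|_{L^p(\mathbb R^{d+1}_+,\mu_\alpha)}+\Big(\int_{\mathbb R^{d+1}_+}\Big(\sum_{k\ge0}2^{ksq}\sum_{Q'\sim Q^x_k,\;Q'\subset\mathbb R^{d+1}_+}|f_{Q^x_k,\mu_\alpha}-f_{Q',\mu_\alpha}|^q\Big)^{p/q}d\mu_\alpha(x)\Big)^{1/p}<\infty$$ (suprema replace the sums over $k$ and $Q'$ if $q=\infty$). Functions equal almost everywhere are identified. For a dyadic cube $Q\subset\mathbb R^d$ let $\mathcal W(Q)=Q\times(\ell(Q),2\ell(Q)]$.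 Fix any family of smooth functions $\psi_Q\colon\mathbb R^{d+1}_+\to[0,1]$, indexed by the dyadic cubes $Q\subset\mathbb R^d$ with $\ell(Q)\le1$, such that, for constants $c,C>0$ independent of $Q$, $\psi_Q$ is Lipschitz with constant $C/\ell(Q)$, $\psi_Q\ge c$ on $\mathcal W(Q)$, $\operatorname{supp}\psi_Q$ is contained in the $\frac{\ell(Q)}4$-neighbourhood of $\mathcal W(Q)$, and $\sum_Q\psi_Q=1$ on $\bigcup_{\ell(Q)\le1}\mathcal W(Q)$. The Whitney extension of $f\in L^1_{\rm loc}(\mathbb R^d)$ is $$\mathcal E f(x)=\sum_{\ell(Q)\le1}f_{Q,m_d}\,\psi_Q(x),\qquad x\in\mathbb R^{d+1}_+,$$ and the trace of a function $f$ on $\mathbb R^{d+1}_+$ is $$\mathcal R f(x)=\lim_{r\to0^+}f_{B((x,0),r)\cap\mathbb R^{d+1}_+,\;\mu_\alpha},\qquad x\in\mathbb R^d .$$ Theorem. With $X=B^{s-(\alpha+1)/p}_{p,p}(\mathbb R^d)$ and $Y=F^s_{p,q}(\mathbb R^{d+1}_+,\mu_\alpha)$, $(X,Y)$ is a Whitney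 trace-extension pair, that is: $\mathcal E$ maps $X$ continuously into $Y$; for every $f\in Y$ the limit $\mathcal Rf(x)$ exists for almost every $x\in\mathbb R^d$ and $\mathcal Rf\in L^1_{\rm loc}(\mathbb R^d)$; $\mathcal R$ maps $Y$ continuously into $X$; and $\mathcal R(\mathcal E f)=f$ almost everywhere for every $f\in X$. In particular the trace space $\{\mathcal Rf: f\in Y\}$ equals $B^{s-(\alpha+1)/p}_{p,p}(\mathbb R^d)$ for every $q\in(0,\infty]$, so it does not depend on $q$. -/

import Mathlib

open MeasureTheory Filter Topology Set
open scoped ENNReal NNReal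

namespace WhitneyTrace

noncomputable section

/-- `ℝⁿ` with its Euclidean norm. -/
abbrev E (n : ℕ) : Type := EuclideanSpace ℝ (Fin n)

/-- The open upper half-space `ℝ^d × (0,∞)` inside `ℝ^{d+1}`. -/
def upperHalf (d : ℕ) : Set (E (d + 1)) := {x | 0 < x (Fin.last d)}

/-- The boundary point `(x, 0)`. -/
def bdryPoint {d : ℕ} (x : E d) : E (d + 1) :=
  WithLp.toLp 2 (Fin.snoc (α := fun _ => ℝ) (fun i => x i) 0)

/-- Index of the dyadic cube `2^{-level} ((0,1]^n + corner)`. -/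
@[ext] structure DyadicCube (n : ℕ) where
  level : ℤ
  corner : Fin n → ℤ

namespace DyadicCube

variable {n : ℕ}

/-- Edge length. -/
def len (Q : DyadicCube n) : ℝ := (2 : ℝ) ^ (-Q.level)

/-- The semi-open cube as a subset of `ℝⁿ`. -/
def toSet (Q : DyadicCube n) : Set (E n) :=
  {x | ∀ i, Q.len * (Q.corner i : ℝ) < x i ∧ x i ≤ Q.len * ((Q.corner i : ℝ) + 1)}

/-- `Q ∼ Q'`: edge lengths comparable up to a factor `2`, and closures that meet. -/
def Neighbor (Q Q' : DyadicCube n) : Prop :=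
  1 / 2 ≤ Q.len / Q'.len ∧ Q.len / Q'.len ≤ 2 ∧
    (closure Q.toSet ∩ closure Q'.toSet).Nonempty

/-- The dyadic cube of edge length `2^{-k}` that contains `x`. -/
def at' (x : E n) (k : ℤ) : DyadicCube n := ⟨k, fun i => ⌈(2 : ℝ) ^ k * x i⌉ - 1⟩

theorem mem_at' (x : E n) (k : ℤ) : x ∈ (at' x k).toSet := by
  intro i
  have h2 : (0 : ℝ) < 2 ^ k := by positivity
  have h := Int.ceil_lt_add_one ((2 : ℝ) ^ k * x i)
  have h' := Int.le_ceil ((2 : ℝ) ^ k * x i)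
  simp only [at', len, zpow_neg, Int.cast_sub, Int.cast_one]
  rw [inv_mul_lt_iff₀ h2, le_inv_mul_iff₀ h2]
  constructor <;> linarith

/-- The Whitney cube `Q × (2^{-k}, 2^{-k+1}]` above a cube `Q` of edge length `2^{-k}`. -/
def whitney {d : ℕ} (Q : DyadicCube d) : DyadicCube (d + 1) :=
  ⟨Q.level, Fin.snoc (α := fun _ => ℤ) Q.corner 1⟩

end DyadicCube

/-! ### Function spaces -/

/-- Integrability (for Lebesgue measure) on the bounded subsets of `Ω`. For `Ω = ℝⁿ` this is
ordinary local integrability. -/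
def LocInt {n : ℕ} (Ω : Set (E n)) (f : E n → ℂ) : Prop :=
  ∀ A : Set (E n), A ⊆ Ω → Bornology.IsBounded A → IntegrableOn f A volume

/-- The `ℓ^q`-quasinorm of a family of nonnegative extended reals, `0 < q ≤ ∞`. -/
def lqNorm {ι : Type} (q : ℝ≥0∞) (a : ι → ℝ≥0∞) : ℝ≥0∞ :=
  if q = ∞ then ⨆ i, a i else (∑' i, a i ^ q.toReal) ^ (1 / q.toReal)

/-- The `ℓ^r`-quasinorm of the oscillations `|f_{Q,μ} - f_{Q',μ}|`, where `Q'` runs over the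
neighbours of `Q` that are contained in `Ω`. -/
def osc {n : ℕ} (Ω : Set (E n)) (μ : Measure (E n)) (r : ℝ≥0∞) (f : E n → ℂ)
    (Q : DyadicCube n) : ℝ≥0∞ :=
  lqNorm r (fun Q' : {Q' : DyadicCube n // Q.Neighbor Q' ∧ Q'.toSet ⊆ Ω} =>
    ‖(⨍ y in Q.toSet, f y ∂μ) - ⨍ y in Q'.1.toSet, f y ∂μ‖ₑ)

/-- The dyadic Besov quasinorm
`‖f‖_{L^p(Ω,μ)} + (∑_{k ≥ 0} 2^{ksq} (∑_{Q of level k} μ(Q) ∑_{Q' ∼ Q} |f_Q - f_{Q'}|^p)^{q/p})^{1/q}`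
(suprema replace sums for infinite exponents); all cubes are contained in `Ω`. -/
def besovNorm {n : ℕ} (Ω : Set (E n)) (μ : Measure (E n)) (s : ℝ) (p q : ℝ≥0∞)
    (f : E n → ℂ) : ℝ≥0∞ :=
  eLpNorm f p (μ.restrict Ω) +
    lqNorm q (fun k : ℕ => (2 : ℝ≥0∞) ^ ((k : ℝ) * s) *
      lqNorm p (fun Q : {Q : DyadicCube n // Q.level = (k : ℤ) ∧ Q.toSet ⊆ Ω} =>
        μ Q.1.toSet ^ (1 / p.toReal) * osc Ω μ p f Q.1))

/-- The Besov space `B^s_{p,q}(Ω, μ)`. -/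
def besovSpace {n : ℕ} (Ω : Set (E n)) (μ : Measure (E n)) (s : ℝ) (p q : ℝ≥0∞) :
    Set (E n → ℂ) :=
  {f | LocInt Ω f ∧ besovNorm Ω μ s p q f < ∞}

/-- The dyadic Triebel-Lizorkin quasinorm `‖f‖_{L^p(Ω,μ)} +
(∫_Ω (∑_{k ≥ 0} 2^{ksq} ∑_{Q' ∼ Q^x_k} |f_{Q^x_k} - f_{Q'}|^q)^{p/q} dμ(x))^{1/p}`
(suprema replace sums for `q = ∞`); all cubes are contained in `Ω`. -/
def triebelNorm {n : ℕ} (Ω : Set (E n)) (μ : Measure (E n)) (s p : ℝ) (q : ℝ≥0∞)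
    (f : E n → ℂ) : ℝ≥0∞ :=
  eLpNorm f (ENNReal.ofReal p) (μ.restrict Ω) +
    (∫⁻ x in Ω, (lqNorm q (fun k : ℕ => (2 : ℝ≥0∞) ^ ((k : ℝ) * s) *
      osc Ω μ q f (DyadicCube.at' x (k : ℤ)))) ^ p ∂μ) ^ (1 / p)

/-- The Triebel-Lizorkin space `F^s_{p,q}(Ω, μ)`. -/
def triebelSpace {n : ℕ} (Ω : Set (E n)) (μ : Measure (E n)) (s p : ℝ) (q : ℝ≥0∞) :
    Set (E n → ℂ) :=
  {f | LocInt Ω f ∧ triebelNorm Ω μ s p q f < ∞}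

/-- The measure `min(1, |x_{d+1}|)^α dx` on the upper half-space of `ℝ^{d+1}`. -/
def muAlpha (d : ℕ) (α : ℝ) : Measure (E (d + 1)) :=
  (volume.restrict (upperHalf d)).withDensity
    (fun x => ENNReal.ofReal ((min 1 |x (Fin.last d)|) ^ α))

/-! ### Whitney extension and trace -/

/-- The dyadic cubes of edge length at most one. -/
abbrev SmallCube (d : ℕ) : Type := {Q : DyadicCube d // 0 ≤ Q.level}

/-- Smooth bump functions adapted to the Whitney cubes `W(Q)`, `ℓ(Q) ≤ 1`. Their supports stay away
from the boundary of the half-space, so that they are taken to be defined (as zero) on all of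
`ℝ^{d+1}`. -/
structure IsWhitneyBumps (d : ℕ) (ψ : SmallCube d → E (d + 1) → ℝ) : Prop where
  smooth : ∀ Q, ContDiff ℝ (⊤ : ℕ∞) (ψ Q)
  mem_Icc : ∀ Q x, ψ Q x ∈ Icc (0 : ℝ) 1
  lipschitz : ∃ C : ℝ, ∀ Q x y, |ψ Q x - ψ Q y| ≤ C / Q.1.len * dist x y
  lower : ∃ c : ℝ, 0 < c ∧ ∀ Q, ∀ x ∈ Q.1.whitney.toSet, c ≤ ψ Q x
  supp : ∀ Q, tsupport (ψ Q) ⊆ Metric.thickening (Q.1.len / 4) Q.1.whitney.toSet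
  sum_eq_one : ∀ x ∈ ⋃ Q : SmallCube d, Q.1.whitney.toSet, ∑' Q, ψ Q x = 1

/-- The Whitney extension `∑_Q f_Q ψ_Q`; the sum has finitely many nonzero terms at each point of
the half-space. -/
def ext {d : ℕ} (ψ : SmallCube d → E (d + 1) → ℝ) (f : E d → ℂ) : E (d + 1) → ℂ :=
  fun x => ∑' Q : SmallCube d, (⨍ y in Q.1.toSet, f y) * (ψ Q x : ℂ)

/-- The averages of `f` over the half-balls `B((x,0), r) ∩ ℝ^{d+1}_+`. -/
def halfBallAverage {d : ℕ} (μ : Measure (E (d + 1))) (f : E (d + 1) → ℂ) (x : E d) (r : ℝ) : ℂ :=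
  ⨍ y in Metric.ball (bdryPoint x) r ∩ upperHalf d, f y ∂μ

/-- The trace is well defined at `x`. -/
def HasTraceAt {d : ℕ} (μ : Measure (E (d + 1))) (f : E (d + 1) → ℂ) (x : E d) : Prop :=
  ∃ c : ℂ, Tendsto (halfBallAverage μ f x) (𝓝[>] 0) (𝓝 c)

/-- The trace of `f`, as the limit of its half-ball averages (meaningful where `HasTraceAt`). -/
def trace {d : ℕ} (μ : Measure (E (d + 1))) (f : E (d + 1) → ℂ) : E d → ℂ :=
  fun x => limUnder (𝓝[>] (0 : ℝ)) (halfBallAverage μ f x)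

/-- `T` maps the space `(X, NX)` continuously into `(Y, NY)`. The operators considered are linear,
for which continuity is the bound `NY (T h) ≤ C * NX h`, here written with `h = f - g`. -/
def MapsContinuously {A B : Type} (X : Set (A → ℂ)) (NX : (A → ℂ) → ℝ≥0∞)
    (Y : Set (B → ℂ)) (NY : (B → ℂ) → ℝ≥0∞) (T : (A → ℂ) → B → ℂ) : Prop :=
  (∀ f ∈ X, T f ∈ Y) ∧
    ∃ C : ℝ≥0, (∀ f ∈ X, NY (T f) ≤ C * NX f) ∧
      ∀ f ∈ X, ∀ g ∈ X, NY (T f - T g) ≤ C * NX (f - g)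

/-- `((X, NX), (Y, NY))` is a Whitney trace-extension pair: extension is continuous from `X` to `Y`,
traces of members of `Y` exist almost everywhere and are locally integrable, the trace is continuous
from `Y` to `X`, and it is a left inverse of the extension. -/
structure IsWhitneyTraceExtensionPair {d : ℕ} (ψ : SmallCube d → E (d + 1) → ℝ)
    (μ : Measure (E (d + 1))) (X : Set (E d → ℂ)) (NX : (E d → ℂ) → ℝ≥0∞)
    (Y : Set (E (d + 1) → ℂ)) (NY : (E (d + 1) → ℂ) → ℝ≥0∞) : Prop where
  ext_continuous : MapsContinuously X NX Y NY (ext ψ)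
  trace_exists : ∀ f ∈ Y, ∀ᵐ x : E d, HasTraceAt μ f x
  trace_locInt : ∀ f ∈ Y, LocInt univ (trace μ f)
  trace_continuous : MapsContinuously Y NY X NX (trace μ)
  trace_ext : ∀ f ∈ X, trace μ (ext ψ f) =ᵐ[volume] f

/-- The trace space of `Y`: all functions that agree almost everywhere with the trace of a member
of `Y`. -/
def traceSpace {d : ℕ} (μ : Measure (E (d + 1))) (Y : Set (E (d + 1) → ℂ)) : Set (E d → ℂ) :=
  {g | ∃ f ∈ Y, trace μ f =ᵐ[volume] g}

end

end WhitneyTrace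

/-!
Write `σ = s - (α + 1) / p`. A point `y` of the half-space has a horizontal part `base y` and a height
`hgt y`, and the weighted measure is the product of Lebesgue measure with `min(1, t)^α dt`
(`measurePreserving_split`). The heights in `(2^{-k}, 2^{1-k}]` have weighted measure comparable to
`2^{-k(α+1)}`, and this is the factor that turns the weight `2^{ksp}` of the half-space into the weight
`2^{kσp}` of the boundary. Since the Whitney cubes `Q × (ℓ(Q), 2ℓ(Q)]` are disjoint, an `L^p`-norm over
the half-space of a quantity that lives, at each height, on a single scale becomes an `ℓ^p`-sum over
scales, whatever the exponent `q` is.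

*Trace.* Keep from the Triebel-Lizorkin norm of `F` only the largest weighted oscillation
(`maxOsc`, the case `q = ∞`). The averages `a_Q` of `F` over the Whitney cubes have differences that
are controlled by it in the Besov manner (`tsum_whitney_osc_le`). By Hardy's inequality their
oscillations are summable along almost every tower of cubes that shrinks to a boundary point, so that
`a_Q` tends to a function `h`, and `h` inherits the Besov bound (`besov_le_of_tower`). The distance of
`F` from `h ∘ base` is at most a multiple of `t^s G` with `G ∈ L^p` plus a tail of the oscillations,
and `s p > α + 1` makes the averages of both over half-balls tend to zero
(`ae_tendsto_halfBallAverage`). Hence `h` is the trace (`exists_trace`).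

*Extension.* Compare `ext ψ f` at height about `2^{-i}` with `f`. At scales `2^{-k}` that are not
much smaller than the height, the oscillation is that of `f` up to the error `extError f k`, the sum of
the oscillations of `f` at finer scales (`osc_ext_le_of_le`). At smaller scales the bumps are
Lipschitz, which gives the factor `2^{-(k-i)}` (`osc_ext_le_of_ge`). As `0 < s < 1`, the weighted
oscillations decay geometrically in `|k - i|` after a small loss in the weights, so all the
`ℓ^q`-quasinorms are dominated by one `ℓ^p`-sum (`lqNorm_rpow_le_of_decay`). Integration over the
layers of heights and summation of geometric series give the Besov norm (`lintegral_osc_ext_le`,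
`exists_ext_bound`). Since `ext ψ f` differs from `f ∘ base` by tails only, its trace is `f`
(`trace_ext_ae_eq`).
-/

namespace WhitneyTrace

open DyadicCube

/-! ### Geometry of dyadic cubes -/

namespace DyadicCube

variable {n : ℕ}

lemma len_pos (Q : DyadicCube n) : 0 < Q.len := by unfold len; positivity

@[simp] lemma at'_level (x : E n) (k : ℤ) : (at' x k).level = k := rfl

/-- The cubes of a fixed level partition the space. -/
lemma mem_toSet_iff {Q : DyadicCube n} {x : E n} : x ∈ Q.toSet ↔ at' x Q.level = Q := by
  constructor
  · intro h
    refine DyadicCube.ext rfl (funext fun i => ?_)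
    have h2 : (0 : ℝ) < 2 ^ Q.level := by positivity
    obtain ⟨h3, h4⟩ := h i
    simp only [len, zpow_neg] at h3 h4
    rw [inv_mul_lt_iff₀ h2] at h3
    rw [le_inv_mul_iff₀ h2] at h4
    have : ⌈(2 : ℝ) ^ Q.level * x i⌉ = Q.corner i + 1 := by
      rw [Int.ceil_eq_iff]; push_cast; constructor <;> linarith
    simp [at', this]
  · intro h; rw [← h]; exact mem_at' x _

lemma measurableSet_toSet (Q : DyadicCube n) : MeasurableSet Q.toSet := by
  have : Q.toSet = ⋂ i, (fun x : E n => x i) ⁻¹'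
      Ioc (Q.len * (Q.corner i : ℝ)) (Q.len * ((Q.corner i : ℝ) + 1)) := by ext x; simp [toSet]
  rw [this]
  exact MeasurableSet.iInter fun i => (by fun_prop : Measurable fun x : E n => x i) measurableSet_Ioc

lemma disjoint_toSet {Q Q' : DyadicCube n} (hl : Q.level = Q'.level) (h : Q ≠ Q') :
    Disjoint Q.toSet Q'.toSet := by
  rw [Set.disjoint_left]
  intro x hx hx'
  rw [mem_toSet_iff] at hx hx'
  exact h (by rw [← hx, ← hx', hl])

/-- Any quantity attached to the cube of level `k` around `x` depends measurably on `x`. -/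
lemma measurable_at' {β : Type*} [MeasurableSpace β] (F : DyadicCube n → β) (k : ℤ) :
    Measurable fun x : E n => F (at' x k) := by
  have h : Measurable fun x : E n => (fun i => ⌈(2 : ℝ) ^ k * x i⌉ - 1 : Fin n → ℤ) := by
    refine measurable_pi_lambda _ fun i => ?_
    exact (Int.measurable_ceil.comp (by fun_prop)).sub_const 1
  exact (Measurable.of_discrete (f := fun c : Fin n → ℤ => F ⟨k, c⟩)).comp h

/-- Cubes are determined by their level and their corner. -/
def equivProd (n : ℕ) : DyadicCube n ≃ ℤ × (Fin n → ℤ) where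
  toFun Q := (Q.level, Q.corner)
  invFun a := ⟨a.1, a.2⟩
  left_inv _ := rfl
  right_inv _ := rfl

instance : Countable (DyadicCube n) := (equivProd n).countable_iff.2 inferInstance

/-- The cubes of level `k`, indexed by their corners. -/
def levelEquiv (n : ℕ) (k : ℤ) : (Fin n → ℤ) ≃ {Q : DyadicCube n // Q.level = k} where
  toFun c := ⟨⟨k, c⟩, rfl⟩
  invFun Q := Q.1.corner
  left_inv _ := rfl
  right_inv Q := by ext <;> simp [Q.2]

lemma toSet_eq_preimage (Q : DyadicCube n) : Q.toSet =
    (PiLp.homeomorph 2 (fun _ : Fin n => ℝ)) ⁻¹'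
      (univ.pi fun i => Ioc (Q.len * (Q.corner i : ℝ)) (Q.len * ((Q.corner i : ℝ) + 1))) := by
  ext x
  simp only [mem_preimage, mem_univ_pi]
  rfl

lemma mem_closure_toSet {Q : DyadicCube n} {x : E n} : x ∈ closure Q.toSet ↔
    ∀ i, Q.len * (Q.corner i : ℝ) ≤ x i ∧ x i ≤ Q.len * ((Q.corner i : ℝ) + 1) := by
  have h : ∀ i, Q.len * (Q.corner i : ℝ) ≠ Q.len * ((Q.corner i : ℝ) + 1) := fun i => by
    have := Q.len_pos
    intro h; nlinarith
  rw [toSet_eq_preimage, ← Homeomorph.preimage_closure, closure_pi_set, mem_preimage,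
    mem_univ_pi]
  simp_rw [closure_Ioc (h _)]
  rfl

lemma volume_toSet (Q : DyadicCube n) : volume Q.toSet = ENNReal.ofReal Q.len ^ n := by
  have h := (EuclideanSpace.volume_preserving_symm_measurableEquiv_toLp (Fin n)).measure_preimage
    (s := univ.pi fun i => Ioc (Q.len * (Q.corner i : ℝ)) (Q.len * ((Q.corner i : ℝ) + 1)))
    (MeasurableSet.univ_pi fun i => measurableSet_Ioc).nullMeasurableSet
  rw [toSet_eq_preimage]
  refine Eq.trans h ?_
  rw [volume_pi_pi]
  simp only [Real.volume_Ioc]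
  rw [Finset.prod_congr rfl fun i _ => by rw [show Q.len * ((Q.corner i : ℝ) + 1) -
    Q.len * (Q.corner i : ℝ) = Q.len by ring]]
  simp

lemma volume_toSet_pos (Q : DyadicCube n) : volume Q.toSet ≠ 0 := by
  rw [volume_toSet]; have := Q.len_pos; positivity

lemma volume_toSet_ne_top (Q : DyadicCube n) : volume Q.toSet ≠ ∞ := by
  rw [volume_toSet]; finiteness

lemma nonempty_toSet (Q : DyadicCube n) : Q.toSet.Nonempty :=
  nonempty_of_measure_ne_zero Q.volume_toSet_pos

lemma abs_sub_le_of_mem {Q : DyadicCube n} {x y : E n} (hx : x ∈ Q.toSet) (hy : y ∈ Q.toSet)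
    (i : Fin n) : |x i - y i| ≤ Q.len := by
  have h1 := hx i; have h2 := hy i
  rw [abs_le]; constructor <;> nlinarith

lemma dist_le_of_coord {x y : E n} {δ : ℝ} (hδ : 0 ≤ δ) (h : ∀ i, |x i - y i| ≤ δ) :
    dist x y ≤ n * δ := by
  rw [EuclideanSpace.dist_eq]
  have : ∑ i, dist (x i) (y i) ^ 2 ≤ (n * δ) ^ 2 := by
    calc ∑ i, dist (x i) (y i) ^ 2 ≤ ∑ _i : Fin n, δ ^ 2 := by
          refine Finset.sum_le_sum fun i _ => ?_
          rw [Real.dist_eq]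
          exact pow_le_pow_left₀ (abs_nonneg _) (h i) 2
      _ = n * δ ^ 2 := by simp
      _ ≤ (n * δ) ^ 2 := by
          rw [mul_pow]
          refine mul_le_mul_of_nonneg_right ?_ (by positivity)
          exact_mod_cast Nat.le_self_pow (by norm_num) n
  calc _ ≤ √((n * δ) ^ 2) := Real.sqrt_le_sqrt this
    _ = n * δ := Real.sqrt_sq (by positivity)

lemma abs_coord_le_dist (x y : E n) (i : Fin n) : |x i - y i| ≤ dist x y := by
  have := PiLp.norm_apply_le (x - y) i
  rwa [PiLp.sub_apply, Real.norm_eq_abs, ← dist_eq_norm] at this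

lemma isBounded_toSet (Q : DyadicCube n) : Bornology.IsBounded Q.toSet := by
  obtain ⟨x, hx⟩ := Q.nonempty_toSet
  refine (Metric.isBounded_closedBall (x := x) (r := n * Q.len)).subset fun y hy => ?_
  exact dist_le_of_coord Q.len_pos.le fun i => abs_sub_le_of_mem hy hx i

/-- Neighbours: the edge lengths differ at most by a factor `2`, and the closed intervals in each
coordinate meet. -/
lemma neighbor_iff {Q Q' : DyadicCube n} : Q.Neighbor Q' ↔
    (Q.level - 1 ≤ Q'.level ∧ Q'.level ≤ Q.level + 1) ∧
    ∀ i, Q.len * Q.corner i ≤ Q'.len * (Q'.corner i + 1) ∧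
      Q'.len * Q'.corner i ≤ Q.len * (Q.corner i + 1) := by
  have hlen : Q.len / Q'.len = (2 : ℝ) ^ (Q'.level - Q.level) := by
    unfold len
    rw [← zpow_sub₀ (by norm_num)]; congr 1; ring
  have h1 : (1 / 2 : ℝ) = 2 ^ (-1 : ℤ) := by norm_num
  have h2 : (2 : ℝ) ^ (Q'.level - Q.level) ≤ 2 ↔ Q'.level ≤ Q.level + 1 := by
    conv_lhs => rw [← zpow_one (2 : ℝ)]
    rw [← zpow_mul, one_mul, zpow_le_zpow_iff_right₀ (by norm_num)]
    omega
  unfold Neighbor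
  rw [hlen, h2, h1, zpow_le_zpow_iff_right₀ (by norm_num), ← and_assoc]
  refine and_congr ?_ ?_
  · constructor <;> rintro ⟨_, _⟩ <;> constructor <;> omega
  · constructor
    · rintro ⟨z, hz, hz'⟩ i
      rw [mem_closure_toSet] at hz hz'
      exact ⟨(hz i).1.trans (hz' i).2, (hz' i).1.trans (hz i).2⟩
    · intro h
      have hl := Q.len_pos
      have hl' := Q'.len_pos
      refine ⟨WithLp.toLp 2 fun i => max (Q.len * Q.corner i) (Q'.len * Q'.corner i), ?_, ?_⟩
      · rw [mem_closure_toSet]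
        exact fun i => ⟨le_max_left _ _, max_le (by nlinarith) (h i).2⟩
      · rw [mem_closure_toSet]
        exact fun i => ⟨le_max_right _ _, max_le (h i).1 (by nlinarith)⟩

lemma Neighbor.symm {Q Q' : DyadicCube n} (h : Q.Neighbor Q') : Q'.Neighbor Q := by
  rw [neighbor_iff] at h ⊢
  refine ⟨by omega, fun i => (h.2 i).symm⟩

lemma neighbor_self (Q : DyadicCube n) : Q.Neighbor Q := by
  rw [neighbor_iff]
  have := Q.len_pos
  refine ⟨by omega, fun i => ⟨by nlinarith, by nlinarith⟩⟩

lemma len_eq_two_mul {Q Q' : DyadicCube n} (h : Q.level = Q'.level + 1) : Q'.len = 2 * Q.len := by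
  unfold len
  rw [h, neg_add, zpow_add₀ (by norm_num)]; norm_num; ring

lemma Neighbor.len_le {Q Q' : DyadicCube n} (h : Q.Neighbor Q') : Q'.len ≤ 2 * Q.len := by
  have h1 := h.1
  rw [div_le_div_iff₀ (by norm_num) Q'.len_pos] at h1
  linarith

lemma Neighbor.volume_le {Q Q' : DyadicCube n} (h : Q.Neighbor Q') :
    volume Q'.toSet ≤ 2 ^ n * volume Q.toSet := by
  rw [volume_toSet, volume_toSet, ← mul_pow]
  gcongr
  calc ENNReal.ofReal Q'.len ≤ ENNReal.ofReal (2 * Q.len) := ENNReal.ofReal_le_ofReal h.len_le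
    _ = _ := by rw [ENNReal.ofReal_mul (by norm_num)]; norm_num

/-- Cubes that meet are neighbours if their levels differ by at most one. -/
lemma neighbor_of_mem {Q Q' : DyadicCube n} {x : E n} (hx : x ∈ Q.toSet) (hx' : x ∈ Q'.toSet)
    (h : Q.level - 1 ≤ Q'.level ∧ Q'.level ≤ Q.level + 1) : Q.Neighbor Q' := by
  rw [neighbor_iff]
  exact ⟨h, fun i => ⟨(hx i).1.le.trans (hx' i).2, (hx' i).1.le.trans (hx i).2⟩⟩

/-- Neighbours have one of three levels, and for each of these every coordinate of their corner is
confined to an integer interval with at most four elements. -/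
lemma finite_neighbors (Q : DyadicCube n) :
    ∃ t : Finset (DyadicCube n), (∀ Q', Q' ∈ t ↔ Q.Neighbor Q') ∧ t.card ≤ 3 * 4 ^ n := by
  classical
  let lo : ℤ → Fin n → ℤ := fun e i => ⌈(2 : ℝ) ^ e * Q.corner i - 1⌉
  let hi : ℤ → Fin n → ℤ := fun e i => ⌊(2 : ℝ) ^ e * (Q.corner i + 1)⌋
  let B : ℤ → Finset (DyadicCube n) := fun e =>
    (Fintype.piFinset fun i => Finset.Icc (lo e i) (hi e i)).image fun c => ⟨Q.level + e, c⟩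
  let T : Finset ℤ := Finset.Icc (-1) 1
  refine ⟨(T.biUnion B).filter fun Q' => Q.Neighbor Q', fun Q' => ?_, ?_⟩
  · rw [Finset.mem_filter, and_iff_right_iff_imp]
    intro h
    rw [neighbor_iff] at h
    obtain ⟨hl, hc⟩ := h
    rw [Finset.mem_biUnion]
    refine ⟨Q'.level - Q.level, by simp only [T, Finset.mem_Icc]; omega, ?_⟩
    simp only [B, Finset.mem_image, Fintype.mem_piFinset, Finset.mem_Icc]
    refine ⟨Q'.corner, fun i => ?_, DyadicCube.ext (by simp) rfl⟩
    have h2 : (0 : ℝ) < 2 ^ Q'.level := by positivity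
    have e1 : (2 : ℝ) ^ (Q'.level - Q.level) = 2 ^ Q'.level * Q.len := by
      rw [len, ← zpow_add₀ (by norm_num)]; rfl
    have e2 : (2 : ℝ) ^ Q'.level * Q'.len = 1 := by
      rw [len, ← zpow_add₀ (by norm_num)]; simp
    simp only [lo, hi, e1, Int.ceil_le, Int.le_floor]
    have h3 := mul_le_mul_of_nonneg_left (hc i).1 h2.le
    have h4 := mul_le_mul_of_nonneg_left (hc i).2 h2.le
    rw [← mul_assoc, ← mul_assoc, e2] at h3 h4
    constructor <;> linarith
  · refine (Finset.card_filter_le _ _).trans (Finset.card_biUnion_le.trans ?_)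
    have : ∀ e ∈ T, (B e).card ≤ 4 ^ n := by
      intro e he
      refine Finset.card_image_le.trans ?_
      rw [Fintype.card_piFinset]
      calc ∏ i, (Finset.Icc (lo e i) (hi e i)).card ≤ ∏ _i : Fin n, 4 := by
            refine Finset.prod_le_prod' fun i _ => ?_
            rw [Int.card_Icc]
            have he2 : (2 : ℝ) ^ e ≤ 2 := by
              simp only [T, Finset.mem_Icc] at he
              calc (2 : ℝ) ^ e ≤ 2 ^ (1 : ℤ) := zpow_le_zpow_right₀ (by norm_num) he.2
                _ = 2 := by norm_num
            have h5 : (2 : ℝ) ^ e * Q.corner i - 1 ≤ lo e i := Int.le_ceil _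
            have h6 : (hi e i : ℝ) ≤ 2 ^ e * (Q.corner i + 1) := Int.floor_le _
            have h7 : (hi e i : ℝ) ≤ (lo e i + 3 : ℤ) := by push_cast; linarith
            have := Int.cast_le.1 h7
            omega
        _ = 4 ^ n := by simp
    calc ∑ e ∈ T, (B e).card ≤ ∑ _e ∈ T, 4 ^ n := Finset.sum_le_sum this
      _ = 3 * 4 ^ n := by simp [T]

/-- The finite set of neighbours of a cube. -/
noncomputable def nbrs (Q : DyadicCube n) : Finset (DyadicCube n) := Q.finite_neighbors.choose

lemma mem_nbrs {Q Q' : DyadicCube n} : Q' ∈ Q.nbrs ↔ Q.Neighbor Q' :=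
  Q.finite_neighbors.choose_spec.1 Q'

lemma card_nbrs_le (Q : DyadicCube n) : Q.nbrs.card ≤ 3 * 4 ^ n :=
  Q.finite_neighbors.choose_spec.2

/-! ### Cubes in the half-space -/

variable {d : ℕ}

/-- The projection of a cube to the boundary. -/
def base (P : DyadicCube (d + 1)) : DyadicCube d := ⟨P.level, fun i => P.corner i.castSucc⟩

@[simp] lemma base_whitney (Q : DyadicCube d) : Q.whitney.base = Q := by
  ext <;> simp [base, whitney]

lemma whitney_len (Q : DyadicCube d) : Q.whitney.len = Q.len := rfl

lemma whitney_corner_last (Q : DyadicCube d) : Q.whitney.corner (Fin.last d) = 1 := by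
  simp [whitney]

lemma whitney_corner_castSucc (Q : DyadicCube d) (i : Fin d) :
    Q.whitney.corner i.castSucc = Q.corner i := by
  simp [whitney]

lemma Neighbor.base {P P' : DyadicCube (d + 1)} (h : P.Neighbor P') : P.base.Neighbor P'.base := by
  rw [neighbor_iff] at h ⊢
  exact ⟨h.1, fun i => h.2 i.castSucc⟩

lemma Neighbor.whitney {Q Q' : DyadicCube d} (h : Q.Neighbor Q') :
    Q.whitney.Neighbor Q'.whitney := by
  have h1 := h.len_le
  have h2 := h.symm.len_le
  rw [neighbor_iff] at h ⊢
  refine ⟨h.1, fun i => ?_⟩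
  refine Fin.lastCases ?_ (fun i => ?_) i
  · rw [whitney_corner_last, whitney_corner_last, whitney_len, whitney_len]
    push_cast
    constructor <;> linarith
  · rw [whitney_corner_castSucc, whitney_corner_castSucc]
    exact h.2 i

end DyadicCube

/-- The horizontal part of a point. -/
def base {d : ℕ} (y : E (d + 1)) : E d := WithLp.toLp 2 fun i => y i.castSucc

/-- The height of a point above the boundary. -/
def hgt {d : ℕ} (y : E (d + 1)) : ℝ := y (Fin.last d)

section
variable {d : ℕ}

@[simp] lemma base_apply (y : E (d + 1)) (i : Fin d) : base y i = y i.castSucc := rfl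

lemma mem_upperHalf {y : E (d + 1)} : y ∈ upperHalf d ↔ 0 < hgt y := Iff.rfl

@[fun_prop] lemma measurable_hgt : Measurable (hgt : E (d + 1) → ℝ) := by unfold hgt; fun_prop

@[fun_prop] lemma measurable_base : Measurable (base : E (d + 1) → E d) := by
  unfold base; fun_prop

lemma measurableSet_upperHalf : MeasurableSet (upperHalf d) :=
  measurableSet_lt measurable_const measurable_hgt

/-- The vertical side of a cube. -/
def DyadicCube.vert (P : DyadicCube (d + 1)) : Set ℝ :=
  Ioc (P.len * P.corner (Fin.last d)) (P.len * (P.corner (Fin.last d) + 1))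

lemma mem_toSet_iff_base {P : DyadicCube (d + 1)} {y : E (d + 1)} :
    y ∈ P.toSet ↔ base y ∈ P.base.toSet ∧ hgt y ∈ P.vert := by
  constructor
  · exact fun h => ⟨fun i => h i.castSucc, h (Fin.last d)⟩
  · exact fun h i => Fin.lastCases h.2 (fun i => h.1 i) i

lemma mem_whitney {Q : DyadicCube d} {y : E (d + 1)} :
    y ∈ Q.whitney.toSet ↔ base y ∈ Q.toSet ∧ hgt y ∈ Ioc Q.len (2 * Q.len) := by
  rw [mem_toSet_iff_base, base_whitney, vert, whitney_corner_last, whitney_len]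
  norm_num [mul_comm]

lemma toSet_subset_upperHalf_iff {P : DyadicCube (d + 1)} :
    P.toSet ⊆ upperHalf d ↔ 0 ≤ P.corner (Fin.last d) := by
  have hl := P.len_pos
  constructor
  · intro h
    by_contra hc
    push Not at hc
    obtain ⟨z, hz⟩ := P.nonempty_toSet
    have h1 : 0 < z (Fin.last d) := h hz
    have h2 := (hz (Fin.last d)).2
    have : ((P.corner (Fin.last d) : ℝ) + 1) ≤ 0 := by exact_mod_cast hc
    nlinarith
  · intro h y hy
    have h1 := (hy (Fin.last d)).1
    have : (0 : ℝ) ≤ P.corner (Fin.last d) := by exact_mod_cast h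
    have h3 : 0 ≤ P.len * P.corner (Fin.last d) := by positivity
    exact h3.trans_lt h1

lemma at'_subset_upperHalf {y : E (d + 1)} (hy : y ∈ upperHalf d) (k : ℤ) :
    (at' y k).toSet ⊆ upperHalf d := by
  rw [toSet_subset_upperHalf_iff]
  have h2 : (0 : ℝ) < 2 ^ k * y (Fin.last d) := mul_pos (by positivity) hy
  have := Int.ceil_pos.2 h2
  simp only [at']; omega

lemma whitney_subset_upperHalf (Q : DyadicCube d) : Q.whitney.toSet ⊆ upperHalf d := by
  rw [toSet_subset_upperHalf_iff, whitney_corner_last]; norm_num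

lemma at'_eq_whitney {y : E (d + 1)} {k : ℤ}
    (h : hgt y ∈ Ioc ((2 : ℝ) ^ (-k)) (2 * (2 : ℝ) ^ (-k))) :
    at' y k = (at' (base y) k).whitney := by
  have : y ∈ (at' (base y) k).whitney.toSet := mem_whitney.2 ⟨mem_at' _ _, h⟩
  rw [mem_toSet_iff] at this
  exact this

end

/-! ### Inequalities for extended nonnegative sums and integrals -/

section Jensen

variable {X : Type*} [MeasurableSpace X]

/-- Jensen's inequality. -/
lemma rpow_lintegral_le {μ : Measure X} {p : ℝ} (hp : 1 ≤ p) {f : X → ℝ≥0∞}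
    (hf : AEMeasurable f μ) :
    (∫⁻ x, f x ∂μ) ^ p ≤ μ univ ^ (p - 1) * ∫⁻ x, f x ^ p ∂μ := by
  have hp0 : 0 < p := by linarith
  have h := eLpNorm'_le_eLpNorm'_mul_rpow_measure_univ (μ := μ) (f := f) one_pos hp
    hf.aestronglyMeasurable
  simp only [eLpNorm', enorm_eq_self, ENNReal.rpow_one, div_one] at h
  calc (∫⁻ x, f x ∂μ) ^ p
      ≤ ((∫⁻ x, f x ^ p ∂μ) ^ (1 / p) * μ univ ^ (1 - 1 / p)) ^ p := by gcongr
    _ = _ := by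
      rw [ENNReal.mul_rpow_of_nonneg _ _ hp0.le, ← ENNReal.rpow_mul, ← ENNReal.rpow_mul,
        one_div_mul_cancel hp0.ne', ENNReal.rpow_one, mul_comm]
      congr 2
      field_simp

lemma rpow_setAverage_le {μ : Measure X} {s : Set X} {p : ℝ} (hp : 1 ≤ p) (h0 : μ s ≠ 0)
    (ht : μ s ≠ ∞) {f : X → ℝ≥0∞} (hf : AEMeasurable f μ) :
    ((∫⁻ x in s, f x ∂μ) / μ s) ^ p ≤ (∫⁻ x in s, f x ^ p ∂μ) / μ s := by
  have h := rpow_lintegral_le hp (hf.restrict (s := s))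
  rw [Measure.restrict_apply_univ] at h
  rw [ENNReal.div_rpow_of_nonneg _ _ (by linarith)]
  calc _ ≤ (μ s ^ (p - 1) * ∫⁻ x in s, f x ^ p ∂μ) / μ s ^ p := by gcongr
    _ = _ := by
      have : μ s ^ p = μ s ^ (p - 1) * μ s := by
        conv_rhs => rw [← ENNReal.rpow_one (μ s), ← ENNReal.rpow_mul, one_mul]
        rw [← ENNReal.rpow_add _ _ h0 ht]; ring_nf
      rw [this, ENNReal.mul_div_mul_left]
      · exact (ENNReal.rpow_pos (pos_iff_ne_zero.2 h0) ht).ne'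
      · exact ENNReal.rpow_ne_top_of_nonneg (by linarith) ht

lemma rpow_tsum_mul_le {p : ℝ} (hp : 1 ≤ p) (w c : ℕ → ℝ≥0∞) :
    (∑' i, w i * c i) ^ p ≤ (∑' i, w i) ^ (p - 1) * ∑' i, w i * c i ^ p := by
  have h := rpow_lintegral_le (μ := Measure.count.withDensity w) hp (f := c)
    Measurable.of_discrete.aemeasurable
  simp only [lintegral_withDensity_eq_lintegral_mul _ (Measurable.of_discrete (f := w))
    (Measurable.of_discrete), withDensity_apply _ MeasurableSet.univ, Pi.mul_apply,
    lintegral_count, Measure.restrict_univ] at h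
  exact h

lemma rpow_add_le {p : ℝ} (hp : 1 ≤ p) (a b : ℝ≥0∞) :
    (a + b) ^ p ≤ 2 ^ p * (a ^ p + b ^ p) := by
  refine (ENNReal.rpow_add_le_mul_rpow_add_rpow a b hp).trans ?_
  gcongr
  · norm_num
  · linarith

end Jensen

section Hardy

lemma tsum_pow_ne_top {r : ℝ≥0∞} (hr : r < 1) : ∑' i : ℕ, r ^ i ≠ ∞ := by
  rw [ENNReal.tsum_geometric]
  exact ENNReal.inv_ne_top.2 (tsub_pos_of_lt hr).ne'

lemma tsum_add_le (x : ℕ → ℝ≥0∞) (i : ℕ) : ∑' k, x (k + i) ≤ ∑' k, x k :=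
  ENNReal.tsum_comp_le_tsum_of_injective (add_left_injective i) x

/-- A discrete Hardy inequality: tails are controlled with geometrically growing weights. -/
lemma hardy {p : ℝ} (hp : 1 ≤ p) {W : ℝ≥0∞} (hW : 1 < W) (hW' : W ≠ ∞) :
    ∃ C : ℝ≥0, ∀ b : ℕ → ℝ≥0∞,
      ∑' k, W ^ k * (∑' i, b (k + i)) ^ p ≤ C * ∑' k, W ^ k * b k ^ p := by
  have hp0 : 0 < p := by linarith
  have hW0 : W ≠ 0 := (zero_lt_one.trans hW).ne'
  set r : ℝ≥0∞ := W ^ (-(1 / p)) with hr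
  have hr1 : r < 1 := ENNReal.rpow_lt_one_of_one_lt_of_neg hW (by simp; positivity)
  have hr0 : r ≠ 0 := by
    rw [hr]; exact (ENNReal.rpow_pos (pos_iff_ne_zero.2 hW0) hW').ne'
  have hrt : r ≠ ∞ := (hr1.trans ENNReal.one_lt_top).ne
  have hrp : r⁻¹ ^ p = W := by
    rw [hr, ENNReal.rpow_neg, inv_inv, ← ENNReal.rpow_mul, one_div_mul_cancel hp0.ne',
      ENNReal.rpow_one]
  set M := ∑' i : ℕ, r ^ i
  have hM : M ≠ ∞ := tsum_pow_ne_top hr1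
  have hC : M ^ (p - 1) * M ≠ ∞ :=
    ENNReal.mul_ne_top (ENNReal.rpow_ne_top_of_nonneg (by linarith) hM) hM
  refine ⟨(M ^ (p - 1) * M).toNNReal, fun b => ?_⟩
  rw [ENNReal.coe_toNNReal hC]
  have key : ∀ k, (∑' i, b (k + i)) ^ p ≤ M ^ (p - 1) * ∑' i, r ^ i * (W ^ i * b (k + i) ^ p) := by
    intro k
    have h := rpow_tsum_mul_le hp (fun i => r ^ i) (fun i => r⁻¹ ^ i * b (k + i))
    have e1 : ∀ i, r ^ i * (r⁻¹ ^ i * b (k + i)) = b (k + i) := fun i => by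
      rw [← mul_assoc, ← mul_pow, ENNReal.mul_inv_cancel hr0 hrt, one_pow, one_mul]
    have e2 : ∀ i, (r⁻¹ ^ i * b (k + i)) ^ p = W ^ i * b (k + i) ^ p := fun i => by
      rw [ENNReal.mul_rpow_of_nonneg _ _ hp0.le, ← hrp, ← ENNReal.rpow_natCast,
        ← ENNReal.rpow_natCast, ← ENNReal.rpow_mul, ← ENNReal.rpow_mul, mul_comm p]
    simp only [e1, e2] at h
    exact h
  calc ∑' k, W ^ k * (∑' i, b (k + i)) ^ p
      ≤ ∑' k, W ^ k * (M ^ (p - 1) * ∑' i, r ^ i * (W ^ i * b (k + i) ^ p)) := by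
        gcongr with k; exact key k
    _ = M ^ (p - 1) * ∑' i, r ^ i * ∑' k, W ^ (k + i) * b (k + i) ^ p := by
        simp_rw [← ENNReal.tsum_mul_left]
        rw [ENNReal.tsum_comm]
        congr 1; ext i; congr 1; ext k
        rw [pow_add]; ring
    _ ≤ M ^ (p - 1) * ∑' i, r ^ i * ∑' k, W ^ k * b k ^ p := by
        refine mul_le_mul_right (ENNReal.tsum_le_tsum fun i => mul_le_mul_right ?_ _) _
        exact tsum_add_le (fun k => W ^ k * b k ^ p) i
    _ = _ := by rw [ENNReal.tsum_mul_right, mul_assoc]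

/-- Shifting a sequence by `r` (truncated at `0`) costs only a constant in weighted sums. -/
lemma tsum_shift_le {W : ℝ≥0∞} (hW' : W ≠ ∞) (r : ℕ) :
    ∃ C : ℝ≥0, ∀ x : ℕ → ℝ≥0∞, ∑' k, W ^ k * x (k - r) ≤ C * ∑' k, W ^ k * x k := by
  induction r with
  | zero => exact ⟨1, fun x => by simp⟩
  | succ r ih =>
    obtain ⟨C, hC⟩ := ih
    refine ⟨C * (1 + W.toNNReal), fun x => ?_⟩
    have h := hC fun k => x (k - 1)
    simp only [Nat.sub_sub] at h
    refine h.trans ?_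
    push_cast
    rw [ENNReal.coe_toNNReal hW', mul_assoc]
    gcongr
    rw [tsum_eq_zero_add' ENNReal.summable, add_mul, one_mul]
    gcongr
    · simpa using ENNReal.le_tsum (f := fun k => W ^ k * x k) 0
    · rw [← ENNReal.tsum_mul_left]
      simp only [Nat.add_sub_cancel]
      refine le_of_eq (tsum_congr fun k => ?_)
      rw [pow_succ]; ring

/-- Summation over pairs `k ≤ j`, arranged by `k` and the difference `j - k`. -/
lemma tsum_conv (g : ℕ → ℕ → ℝ≥0∞) :
    ∑' j, ∑' k, (if k ≤ j then g k (j - k) else 0) = ∑' k, ∑' m, g k m := by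
  rw [ENNReal.tsum_comm]
  refine tsum_congr fun k => ?_
  have h : ∀ j ∉ Set.range (fun m => m + k), (if k ≤ j then g k (j - k) else 0) = 0 := by
    intro j hj
    rw [if_neg]
    exact fun h => hj ⟨j - k, by simp only; omega⟩
  rw [← (add_left_injective k).tsum_eq (f := fun j => if k ≤ j then g k (j - k) else 0)]
  · simp
  · intro j hj
    by_contra hc
    exact hj (h j hc)

lemma tsum_pow_dist_le (r : ℝ≥0∞) (i : ℕ) :
    ∑' k : ℕ, r ^ ((k - i) + (i - k)) ≤ (r + 1) * ∑' k : ℕ, r ^ k := by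
  rw [← ENNReal.summable.sum_add_tsum_nat_add' (k := i), add_mul, one_mul]
  refine add_le_add ?_ ?_
  · rw [← Finset.sum_range_reflect, ← ENNReal.tsum_mul_left]
    calc ∑ j ∈ Finset.range i, r ^ (i - 1 - j - i + (i - (i - 1 - j)))
        = ∑ j ∈ Finset.range i, r * r ^ j := by
          refine Finset.sum_congr rfl fun j hj => ?_
          rw [Finset.mem_range] at hj
          rw [show i - 1 - j - i + (i - (i - 1 - j)) = j + 1 by omega, pow_succ, mul_comm]
      _ ≤ _ := ENNReal.sum_le_tsum _
  · refine le_of_eq (tsum_congr fun k => ?_)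
    congr 1; omega

end Hardy

section lq

variable {ι : Type}

lemma le_lqNorm {q : ℝ≥0∞} (hq : 0 < q) (a : ι → ℝ≥0∞) (i : ι) : a i ≤ lqNorm q a := by
  unfold lqNorm
  split_ifs with h
  · exact le_iSup a i
  · have hq' : 0 < q.toReal := ENNReal.toReal_pos hq.ne' h
    calc a i = (a i ^ q.toReal) ^ (1 / q.toReal) := by
          rw [← ENNReal.rpow_mul, mul_one_div_cancel hq'.ne', ENNReal.rpow_one]
      _ ≤ _ := by gcongr; exact ENNReal.le_tsum i

lemma lqNorm_top (a : ι → ℝ≥0∞) : lqNorm ∞ a = ⨆ i, a i := if_pos rfl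

lemma lqNorm_ofReal_rpow {p : ℝ} (hp : 0 < p) (a : ι → ℝ≥0∞) :
    lqNorm (ENNReal.ofReal p) a ^ p = ∑' i, a i ^ p := by
  rw [lqNorm, if_neg ENNReal.ofReal_ne_top, ENNReal.toReal_ofReal hp.le, ← ENNReal.rpow_mul,
    one_div_mul_cancel hp.ne', ENNReal.rpow_one]

lemma lqNorm_ofReal {p : ℝ} (hp : 0 < p) (a : ι → ℝ≥0∞) :
    lqNorm (ENNReal.ofReal p) a = (∑' i, a i ^ p) ^ (1 / p) := by
  rw [lqNorm, if_neg ENNReal.ofReal_ne_top, ENNReal.toReal_ofReal hp.le]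

/-- Sequences dominated by a fixed `q`-summable profile. -/
lemma lqNorm_le_mul {q : ℝ≥0∞} (hq : 0 < q) {a w : ι → ℝ≥0∞} {M : ℝ≥0∞}
    (h : ∀ i, a i ≤ w i * M) : lqNorm q a ≤ lqNorm q w * M := by
  unfold lqNorm
  split_ifs with hq'
  · refine iSup_le fun i => (h i).trans ?_
    gcongr
    exact le_iSup w i
  · have hq'' : 0 < q.toReal := ENNReal.toReal_pos hq.ne' hq'
    calc (∑' i, a i ^ q.toReal) ^ (1 / q.toReal)
        ≤ (∑' i, w i ^ q.toReal * M ^ q.toReal) ^ (1 / q.toReal) := by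
          gcongr with i
          rw [← ENNReal.mul_rpow_of_nonneg _ _ hq''.le]
          gcongr; exact h i
      _ = _ := by
          rw [ENNReal.tsum_mul_right, ENNReal.mul_rpow_of_nonneg _ _ (by positivity),
            ← ENNReal.rpow_mul M, mul_one_div_cancel hq''.ne', ENNReal.rpow_one]

lemma lqNorm_one_le (q : ℝ≥0∞) (N : ℕ) : ∃ C : ℝ≥0, ∀ (ι : Type) [Finite ι],
    Nat.card ι ≤ N → lqNorm q (fun _ : ι => 1) ≤ C := by
  refine ⟨1 + (N : ℝ≥0) ^ (1 / q.toReal), fun ι _ h => ?_⟩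
  unfold lqNorm
  split_ifs with hq
  · exact iSup_le fun _ => by push_cast; exact le_self_add
  · simp only [ENNReal.one_rpow, ENNReal.tsum_one]
    have := Fintype.ofFinite ι
    rw [ENat.card_eq_coe_fintype_card, ← Nat.card_eq_fintype_card]
    calc ((Nat.card ι : ℕ∞) : ℝ≥0∞) ^ (1 / q.toReal) ≤ (N : ℝ≥0∞) ^ (1 / q.toReal) := by
          gcongr
          simpa using h
      _ ≤ _ := by
          push_cast
          rw [ENNReal.coe_rpow_of_nonneg _ (by positivity)]
          simp

/-- Sequences that decay geometrically away from the index `i`. -/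
lemma lqNorm_geom_le {q : ℝ≥0∞} (hq : 0 < q) {r : ℝ≥0∞} (hr : r < 1) :
    ∃ C : ℝ≥0, ∀ i : ℕ, lqNorm q (fun k : ℕ => r ^ ((k - i) + (i - k))) ≤ C := by
  by_cases hq' : q = ∞
  · refine ⟨1, fun i => ?_⟩
    rw [hq', lqNorm_top]
    exact iSup_le fun k => pow_le_one₀ (by simp) hr.le
  · have hq'' : 0 < q.toReal := ENNReal.toReal_pos hq.ne' hq'
    have hrq : r ^ q.toReal < 1 := ENNReal.rpow_lt_one hr hq''
    have hfin : ((r ^ q.toReal + 1) * ∑' k : ℕ, (r ^ q.toReal) ^ k) ^ (1 / q.toReal) ≠ ∞ := by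
      refine ENNReal.rpow_ne_top_of_nonneg (by positivity) (ENNReal.mul_ne_top ?_
        (tsum_pow_ne_top hrq))
      exact ENNReal.add_ne_top.2 ⟨(hrq.trans ENNReal.one_lt_top).ne, ENNReal.one_ne_top⟩
    refine ⟨_, fun i => le_trans ?_ (ENNReal.coe_toNNReal hfin).ge⟩
    rw [lqNorm, if_neg hq']
    gcongr
    refine le_trans (le_of_eq (tsum_congr fun k => ?_)) (tsum_pow_dist_le _ i)
    rw [← ENNReal.rpow_natCast, ← ENNReal.rpow_natCast, ← ENNReal.rpow_mul, ← ENNReal.rpow_mul,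
      mul_comm]

end lq

section Average

variable {X : Type*} [MeasurableSpace X] {μ : Measure X}

lemma enorm_setAverage_sub_le {s : Set X} (h0 : μ s ≠ 0) (ht : μ s ≠ ∞) {f : X → ℂ}
    (hf : IntegrableOn f s μ) (c : ℂ) :
    ‖(⨍ x in s, f x ∂μ) - c‖ₑ ≤ (∫⁻ x in s, ‖f x - c‖ₑ ∂μ) / μ s := by
  have hc : IntegrableOn (fun _ => c) s μ := integrableOn_const ht
  have e : (⨍ x in s, f x ∂μ) - c = ⨍ x in s, (f x - c) ∂μ := by
    rw [setAverage_eq, setAverage_eq, integral_sub hf hc, smul_sub, setIntegral_const, smul_smul,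
      inv_mul_cancel₀, one_smul]
    exact (ENNReal.toReal_pos h0 ht).ne'
  rw [e, setAverage_eq, enorm_smul, mul_comm]
  have e2 : ‖(μ.real s)⁻¹‖ₑ = (μ s)⁻¹ := by
    rw [Measure.real, enorm_inv (ENNReal.toReal_pos h0 ht).ne',
      Real.enorm_eq_ofReal ENNReal.toReal_nonneg, ENNReal.ofReal_toReal ht]
  rw [e2, div_eq_mul_inv]
  gcongr
  exact enorm_integral_le_lintegral_enorm _

lemma enorm_setAverage_le {s : Set X} (h0 : μ s ≠ 0) (ht : μ s ≠ ∞) (f : X → ℂ) :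
    ‖⨍ x in s, f x ∂μ‖ₑ ≤ (∫⁻ x in s, ‖f x‖ₑ ∂μ) / μ s := by
  rw [setAverage_eq, enorm_smul, mul_comm]
  have e2 : ‖(μ.real s)⁻¹‖ₑ = (μ s)⁻¹ := by
    rw [Measure.real, enorm_inv (ENNReal.toReal_pos h0 ht).ne',
      Real.enorm_eq_ofReal ENNReal.toReal_nonneg, ENNReal.ofReal_toReal ht]
  rw [e2, div_eq_mul_inv]
  gcongr
  exact enorm_integral_le_lintegral_enorm _

lemma setAverage_sub {s : Set X} {f g : X → ℂ} (hf : IntegrableOn f s μ)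
    (hg : IntegrableOn g s μ) :
    ⨍ x in s, (f x - g x) ∂μ = (⨍ x in s, f x ∂μ) - ⨍ x in s, g x ∂μ := by
  rw [setAverage_eq, setAverage_eq, setAverage_eq, integral_sub hf hg, smul_sub]

end Average

/-! ### Sums over dyadic cubes -/

section Cubes

variable {n : ℕ}

lemma lintegral_eq_tsum_level (μ : Measure (E n)) (k : ℤ) (g : E n → ℝ≥0∞) :
    ∫⁻ x, g x ∂μ = ∑' Q : {Q : DyadicCube n // Q.level = k}, ∫⁻ x in Q.1.toSet, g x ∂μ := by
  rw [← lintegral_iUnion]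
  · rw [show (⋃ Q : {Q : DyadicCube n // Q.level = k}, Q.1.toSet) = univ from
      eq_univ_of_forall fun x => mem_iUnion.2 ⟨⟨at' x k, rfl⟩, mem_at' x k⟩, Measure.restrict_univ]
  · exact fun Q => measurableSet_toSet _
  · intro Q Q' h
    exact disjoint_toSet (Q.2.trans Q'.2.symm) fun h' => h (Subtype.ext h')

lemma lintegral_at' (μ : Measure (E n)) (k : ℤ) (F : DyadicCube n → ℝ≥0∞) :
    ∫⁻ x, F (at' x k) ∂μ = ∑' Q : {Q : DyadicCube n // Q.level = k}, F Q.1 * μ Q.1.toSet := by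
  rw [lintegral_eq_tsum_level μ k]
  refine tsum_congr fun Q => ?_
  rw [← setLIntegral_const]
  refine setLIntegral_congr_fun (measurableSet_toSet _) fun x hx => ?_
  have h := mem_toSet_iff.1 hx
  rw [Q.2] at h
  simp only [h]

/-- Averaging a function over the neighbours of the cube around `x`, and then integrating in `x`,
costs only a dimensional constant. -/
lemma lintegral_sum_nbrs_le (n : ℕ) : ∃ C : ℝ≥0, ∀ (k : ℤ) (g : E n → ℝ≥0∞),
    ∫⁻ x, ∑ Q' ∈ (at' x k).nbrs, (∫⁻ y in Q'.toSet, g y) / volume Q'.toSet ≤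
      C * ∫⁻ x, g x := by
  classical
  refine ⟨2 ^ n * (3 * (3 * 4 ^ n)), fun k g => ?_⟩
  set I : DyadicCube n → ℝ≥0∞ := fun Q => ∫⁻ y in Q.toSet, g y
  rw [lintegral_at' volume k fun Q => ∑ Q' ∈ Q.nbrs, I Q' / volume Q'.toSet]
  have h1 : ∀ Q : DyadicCube n, (∑ Q' ∈ Q.nbrs, I Q' / volume Q'.toSet) * volume Q.toSet ≤
      2 ^ n * ∑' Q', (if Q.Neighbor Q' then I Q' else 0) := by
    intro Q
    have e : ∑' Q', (if Q.Neighbor Q' then I Q' else 0) = ∑ Q' ∈ Q.nbrs, I Q' := by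
      rw [tsum_eq_sum (s := Q.nbrs)]
      · exact Finset.sum_congr rfl fun Q' h => if_pos (mem_nbrs.1 h)
      · exact fun Q' h => if_neg fun h' => h (mem_nbrs.2 h')
    rw [e, Finset.sum_mul, Finset.mul_sum]
    refine Finset.sum_le_sum fun Q' hQ' => ?_
    have h2 := (mem_nbrs.1 hQ').symm.volume_le
    calc I Q' / volume Q'.toSet * volume Q.toSet
        ≤ I Q' / volume Q'.toSet * (2 ^ n * volume Q'.toSet) := by gcongr
      _ = 2 ^ n * (I Q' / volume Q'.toSet * volume Q'.toSet) := by ring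
      _ = 2 ^ n * I Q' := by
        rw [ENNReal.div_mul_cancel (volume_toSet_pos _) (volume_toSet_ne_top _)]
  calc _ ≤ ∑' Q : {Q : DyadicCube n // Q.level = k},
        2 ^ n * ∑' Q', (if Q.1.Neighbor Q' then I Q' else 0) := ENNReal.tsum_le_tsum fun Q => h1 Q.1
    _ = 2 ^ n * ∑' Q', ∑' Q : {Q : DyadicCube n // Q.level = k},
        (if Q.1.Neighbor Q' then I Q' else 0) := by rw [ENNReal.tsum_mul_left, ENNReal.tsum_comm]
    _ ≤ 2 ^ n * ∑' Q' : DyadicCube n,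
        (if Q'.level ∈ Finset.Icc (k - 1) (k + 1) then (3 * 4 ^ n) * I Q' else 0) := by
        gcongr with Q'
        by_cases hl : Q'.level ∈ Finset.Icc (k - 1) (k + 1)
        · rw [if_pos hl]
          calc _ ≤ ∑' Q : DyadicCube n, (if Q.Neighbor Q' then I Q' else 0) :=
                ENNReal.tsum_comp_le_tsum_of_injective Subtype.val_injective
                  fun Q : DyadicCube n => if Q.Neighbor Q' then I Q' else 0
            _ = ∑ Q ∈ Q'.nbrs, I Q' := by
                rw [tsum_eq_sum (s := Q'.nbrs)]
                · exact Finset.sum_congr rfl fun Q h => if_pos (mem_nbrs.1 h).symm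
                · exact fun Q h => if_neg fun h' => h (mem_nbrs.2 h'.symm)
            _ ≤ _ := by
                rw [Finset.sum_const, nsmul_eq_mul]
                gcongr
                exact_mod_cast Q'.card_nbrs_le
        · rw [if_neg hl]
          refine le_of_eq (ENNReal.tsum_eq_zero.2 fun Q => if_neg fun h => hl ?_)
          have := (neighbor_iff.1 h).1
          rw [Q.2] at this
          exact Finset.mem_Icc.2 this
    _ = 2 ^ n * ∑ l ∈ Finset.Icc (k - 1) (k + 1), (3 * 4 ^ n) * ∫⁻ x, g x := by
        congr 1
        rw [← (equivProd n).symm.tsum_eq, ENNReal.tsum_prod', tsum_eq_sum (s := Finset.Icc (k - 1) (k + 1))]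
        · refine Finset.sum_congr rfl fun l hl => ?_
          rw [lintegral_eq_tsum_level volume l g, ← (levelEquiv n l).tsum_eq, ← ENNReal.tsum_mul_left]
          refine tsum_congr fun c => ?_
          have : ((equivProd n).symm (l, c)).level = l := rfl
          rw [this, if_pos hl]
          rfl
        · intro l hl
          refine ENNReal.tsum_eq_zero.2 fun c => if_neg hl
    _ = _ := by
        rw [Finset.sum_const, Int.card_Icc, show (k + 1 + 1 - (k - 1)).toNat = 3 by omega]
        push_cast
        rw [nsmul_eq_mul]; push_cast; ring

end Cubes

/-! ### Oscillations -/

section Osc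

variable {n : ℕ} {Ω : Set (E n)} {μ : Measure (E n)} {f : E n → ℂ}

lemma enorm_sub_le_osc {q : ℝ≥0∞} (hq : 0 < q) {Q Q' : DyadicCube n} (h : Q.Neighbor Q')
    (hΩ : Q'.toSet ⊆ Ω) :
    ‖(⨍ y in Q.toSet, f y ∂μ) - ⨍ y in Q'.toSet, f y ∂μ‖ₑ ≤ osc Ω μ q f Q :=
  le_lqNorm hq (fun Q' : {Q' : DyadicCube n // Q.Neighbor Q' ∧ Q'.toSet ⊆ Ω} =>
    ‖(⨍ y in Q.toSet, f y ∂μ) - ⨍ y in Q'.1.toSet, f y ∂μ‖ₑ) ⟨Q', h, hΩ⟩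

lemma osc_top_le {B : ℝ≥0∞} {Q : DyadicCube n}
    (h : ∀ Q' : DyadicCube n, Q.Neighbor Q' → Q'.toSet ⊆ Ω →
      ‖(⨍ y in Q.toSet, f y ∂μ) - ⨍ y in Q'.toSet, f y ∂μ‖ₑ ≤ B) : osc Ω μ ∞ f Q ≤ B := by
  unfold osc
  rw [lqNorm_top]
  exact iSup_le fun Q' => h Q'.1 Q'.2.1 Q'.2.2

lemma osc_top_le_osc {q : ℝ≥0∞} (hq : 0 < q) (Q : DyadicCube n) :
    osc Ω μ ∞ f Q ≤ osc Ω μ q f Q :=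
  osc_top_le fun _ h hΩ => enorm_sub_le_osc hq h hΩ

/-- All the quasinorms of the finitely many oscillations around a cube are comparable. -/
lemma osc_le_osc_top (n : ℕ) {q : ℝ≥0∞} (hq : 0 < q) : ∃ C : ℝ≥0, ∀ (Ω : Set (E n))
    (μ : Measure (E n)) (f : E n → ℂ) (Q : DyadicCube n),
    osc Ω μ q f Q ≤ C * osc Ω μ ∞ f Q := by
  obtain ⟨C, hC⟩ := lqNorm_one_le q (3 * 4 ^ n)
  refine ⟨C, fun Ω μ f Q => ?_⟩
  have hfin : Finite {Q' : DyadicCube n // Q.Neighbor Q'} :=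
    Finite.of_equiv Q.nbrs (Equiv.subtypeEquivRight fun Q' => mem_nbrs)
  have hinj : Function.Injective (fun Q' : {Q' : DyadicCube n // Q.Neighbor Q' ∧ Q'.toSet ⊆ Ω} =>
      (⟨Q'.1, Q'.2.1⟩ : {Q' : DyadicCube n // Q.Neighbor Q'})) := by
    intro a b h
    simpa [Subtype.ext_iff] using h
  have hfin' : Finite {Q' : DyadicCube n // Q.Neighbor Q' ∧ Q'.toSet ⊆ Ω} :=
    Finite.of_injective _ hinj
  have hcard : Nat.card {Q' : DyadicCube n // Q.Neighbor Q' ∧ Q'.toSet ⊆ Ω} ≤ 3 * 4 ^ n := by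
    refine (Nat.card_le_card_of_injective _ hinj).trans ?_
    rw [← Nat.card_congr (Equiv.subtypeEquivRight fun Q' => mem_nbrs (Q := Q) (Q' := Q'))]
    simpa using Q.card_nbrs_le
  have h := lqNorm_le_mul hq (w := fun _ => 1) (M := osc Ω μ ∞ f Q)
    (a := fun Q' : {Q' : DyadicCube n // Q.Neighbor Q' ∧ Q'.toSet ⊆ Ω} =>
      ‖(⨍ y in Q.toSet, f y ∂μ) - ⨍ y in Q'.1.toSet, f y ∂μ‖ₑ)
    fun Q' => by rw [one_mul]; exact enorm_sub_le_osc (by simp) Q'.2.1 Q'.2.2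
  exact h.trans (by gcongr; exact hC _ hcard)

lemma osc_congr {g : E n → ℂ} (h : f =ᵐ[μ] g) (q : ℝ≥0∞) (Q : DyadicCube n) :
    osc Ω μ q f Q = osc Ω μ q g Q := by
  have : ∀ s : Set (E n), ⨍ y in s, f y ∂μ = ⨍ y in s, g y ∂μ := fun s => by
    rw [setAverage_eq, setAverage_eq, integral_congr_ae (ae_restrict_of_ae h)]
  unfold osc
  simp_rw [this]

/-- The Besov quasinorm with both exponents equal to `p`, as an integral of oscillations. -/
lemma besovNorm_eq {σ p : ℝ} (hp : 0 < p) (f : E n → ℂ) :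
    besovNorm univ volume σ (ENNReal.ofReal p) (ENNReal.ofReal p) f =
      eLpNorm f (ENNReal.ofReal p) volume +
        (∑' k : ℕ, (2 ^ (σ * p)) ^ k *
          ∫⁻ x, osc univ volume (ENNReal.ofReal p) f (at' x k) ^ p) ^ (1 / p) := by
  unfold besovNorm
  rw [Measure.restrict_univ, lqNorm_ofReal hp]
  congr 2
  refine tsum_congr fun k => ?_
  rw [ENNReal.mul_rpow_of_nonneg _ _ hp.le, lqNorm_ofReal_rpow hp,
    lintegral_at' volume k fun Q => osc univ volume (ENNReal.ofReal p) f Q ^ p]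
  congr 1
  · rw [← ENNReal.rpow_mul, ← ENNReal.rpow_natCast, ← ENNReal.rpow_mul]
    congr 1; ring
  · rw [← (Equiv.subtypeEquivRight fun Q : DyadicCube n =>
      (show Q.level = (k : ℤ) ∧ Q.toSet ⊆ univ ↔ Q.level = (k : ℤ) by simp)).symm.tsum_eq]
    refine tsum_congr fun Q => ?_
    rw [ENNReal.mul_rpow_of_nonneg _ _ hp.le, ENNReal.toReal_ofReal hp.le, ← ENNReal.rpow_mul,
      one_div_mul_cancel hp.ne', ENNReal.rpow_one, mul_comm]
    rfl

end Osc

/-! ### The weighted measure as a product -/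

/-- The measure `min(1, t)^α dt` on the half-line. -/
noncomputable def nu (α : ℝ) : Measure ℝ :=
  (volume.restrict (Ioi 0)).withDensity fun t => ENNReal.ofReal ((min 1 |t|) ^ α)

instance (α : ℝ) : SFinite (nu α) := by unfold nu; infer_instance

section Nu

variable {α : ℝ}

lemma nu_Ioc {a b : ℝ} (ha : 0 ≤ a) :
    nu α (Ioc a b) = ∫⁻ t in Ioc a b, ENNReal.ofReal ((min 1 |t|) ^ α) := by
  rw [nu, withDensity_apply _ measurableSet_Ioc, Measure.restrict_restrict measurableSet_Ioc,
    inter_eq_left.2 (Ioc_subset_Ioi_self.trans (Ioi_subset_Ioi ha))]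

lemma nu_Ioc_of_le_one (hα : -1 < α) {a b : ℝ} (ha : 0 ≤ a) (hab : a ≤ b) (hb : b ≤ 1) :
    nu α (Ioc a b) = ENNReal.ofReal ((b ^ (α + 1) - a ^ (α + 1)) / (α + 1)) := by
  have hI : IntegrableOn (fun t : ℝ => t ^ α) (Ioc a b) := by
    rw [← intervalIntegrable_iff_integrableOn_Ioc_of_le hab]
    exact intervalIntegral.intervalIntegrable_rpow' hα
  rw [nu_Ioc ha, ← integral_rpow (Or.inl hα), intervalIntegral.integral_of_le hab,
    ofReal_integral_eq_lintegral_ofReal hI]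
  · refine setLIntegral_congr_fun measurableSet_Ioc fun t ht => ?_
    have h0 : 0 < t := ha.trans_lt ht.1
    simp only [abs_of_pos h0, min_eq_right (ht.2.trans hb)]
  · filter_upwards [ae_restrict_mem measurableSet_Ioc] with t ht
    exact Real.rpow_nonneg (ha.trans ht.1.le) _

lemma nu_Ioc_of_one_le {a b : ℝ} (ha : 1 ≤ a) : nu α (Ioc a b) = ENNReal.ofReal (b - a) := by
  rw [nu_Ioc (by linarith), ← Real.volume_Ioc, ← setLIntegral_one]
  refine setLIntegral_congr_fun measurableSet_Ioc fun t ht => ?_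
  have h0 : 1 < t := ha.trans_lt ht.1
  simp only [abs_of_pos (zero_lt_one.trans h0), min_eq_left h0.le]
  simp

lemma nu_Ioc_ne_top (hα : -1 < α) {a b : ℝ} (ha : 0 ≤ a) : nu α (Ioc a b) ≠ ∞ := by
  have h : Ioc a b ⊆ Ioc 0 1 ∪ Ioc 1 b := by
    intro t ht
    rcases le_or_gt t 1 with h | h
    · exact Or.inl ⟨ha.trans_lt ht.1, h⟩
    · exact Or.inr ⟨h, ht.2⟩
  refine ne_top_of_le_ne_top ?_ ((measure_mono h).trans (measure_union_le _ _))
  rw [nu_Ioc_of_le_one hα le_rfl zero_le_one le_rfl, nu_Ioc_of_one_le le_rfl]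
  finiteness

lemma nu_Ioc_ne_zero {a b : ℝ} (ha : 0 ≤ a) (hab : a < b) : nu α (Ioc a b) ≠ 0 := by
  rw [nu_Ioc ha, ← pos_iff_ne_zero, setLIntegral_pos_iff (by fun_prop)]
  refine lt_of_lt_of_le (by simpa using hab : 0 < volume (Ioc a b)) (measure_mono fun t ht => ⟨?_, ht⟩)
  have h0 : 0 < t := ha.trans_lt ht.1
  rw [Function.mem_support, ← pos_iff_ne_zero, ENNReal.ofReal_pos]
  exact Real.rpow_pos_of_pos (lt_min one_pos (abs_pos.2 h0.ne')) _

lemma ofReal_zpow_neg_rpow (j : ℕ) (β : ℝ) :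
    ENNReal.ofReal (((2 : ℝ) ^ (-(j : ℤ))) ^ β) = ((2 : ℝ≥0∞) ^ (-β)) ^ j := by
  rw [← ENNReal.rpow_natCast, ← ENNReal.rpow_mul, ← Real.rpow_intCast, ← Real.rpow_mul (by norm_num),
    ← ENNReal.ofReal_rpow_of_pos (by norm_num)]
  norm_num [mul_comm]

/-- The measure of the dyadic strip at height `2^{-j}` scales like `2^{-j(α+1)}` below the height
`1`, where the weight is a power. -/
lemma nu_strip_eq (hα : -1 < α) {j : ℕ} (hj : j ≠ 0) :
    nu α (Ioc ((2 : ℝ) ^ (-(j : ℤ))) (2 * (2 : ℝ) ^ (-(j : ℤ)))) =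
      ENNReal.ofReal ((2 ^ (α + 1) - 1) / (α + 1)) * ((2 : ℝ≥0∞) ^ (-(α + 1))) ^ j := by
  have h2 : (1 : ℝ) < 2 ^ (α + 1) := Real.one_lt_rpow (by norm_num) (by linarith)
  have hj2 : (2 : ℝ) * (2 : ℝ) ^ (-(j : ℤ)) ≤ 1 := by
    rw [← zpow_one_add₀ (by norm_num)]
    exact zpow_le_one_of_nonpos₀ (by norm_num) (by omega)
  have hp : (0 : ℝ) < (2 : ℝ) ^ (-(j : ℤ)) := by positivity
  rw [nu_Ioc_of_le_one hα hp.le (by linarith) hj2, Real.mul_rpow (by norm_num) hp.le,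
    show ((2 : ℝ) ^ (α + 1) * ((2 : ℝ) ^ (-(j : ℤ))) ^ (α + 1) - ((2 : ℝ) ^ (-(j : ℤ))) ^ (α + 1))
      / (α + 1) = (2 ^ (α + 1) - 1) / (α + 1) * ((2 : ℝ) ^ (-(j : ℤ))) ^ (α + 1) by ring,
    ENNReal.ofReal_mul (div_nonneg (by linarith) (by linarith)), ofReal_zpow_neg_rpow]

lemma nu_strip_zero : nu α (Ioc ((2 : ℝ) ^ (-((0 : ℕ) : ℤ))) (2 * (2 : ℝ) ^ (-((0 : ℕ) : ℤ)))) = 1 := by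
  norm_num [nu_Ioc_of_one_le]

lemma le_nu_strip (hα : -1 < α) : ∃ C : ℝ≥0, ∀ j : ℕ, ((2 : ℝ≥0∞) ^ (-(α + 1))) ^ j ≤
    C * nu α (Ioc ((2 : ℝ) ^ (-(j : ℤ))) (2 * (2 : ℝ) ^ (-(j : ℤ)))) := by
  have h2 : (1 : ℝ) < 2 ^ (α + 1) := Real.one_lt_rpow (by norm_num) (by linarith)
  have hc : 0 < (2 ^ (α + 1) - 1) / (α + 1) := div_pos (by linarith) (by linarith)
  set c : ℝ≥0 := Real.toNNReal ((2 ^ (α + 1) - 1) / (α + 1)) with hcdef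
  have h0 : c ≠ 0 := by simpa [hcdef] using hc
  refine ⟨1 + c⁻¹, fun j => ?_⟩
  rcases eq_or_ne j 0 with rfl | hj
  · rw [nu_strip_zero]
    simp
  · rw [nu_strip_eq hα hj, ← mul_assoc]
    refine le_mul_of_one_le_left (by simp) ?_
    change 1 ≤ ((1 + c⁻¹ : ℝ≥0) : ℝ≥0∞) * (c : ℝ≥0∞)
    rw [ENNReal.coe_add, ENNReal.coe_inv h0, add_mul,
      ENNReal.inv_mul_cancel (by simpa using h0) ENNReal.coe_ne_top]
    exact le_add_self

lemma nu_strip_le (hα : -1 < α) : ∃ C : ℝ≥0, ∀ j : ℕ,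
    nu α (Ioc ((2 : ℝ) ^ (-(j : ℤ))) (2 * (2 : ℝ) ^ (-(j : ℤ)))) ≤
      C * ((2 : ℝ≥0∞) ^ (-(α + 1))) ^ j := by
  refine ⟨1 + (Real.toNNReal ((2 ^ (α + 1) - 1) / (α + 1))), fun j => ?_⟩
  rcases eq_or_ne j 0 with rfl | hj
  · rw [nu_strip_zero]
    simp
  · rw [nu_strip_eq hα hj]
    gcongr
    push_cast
    exact le_add_self

end Nu

section Split

variable {d : ℕ}

lemma measurePreserving_split_volume : MeasurePreserving (fun y : E (d + 1) => (base y, hgt y))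
    volume (volume.prod volume) := by
  have h1 := EuclideanSpace.volume_preserving_symm_measurableEquiv_toLp (Fin (d + 1))
  have h2 := volume_preserving_piFinSuccAbove (fun _ : Fin (d + 1) => ℝ) (Fin.last d)
  have h3 : MeasurePreserving (Prod.swap : ℝ × (Fin d → ℝ) → (Fin d → ℝ) × ℝ)
    (volume.prod volume) (volume.prod volume) := Measure.measurePreserving_swap
  have h4 := ((EuclideanSpace.volume_preserving_symm_measurableEquiv_toLp (Fin d)).symm).prod
    (MeasurePreserving.id (volume : Measure ℝ))
  have h := (h4.comp h3).comp (h2.comp h1)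
  have e : (fun y : E (d + 1) => (base y, hgt y)) =
      (Prod.map (MeasurableEquiv.toLp 2 (Fin d → ℝ)).symm.symm id ∘ Prod.swap) ∘
      (MeasurableEquiv.piFinSuccAbove (fun _ => ℝ) (Fin.last d)) ∘
      (MeasurableEquiv.toLp 2 (Fin (d + 1) → ℝ)).symm := by
    funext y
    refine Prod.ext (PiLp.ext fun i => ?_) rfl
    simp [MeasurableEquiv.piFinSuccAbove, Fin.insertNthEquiv, Fin.init, base]
  rw [e]
  exact h

/-- Splitting a point of the half-space into its horizontal part and its height turns the weighted
measure into a product. -/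
lemma measurePreserving_split (α : ℝ) : MeasurePreserving (fun y : E (d + 1) => (base y, hgt y))
    (muAlpha d α) (volume.prod (nu α)) := by
  have hm : Measurable fun y : E (d + 1) => (base y, hgt y) := by fun_prop
  have hw : Measurable fun t : ℝ => ENNReal.ofReal ((min 1 |t|) ^ α) := by fun_prop
  refine ⟨hm, ?_⟩
  rw [nu, prod_withDensity_right₀ hw.aemeasurable]
  have h1 := measurePreserving_split_volume (d := d) |>.restrict_preimage
    (MeasurableSet.univ.prod measurableSet_Ioi : MeasurableSet (univ ×ˢ Ioi (0 : ℝ)))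
  have e : (fun y : E (d + 1) => (base y, hgt y)) ⁻¹' (univ ×ˢ Ioi 0) = upperHalf d := by
    ext y; simp [mem_upperHalf]
  rw [e, ← Measure.prod_restrict, Measure.restrict_univ] at h1
  rw [← h1.map_eq]
  refine Measure.ext fun s hs => ?_
  rw [Measure.map_apply hm hs, muAlpha, withDensity_apply _ (hm hs), withDensity_apply _ hs,
    setLIntegral_map hs (by fun_prop) hm]
  rfl

variable {α : ℝ}

lemma setLIntegral_base {s : Set (E d)} {I : Set ℝ} (hs : MeasurableSet s) (hI : MeasurableSet I)
    {g : E d → ℝ≥0∞} (hg : AEMeasurable g) :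
    ∫⁻ y in base ⁻¹' s ∩ hgt ⁻¹' I, g (base y) ∂(muAlpha d α) = (∫⁻ x in s, g x) * nu α I := by
  have h := (measurePreserving_split (d := d) α).restrict_preimage (hs.prod hI)
  have e : base ⁻¹' s ∩ hgt ⁻¹' I = (fun y : E (d + 1) => (base y, hgt y)) ⁻¹' (s ×ˢ I) := by
    ext y; simp
  rw [e]
  have hg' : AEMeasurable (fun z : E d × ℝ => g z.1) ((volume.prod (nu α)).restrict (s ×ˢ I)) :=
    (hg.comp_fst).restrict
  calc _ = ∫⁻ z in s ×ˢ I, g z.1 ∂(volume.prod (nu α)) := by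
        rw [← h.map_eq] at hg' ⊢
        rw [lintegral_map' hg' h.measurable.aemeasurable]
    _ = ∫⁻ z, g z.1 * (fun _ => 1) z.2 ∂((volume.restrict s).prod ((nu α).restrict I)) := by
        rw [Measure.prod_restrict]; simp
    _ = _ := by
        rw [lintegral_prod_mul hg.restrict aemeasurable_const]; simp

lemma muAlpha_box {s : Set (E d)} {I : Set ℝ} (hs : MeasurableSet s) (hI : MeasurableSet I) :
    muAlpha d α (base ⁻¹' s ∩ hgt ⁻¹' I) = volume s * nu α I := by
  have := setLIntegral_base (α := α) hs hI (g := fun _ => 1) aemeasurable_const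
  simpa using this

lemma toSet_eq_box (P : DyadicCube (d + 1)) : P.toSet = base ⁻¹' P.base.toSet ∩ hgt ⁻¹' P.vert := by
  ext y; exact mem_toSet_iff_base

lemma measurableSet_vert (P : DyadicCube (d + 1)) : MeasurableSet P.vert := measurableSet_Ioc

lemma muAlpha_toSet (P : DyadicCube (d + 1)) :
    muAlpha d α P.toSet = volume P.base.toSet * nu α P.vert := by
  rw [toSet_eq_box, muAlpha_box (measurableSet_toSet _) (measurableSet_vert P)]

lemma vert_left_nonneg {P : DyadicCube (d + 1)} (hP : P.toSet ⊆ upperHalf d) :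
    0 ≤ P.len * P.corner (Fin.last d) := by
  rw [toSet_subset_upperHalf_iff] at hP
  exact mul_nonneg P.len_pos.le (by exact_mod_cast hP)

lemma nu_vert_ne_zero {P : DyadicCube (d + 1)} (hP : P.toSet ⊆ upperHalf d) :
    nu α P.vert ≠ 0 := nu_Ioc_ne_zero (vert_left_nonneg hP) (by have := P.len_pos; nlinarith)

lemma nu_vert_ne_top (hα : -1 < α) {P : DyadicCube (d + 1)} (hP : P.toSet ⊆ upperHalf d) :
    nu α P.vert ≠ ∞ := nu_Ioc_ne_top hα (vert_left_nonneg hP)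

lemma muAlpha_toSet_ne_zero {P : DyadicCube (d + 1)} (hP : P.toSet ⊆ upperHalf d) :
    muAlpha d α P.toSet ≠ 0 := by
  rw [muAlpha_toSet]
  exact mul_ne_zero (volume_toSet_pos _) (nu_vert_ne_zero hP)

lemma muAlpha_toSet_ne_top (hα : -1 < α) {P : DyadicCube (d + 1)} (hP : P.toSet ⊆ upperHalf d) :
    muAlpha d α P.toSet ≠ ∞ := by
  rw [muAlpha_toSet]
  exact ENNReal.mul_ne_top (volume_toSet_ne_top _) (nu_vert_ne_top hα hP)

/-- Averages over a cube of a function of the horizontal part are averages over the projection. -/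
lemma laverage_base (hα : -1 < α) {P : DyadicCube (d + 1)} (hP : P.toSet ⊆ upperHalf d)
    {g : E d → ℝ≥0∞} (hg : AEMeasurable g) :
    (∫⁻ y in P.toSet, g (base y) ∂(muAlpha d α)) / muAlpha d α P.toSet =
      (∫⁻ x in P.base.toSet, g x) / volume P.base.toSet := by
  rw [muAlpha_toSet, toSet_eq_box, setLIntegral_base (measurableSet_toSet _) (measurableSet_vert P) hg,
    ENNReal.mul_div_mul_right _ _ (nu_vert_ne_zero hP) (nu_vert_ne_top hα hP)]

lemma average_base (hα : -1 < α) {P : DyadicCube (d + 1)} (hP : P.toSet ⊆ upperHalf d)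
    {f : E d → ℂ} (hf : AEStronglyMeasurable f) :
    ⨍ y in P.toSet, f (base y) ∂(muAlpha d α) = ⨍ x in P.base.toSet, f x := by
  have h := (measurePreserving_split (d := d) α).restrict_preimage
    ((measurableSet_toSet P.base).prod (measurableSet_vert P))
  have e : P.toSet = (fun y : E (d + 1) => (base y, hgt y)) ⁻¹' (P.base.toSet ×ˢ P.vert) := by
    rw [toSet_eq_box]; ext y; simp
  have hI : ∫ y in P.toSet, f (base y) ∂(muAlpha d α) =
      (∫ x in P.base.toSet, f x) * ((nu α).real P.vert : ℂ) := by
    have hf' : AEStronglyMeasurable (fun z : E d × ℝ => f z.1)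
      ((volume.prod (nu α)).restrict (P.base.toSet ×ˢ P.vert)) := (hf.comp_fst).restrict
    rw [e]
    have h1 : ∫ y, f (base y) ∂((muAlpha d α).restrict
        ((fun y : E (d + 1) => (base y, hgt y)) ⁻¹' (P.base.toSet ×ˢ P.vert))) =
        ∫ z in P.base.toSet ×ˢ P.vert, f z.1 ∂(volume.prod (nu α)) := by
      rw [← h.map_eq] at hf' ⊢
      rw [integral_map h.measurable.aemeasurable hf']
    rw [h1]
    have h2 := setIntegral_prod_mul (μ := (volume : Measure (E d))) (ν := nu α) f
      (fun _ => (1 : ℂ)) P.base.toSet P.vert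
    simp only [mul_one] at h2
    rw [h2]
    simp
  have h3 : (nu α).real P.vert ≠ 0 :=
    (ENNReal.toReal_pos (nu_vert_ne_zero hP) (nu_vert_ne_top hα hP)).ne'
  have h4 : ((nu α).real P.vert : ℂ) ≠ 0 := by exact_mod_cast h3
  rw [setAverage_eq, setAverage_eq, hI, Measure.real, muAlpha_toSet, ENNReal.toReal_mul]
  simp only [Complex.real_smul]
  change (((volume.real P.base.toSet * (nu α).real P.vert)⁻¹ : ℝ) : ℂ) * _ = _
  push_cast
  rw [mul_inv]
  field_simp

lemma ae_muAlpha_base {q : E d → Prop} (h : ∀ᵐ x : E d, q x) :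
    ∀ᵐ y ∂(muAlpha d α), q (base y) :=
  (Measure.quasiMeasurePreserving_fst.comp
    (measurePreserving_split α).quasiMeasurePreserving).ae h

lemma ae_muAlpha_mem : ∀ᵐ y ∂(muAlpha d α), y ∈ upperHalf d :=
  (withDensity_absolutelyContinuous _ _).ae_le (ae_restrict_mem measurableSet_upperHalf)

lemma muAlpha_absolutelyContinuous : muAlpha d α ≪ volume.restrict (upperHalf d) :=
  withDensity_absolutelyContinuous _ _

lemma restrict_muAlpha : (muAlpha d α).restrict (upperHalf d) = muAlpha d α :=
  Measure.restrict_eq_self_of_ae_mem ae_muAlpha_mem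

end Split

/-! ### Differentiation along dyadic cubes and half-balls -/

section Differentiation

variable {n : ℕ}

lemma tendsto_two_zpow_neg : Tendsto (fun k : ℕ => (2 : ℝ) ^ (-(k : ℤ))) atTop (𝓝 0) := by
  have := tendsto_pow_atTop_nhds_zero_of_lt_one (r := (1 / 2 : ℝ)) (by norm_num) (by norm_num)
  refine this.congr fun k => ?_
  rw [zpow_neg, zpow_natCast, one_div, inv_pow]

/-- The Lebesgue differentiation theorem along dyadic cubes. -/
lemma ae_tendsto_cube {f : E n → ℂ} (hf : LocallyIntegrable f) : ∀ᵐ x : E n,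
    Tendsto (fun k : ℕ => (∫⁻ y in (at' x (k : ℤ)).toSet, ‖f y - f x‖ₑ) /
      volume (at' x (k : ℤ)).toSet) atTop (𝓝 0) := by
  filter_upwards [(Besicovitch.vitaliFamily volume).ae_tendsto_lintegral_enorm_sub_div hf] with x hx
  have hx' := hx.comp (Besicovitch.tendsto_filterAt volume x)
  set r : ℕ → ℝ := fun k => ((n : ℝ) + 1) * (2 : ℝ) ^ (-(k : ℤ))
  have hr0 : ∀ k, 0 < r k := fun k => by positivity
  have hr : Tendsto r atTop (𝓝[>] 0) := by
    rw [tendsto_nhdsWithin_iff]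
    refine ⟨?_, Eventually.of_forall hr0⟩
    have := tendsto_two_zpow_neg.const_mul ((n : ℝ) + 1)
    rwa [mul_zero] at this
  have h1 := hx'.comp hr
  -- The ball around `x` of radius `(n + 1) 2^{-k}` contains the cube, and has comparable measure.
  set c : ℝ≥0∞ := ENNReal.ofReal ((n : ℝ) + 1) ^ n * volume (Metric.closedBall (0 : E n) 1)
  have hc : c ≠ ∞ := ENNReal.mul_ne_top (by finiteness) measure_closedBall_lt_top.ne
  have hc0 : c ≠ 0 := by
    refine mul_ne_zero ?_ (Metric.measure_closedBall_pos volume _ one_pos).ne'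
    have : (0 : ℝ) < (n : ℝ) + 1 := by positivity
    positivity
  have h2 := ENNReal.Tendsto.const_mul (a := c) h1 (Or.inr hc)
  rw [mul_zero] at h2
  refine tendsto_of_tendsto_of_tendsto_of_le_of_le tendsto_const_nhds h2 (fun _ => zero_le)
    fun k => ?_
  simp only [Function.comp]
  have hvol : volume (Metric.closedBall x (r k)) = c * volume (at' x (k : ℤ)).toSet := by
    rw [Measure.addHaar_closedBall' _ _ (hr0 k).le, volume_toSet, finrank_euclideanSpace_fin,
      ENNReal.ofReal_pow (hr0 k).le, ENNReal.ofReal_mul (by positivity), mul_pow]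
    simp only [c, len, at'_level]
    ring
  have hsub : (at' x (k : ℤ)).toSet ⊆ Metric.closedBall x (r k) := by
    intro y hy
    have := dist_le_of_coord (at' x (k : ℤ)).len_pos.le
      fun i => abs_sub_le_of_mem hy (mem_at' x _) i
    refine (Metric.mem_closedBall.2 (this.trans ?_))
    simp only [len, at'_level, r]
    gcongr
    linarith
  rw [hvol, ← mul_div_assoc, ENNReal.mul_div_mul_left _ _ hc0 hc]
  gcongr

variable {d : ℕ} {α : ℝ}

/-- The Lebesgue differentiation theorem along dyadic cubes for the weighted measure: near a point
of the open half-space the weight is bounded above and below. -/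
lemma ae_tendsto_cube_muAlpha {F : E (d + 1) → ℂ} (hF : LocInt (upperHalf d) F) :
    ∀ᵐ x ∂(muAlpha d α), Tendsto (fun k : ℕ =>
      (∫⁻ y in (at' x (k : ℤ)).toSet, ‖F y - F x‖ₑ ∂(muAlpha d α)) /
      muAlpha d α (at' x (k : ℤ)).toSet) atTop (𝓝 0) := by
  have hloc : LocallyIntegrable ((upperHalf d).indicator F) := by
    intro x
    refine ⟨Metric.ball x 1, Metric.ball_mem_nhds x one_pos, ?_⟩
    rw [IntegrableOn, integrable_indicator_iff measurableSet_upperHalf, IntegrableOn,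
      Measure.restrict_restrict measurableSet_upperHalf]
    exact hF _ inter_subset_left (Metric.isBounded_ball.subset inter_subset_right)
  have h1 : ∀ᵐ x ∂(muAlpha d α), x ∈ upperHalf d ∧ Tendsto (fun k : ℕ =>
      (∫⁻ y in (at' x (k : ℤ)).toSet, ‖(upperHalf d).indicator F y - (upperHalf d).indicator F x‖ₑ) /
      volume (at' x (k : ℤ)).toSet) atTop (𝓝 0) := by
    filter_upwards [ae_muAlpha_mem, (muAlpha_absolutelyContinuous (α := α)).ae_le
      (ae_restrict_of_ae (ae_tendsto_cube hloc))] with x h h'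
    exact ⟨h, h'⟩
  filter_upwards [h1] with x ⟨hx, hlim⟩
  have ht : 0 < hgt x := hx
  set a : ℝ := min 1 (hgt x / 2)
  have ha : 0 < a := lt_min one_pos (by linarith)
  have haα : 0 < a ^ α := Real.rpow_pos_of_pos ha _
  have hw : ∀ u : ℝ, a ≤ u → u ≤ 1 → min 1 (a ^ α) ≤ u ^ α ∧ u ^ α ≤ max 1 (a ^ α) := by
    intro u hau hu
    rcases le_total 0 α with h | h
    · exact ⟨(min_le_right _ _).trans (Real.rpow_le_rpow ha.le hau h),
        (Real.rpow_le_one (ha.le.trans hau) hu h).trans (le_max_left _ _)⟩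
    · exact ⟨(min_le_left _ _).trans (Real.one_le_rpow_of_pos_of_le_one_of_nonpos
        (ha.trans_le hau) hu h), (Real.rpow_le_rpow_of_nonpos ha hau h).trans (le_max_right _ _)⟩
  set m : ℝ≥0∞ := ENNReal.ofReal (min 1 (a ^ α))
  set M : ℝ≥0∞ := ENNReal.ofReal (max 1 (a ^ α))
  have hm0 : m ≠ 0 := by simpa [m] using haα
  have h2 := ENNReal.Tendsto.const_mul (a := M / m) hlim
    (Or.inr (ENNReal.div_ne_top ENNReal.ofReal_ne_top hm0))
  rw [mul_zero] at h2
  refine tendsto_of_tendsto_of_tendsto_of_le_of_le' tendsto_const_nhds h2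
    (Eventually.of_forall fun _ => zero_le) ?_
  have hev : ∀ᶠ k : ℕ in atTop, (2 : ℝ) ^ (-(k : ℤ)) < hgt x / 2 :=
    tendsto_two_zpow_neg.eventually_lt_const (by linarith)
  filter_upwards [hev] with k hk
  set P := at' x (k : ℤ)
  have hPs : MeasurableSet P.toSet := measurableSet_toSet _
  have hPh : P.toSet ⊆ upperHalf d := at'_subset_upperHalf hx _
  have hP : ∀ y ∈ P.toSet, a ≤ min 1 |y (Fin.last d)| := by
    intro y hy
    have h3 := abs_sub_le_of_mem hy (mem_at' x (k : ℤ)) (Fin.last d)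
    have h4 : P.len < hgt x / 2 := hk
    have h5 : hgt x - P.len ≤ y (Fin.last d) := by
      have := (abs_le.1 h3).1
      change hgt x - (at' x (k : ℤ)).len ≤ _
      unfold hgt; linarith
    refine le_min (min_le_left _ _) ((min_le_right _ _).trans ?_)
    exact le_trans (by linarith) (le_abs_self _)
  have hmeas : Measurable fun y : E (d + 1) => ENNReal.ofReal (min 1 |y (Fin.last d)| ^ α) := by
    fun_prop
  have hup : ∀ g : E (d + 1) → ℝ≥0∞, ∫⁻ y in P.toSet, g y ∂(muAlpha d α) ≤
      M * ∫⁻ y in P.toSet, g y := by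
    intro g
    rw [muAlpha, restrict_withDensity hPs, Measure.restrict_restrict hPs, inter_eq_left.2 hPh]
    refine (lintegral_withDensity_le_lintegral_mul _ hmeas _).trans ?_
    rw [← lintegral_const_mul' _ _ ENNReal.ofReal_ne_top]
    refine setLIntegral_mono' hPs fun y hy => ?_
    simp only [Pi.mul_apply]
    gcongr
    exact (hw _ (hP y hy) (min_le_left _ _)).2
  have hlow : m * volume P.toSet ≤ muAlpha d α P.toSet := by
    rw [muAlpha, withDensity_apply _ hPs, Measure.restrict_restrict hPs, inter_eq_left.2 hPh,
      ← setLIntegral_const]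
    refine setLIntegral_mono' hPs fun y hy => ?_
    exact ENNReal.ofReal_le_ofReal (hw _ (hP y hy) (min_le_left _ _)).1
  have hcongr : ∫⁻ y in P.toSet, ‖F y - F x‖ₑ =
      ∫⁻ y in P.toSet, ‖(upperHalf d).indicator F y - (upperHalf d).indicator F x‖ₑ := by
    refine setLIntegral_congr_fun hPs fun y hy => ?_
    simp only [indicator_of_mem (hPh hy), indicator_of_mem hx]
  calc _ ≤ (M * ∫⁻ y in P.toSet, ‖F y - F x‖ₑ) / (m * volume P.toSet) := by
        gcongr; exact hup _
    _ = _ := by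
        rw [hcongr, div_eq_mul_inv, div_eq_mul_inv, div_eq_mul_inv,
          ENNReal.mul_inv (Or.inl hm0) (Or.inl ENNReal.ofReal_ne_top)]
        ring

lemma dist_bdryPoint_sq (y : E (d + 1)) (x : E d) :
    dist y (bdryPoint x) ^ 2 = dist (base y) x ^ 2 + hgt y ^ 2 := by
  rw [EuclideanSpace.dist_eq, EuclideanSpace.dist_eq, Real.sq_sqrt (by positivity),
    Real.sq_sqrt (by positivity), Fin.sum_univ_castSucc]
  simp [bdryPoint, hgt, Real.dist_eq]

/-- The cylinder of height `r` over a closed ball of radius `r`. It is comparable to a half-ball, and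
a product set. -/
def cyl (x : E d) (r : ℝ) : Set (E (d + 1)) := base ⁻¹' (Metric.closedBall x r) ∩ hgt ⁻¹' (Ioc 0 r)

lemma measurableSet_cyl (x : E d) (r : ℝ) : MeasurableSet (cyl x r) :=
  (measurable_base measurableSet_closedBall).inter (measurable_hgt measurableSet_Ioc)

lemma halfBall_subset_cyl (x : E d) (r : ℝ) :
    Metric.ball (bdryPoint x) r ∩ upperHalf d ⊆ cyl x r := by
  rintro y ⟨hy, hy0⟩
  have h := dist_bdryPoint_sq y x
  have h1 : dist y (bdryPoint x) < r := hy
  have h2 : 0 < hgt y := hy0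
  have h3 : 0 ≤ dist y (bdryPoint x) := dist_nonneg
  have h4 : 0 ≤ dist (base y) x := dist_nonneg
  have h5 : dist (base y) x ≤ r := by nlinarith
  exact ⟨h5, h2, by nlinarith⟩

lemma cyl_subset_halfBall (x : E d) {r : ℝ} (hr : 0 < r) :
    cyl x (r / 2) ⊆ Metric.ball (bdryPoint x) r ∩ upperHalf d := by
  rintro y ⟨hy, hy0, hy1⟩
  have h := dist_bdryPoint_sq y x
  have h1 : dist (base y) x ≤ r / 2 := hy
  have h3 : 0 ≤ dist y (bdryPoint x) := dist_nonneg
  have h4 : 0 ≤ dist (base y) x := dist_nonneg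
  refine ⟨?_, hy0⟩
  rw [Metric.mem_ball]
  nlinarith

lemma muAlpha_cyl (x : E d) (r : ℝ) :
    muAlpha d α (cyl x r) = volume (Metric.closedBall x r) * nu α (Ioc 0 r) :=
  muAlpha_box measurableSet_closedBall measurableSet_Ioc

lemma muAlpha_cyl_ne_zero (x : E d) {r : ℝ} (hr : 0 < r) : muAlpha d α (cyl x r) ≠ 0 := by
  rw [muAlpha_cyl]
  exact mul_ne_zero (Metric.measure_closedBall_pos volume _ hr).ne' (nu_Ioc_ne_zero le_rfl hr)

lemma muAlpha_cyl_ne_top (hα : -1 < α) (x : E d) (r : ℝ) : muAlpha d α (cyl x r) ≠ ∞ := by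
  rw [muAlpha_cyl]
  exact ENNReal.mul_ne_top measure_closedBall_lt_top.ne (nu_Ioc_ne_top hα le_rfl)

/-- The doubling property at small scales. -/
lemma muAlpha_cyl_le (hα : -1 < α) (x : E d) {r : ℝ} (hr : 0 < r) (hr1 : r ≤ 1) :
    muAlpha d α (cyl x r) ≤ ENNReal.ofReal (2 ^ d * 2 ^ (α + 1)) * muAlpha d α (cyl x (r / 2)) := by
  rw [muAlpha_cyl, muAlpha_cyl, Measure.addHaar_closedBall' _ _ hr.le,
    Measure.addHaar_closedBall' volume x (by linarith : 0 ≤ r / 2), finrank_euclideanSpace_fin,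
    nu_Ioc_of_le_one hα le_rfl hr.le hr1, nu_Ioc_of_le_one hα le_rfl (by linarith) (by linarith),
    Real.zero_rpow (by linarith), sub_zero, sub_zero]
  refine le_of_eq ?_
  have e1 : r ^ d = 2 ^ d * (r / 2) ^ d := by rw [← mul_pow]; congr 1; ring
  have e2 : r ^ (α + 1) / (α + 1) = 2 ^ (α + 1) * ((r / 2) ^ (α + 1) / (α + 1)) := by
    rw [← mul_div_assoc, ← Real.mul_rpow (by norm_num) (by linarith)]
    congr 2; ring
  rw [e1, e2, ENNReal.ofReal_mul (by positivity), ENNReal.ofReal_mul (by positivity),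
    ENNReal.ofReal_mul (by positivity)]
  ring

/-- A criterion for the existence of traces. If `F` is close to a function `h` of the horizontal
variable, with an error consisting of functions of the horizontal variable that tend to `0` and of
`t^s G` with `G ∈ L^p`, `s p > α + 1`, then the half-ball averages of `F` converge to `h`. -/
lemma ae_tendsto_halfBallAverage {s p : ℝ} (hα : -1 < α) (hp : 1 ≤ p) (hs : 0 ≤ s)
    (hsp : α + 1 < s * p)
    {F : E (d + 1) → ℂ} (hF : ∀ x r, IntegrableOn F (cyl x r) (muAlpha d α))
    {h : E d → ℂ} (hh : LocallyIntegrable h)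
    {D : ℕ → E d → ℝ≥0∞} (hDm : ∀ m, AEMeasurable (D m)) (hD : ∀ m, ∫⁻ x, D m x ^ p ≠ ∞)
    (hD0 : ∀ᵐ x, Tendsto (fun m => D m x) atTop (𝓝 0))
    {G : E (d + 1) → ℝ≥0∞} (hG : Measurable G) (hGp : ∫⁻ y, G y ^ p ∂(muAlpha d α) ≠ ∞)
    (hFh : ∀ᵐ y ∂(muAlpha d α), ∀ m : ℕ, hgt y ≤ (2 : ℝ) ^ (-(m : ℤ)) →
      ‖F y - h (base y)‖ₑ ≤ ENNReal.ofReal (hgt y) ^ s * G y + D m (base y)) :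
    ∀ᵐ x : E d, Tendsto (halfBallAverage (muAlpha d α) F x) (𝓝[>] 0) (𝓝 (h x)) := by
  have hp0 : 0 < p := by linarith
  set μ := muAlpha d α with hμ
  -- The measure `A ↦ ∫_{A × (0, ∞)} G^p dμ` on the boundary.
  set ρ : Measure (E d) := (μ.withDensity fun y => G y ^ p).map base with hρ
  have hfin : IsFiniteMeasure (μ.withDensity fun y => G y ^ p) :=
    isFiniteMeasure_withDensity hGp
  have hfinρ : IsFiniteMeasure ρ := by rw [hρ]; infer_instance
  let v := Besicovitch.vitaliFamily (volume : Measure (E d))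
  have hρ_ae := v.ae_tendsto_rnDeriv ρ
  have hρ_fin := ρ.rnDeriv_lt_top (volume : Measure (E d))
  have hh_ae := v.ae_tendsto_lintegral_enorm_sub_div hh
  have hD_ae : ∀ᵐ x, ∀ m, Tendsto (fun a => (∫⁻ y in a, D m y ^ p) / volume a) (v.filterAt x)
      (𝓝 (D m x ^ p)) :=
    ae_all_iff.2 fun m => v.ae_tendsto_lintegral_div ((hDm m).pow_const p) (hD m)
  filter_upwards [hρ_ae, hρ_fin, hh_ae, hD_ae, hD0] with x hxρ hxf hxh hxD hxD0
  have hv := Besicovitch.tendsto_filterAt (volume : Measure (E d)) x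
  have hsmall : ∀ ε : ℝ, 0 < ε → ∀ᶠ r : ℝ in 𝓝[>] 0, 0 < r ∧ r ≤ ε := fun ε hε => by
    filter_upwards [Ioc_mem_nhdsGT hε] with r hr using hr
  have hcyl : ∀ (r : ℝ) (g : E d → ℝ≥0∞), 0 < r → AEMeasurable g →
      (∫⁻ y in cyl x r, g (base y) ∂μ) / μ (cyl x r) =
        (∫⁻ y in Metric.closedBall x r, g y) / volume (Metric.closedBall x r) := by
    intro r g hr hg
    rw [hμ, muAlpha_cyl, cyl, setLIntegral_base measurableSet_closedBall measurableSet_Ioc hg,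
      ENNReal.mul_div_mul_right _ _ (nu_Ioc_ne_zero le_rfl hr) (nu_Ioc_ne_top hα le_rfl)]
  have hhm : AEStronglyMeasurable h := hh.aestronglyMeasurable
  have hbase : Measure.QuasiMeasurePreserving (base : E (d + 1) → E d) μ volume :=
    Measure.quasiMeasurePreserving_fst.comp (measurePreserving_split α).quasiMeasurePreserving
  set T : ℝ → ℝ≥0∞ := fun r => (∫⁻ y in cyl x r, ‖F y - h (base y)‖ₑ ∂μ) / μ (cyl x r) with hT
  have hTp : Tendsto (fun r => T r ^ p) (𝓝[>] 0) (𝓝 0) := by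
    set e : ℝ → ℝ≥0∞ := fun r => ENNReal.ofReal ((α + 1) * r ^ (s * p - (α + 1))) *
      (ρ (Metric.closedBall x r) / volume (Metric.closedBall x r)) with he
    -- The factor `r^{sp}` from the heights outweighs the height integral, of order `r^{α+1}`.
    have hbound : ∀ m : ℕ, ∀ᶠ r : ℝ in 𝓝[>] 0, T r ^ p ≤ 2 ^ p * (e r +
        (∫⁻ y in Metric.closedBall x r, D m y ^ p) / volume (Metric.closedBall x r)) := by
      intro m
      filter_upwards [hsmall ((2 : ℝ) ^ (-(m : ℤ))) (by positivity), hsmall 1 one_pos]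
        with r ⟨hr, hrm⟩ ⟨_, hr1⟩
      have h0 := muAlpha_cyl_ne_zero (α := α) x hr
      have ht := muAlpha_cyl_ne_top hα x r
      have hDb : AEMeasurable (fun y : E (d + 1) => D m (base y)) μ :=
        (hDm m).comp_quasiMeasurePreserving hbase
      have hGt : Measurable fun y : E (d + 1) => ENNReal.ofReal (hgt y) ^ s * G y := by fun_prop
      have h1 : T r ≤ (∫⁻ y in cyl x r, (ENNReal.ofReal (hgt y) ^ s * G y + D m (base y)) ∂μ) /
          μ (cyl x r) := by
        refine ENNReal.div_le_div_right (lintegral_mono_ae ?_) _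
        filter_upwards [ae_restrict_of_ae hFh, ae_restrict_mem (measurableSet_cyl x r)] with y hy hyc
        exact hy m (hyc.2.2.trans hrm)
      calc T r ^ p ≤ ((∫⁻ y in cyl x r, (ENNReal.ofReal (hgt y) ^ s * G y + D m (base y)) ∂μ) /
            μ (cyl x r)) ^ p := by gcongr
        _ ≤ (∫⁻ y in cyl x r, (ENNReal.ofReal (hgt y) ^ s * G y + D m (base y)) ^ p ∂μ) /
            μ (cyl x r) := rpow_setAverage_le hp h0 ht (hGt.aemeasurable.add hDb)
        _ ≤ (∫⁻ y in cyl x r, 2 ^ p * (ENNReal.ofReal r ^ (s * p) * G y ^ p + D m (base y) ^ p) ∂μ) /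
            μ (cyl x r) := by
          refine ENNReal.div_le_div_right (setLIntegral_mono' (measurableSet_cyl x r)
            fun y hy => (rpow_add_le hp _ _).trans ?_) _
          rw [ENNReal.mul_rpow_of_nonneg _ _ hp0.le, ← ENNReal.rpow_mul]
          gcongr
          exact hy.2.2
        _ = 2 ^ p * (ENNReal.ofReal r ^ (s * p) * (∫⁻ y in cyl x r, G y ^ p ∂μ) / μ (cyl x r) +
            (∫⁻ y in cyl x r, D m (base y) ^ p ∂μ) / μ (cyl x r)) := by
          rw [lintegral_const_mul' _ _ (by finiteness), lintegral_add_left (by fun_prop),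
            lintegral_const_mul _ (by fun_prop), mul_div_assoc, ENNReal.add_div]
        _ ≤ _ := by
          rw [hcyl r (fun y => D m y ^ p) hr ((hDm m).pow_const p)]
          gcongr
          have h3 : ∫⁻ y in cyl x r, G y ^ p ∂μ ≤ ρ (Metric.closedBall x r) := by
            rw [hρ, Measure.map_apply measurable_base measurableSet_closedBall,
              withDensity_apply _ (measurable_base measurableSet_closedBall)]
            exact lintegral_mono_set inter_subset_left
          have hα1 : 0 < α + 1 := by linarith
          have hrα : 0 < r ^ (α + 1) := Real.rpow_pos_of_pos hr _
          calc _ ≤ ENNReal.ofReal r ^ (s * p) * ρ (Metric.closedBall x r) / μ (cyl x r) := by gcongr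
            _ = _ := by
              rw [hμ, muAlpha_cyl, nu_Ioc_of_le_one hα le_rfl hr.le hr1,
                Real.zero_rpow (by linarith), sub_zero, he, ENNReal.ofReal_rpow_of_pos hr]
              have e1 : r ^ (s * p) = (α + 1) * r ^ (s * p - (α + 1)) * (r ^ (α + 1) / (α + 1)) := by
                rw [Real.rpow_sub hr]; field_simp
              have hc0 : ENNReal.ofReal (r ^ (α + 1) / (α + 1)) ≠ 0 := by
                rw [Ne, ENNReal.ofReal_eq_zero, not_le]; positivity
              rw [e1, ENNReal.ofReal_mul (by positivity), mul_right_comm,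
                ENNReal.mul_div_mul_right _ _ hc0 ENNReal.ofReal_ne_top, mul_div_assoc]
    have helim : Tendsto e (𝓝[>] 0) (𝓝 0) := by
      have h1 : Tendsto (fun r : ℝ => ENNReal.ofReal ((α + 1) * r ^ (s * p - (α + 1))))
          (𝓝[>] 0) (𝓝 0) := by
        have : Tendsto (fun r : ℝ => (α + 1) * r ^ (s * p - (α + 1))) (𝓝 0) (𝓝 0) := by
          have := (Real.continuousAt_rpow_const 0 (s * p - (α + 1)) (Or.inr (by linarith))).tendsto
          rw [Real.zero_rpow (by linarith)] at this
          simpa using this.const_mul (α + 1)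
        have := (ENNReal.tendsto_ofReal this).mono_left (nhdsWithin_le_nhds (s := Ioi 0))
        simpa using this
      have h2 := ENNReal.Tendsto.mul h1 (Or.inr hxf.ne) (hxρ.comp hv) (Or.inr ENNReal.zero_ne_top)
      rwa [zero_mul] at h2
    rw [ENNReal.tendsto_nhds_zero]
    intro ε hε
    have h4 : Tendsto (fun m => 2 ^ p * (0 + D m x ^ p)) atTop (𝓝 0) := by
      have h5 := (ENNReal.continuous_rpow_const (y := p)).tendsto 0 |>.comp hxD0
      rw [ENNReal.zero_rpow_of_pos hp0] at h5
      have := ENNReal.Tendsto.const_mul (a := 2 ^ p) h5 (Or.inr (by finiteness))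
      simpa using this
    obtain ⟨m, hm⟩ := (h4.eventually_lt_const hε).exists
    have h6 := ENNReal.Tendsto.const_mul (a := 2 ^ p) (helim.add ((hxD m).comp hv))
      (Or.inr (by finiteness))
    filter_upwards [hbound m, h6.eventually_lt_const hm] with r h7 h8
    exact h7.trans h8.le
  have hTlim : Tendsto T (𝓝[>] 0) (𝓝 0) := by
    have h5 := (ENNReal.continuous_rpow_const (y := 1 / p)).tendsto 0 |>.comp hTp
    rw [ENNReal.zero_rpow_of_pos (by positivity)] at h5
    refine h5.congr fun r => ?_
    rw [Function.comp, ← ENNReal.rpow_mul, mul_one_div_cancel hp0.ne', ENNReal.rpow_one]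
  have hsum := ENNReal.Tendsto.const_mul (a := ENNReal.ofReal (2 ^ d * 2 ^ (α + 1)))
    (hTlim.add (hxh.comp hv)) (Or.inr ENNReal.ofReal_ne_top)
  rw [add_zero, mul_zero] at hsum
  rw [tendsto_iff_edist_tendsto_0]
  refine tendsto_of_tendsto_of_tendsto_of_le_of_le' tendsto_const_nhds hsum
    (Eventually.of_forall fun _ => zero_le) ?_
  filter_upwards [hsmall 1 one_pos] with r ⟨hr, hr1⟩
  set B := Metric.ball (bdryPoint x) r ∩ upperHalf d
  have hB1 : B ⊆ cyl x r := halfBall_subset_cyl x r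
  have hB2 : cyl x (r / 2) ⊆ B := cyl_subset_halfBall x hr
  have hBt : μ B ≠ ∞ := ne_top_of_le_ne_top (muAlpha_cyl_ne_top hα x r) (measure_mono hB1)
  have hB0 : μ B ≠ 0 := fun h0 => muAlpha_cyl_ne_zero (α := α) x (half_pos hr)
    (measure_mono_null hB2 h0)
  rw [edist_eq_enorm_sub]
  refine (enorm_setAverage_sub_le hB0 hBt ((hF x r).mono_set hB1) (h x)).trans ?_
  have hCm : μ (cyl x r) ≤ ENNReal.ofReal (2 ^ d * 2 ^ (α + 1)) * μ B :=
    (muAlpha_cyl_le hα x hr hr1).trans (by gcongr)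
  set C := ENNReal.ofReal (2 ^ d * 2 ^ (α + 1))
  have hC0 : C ≠ 0 := (ENNReal.ofReal_pos.2 (by positivity)).ne'
  have hCt : C ≠ ∞ := ENNReal.ofReal_ne_top
  have hhx := hcyl r (fun y => ‖h y - h x‖ₑ) hr (by fun_prop)
  have hhb : AEMeasurable (fun y : E (d + 1) => ‖h (base y) - h x‖ₑ) μ :=
    (by fun_prop : AEMeasurable fun y => ‖h y - h x‖ₑ).comp_quasiMeasurePreserving hbase
  calc (∫⁻ y in B, ‖F y - h x‖ₑ ∂μ) / μ B
      ≤ (∫⁻ y in cyl x r, ‖F y - h x‖ₑ ∂μ) / (C⁻¹ * μ (cyl x r)) := by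
        gcongr
        rw [ENNReal.inv_mul_le_iff hC0 hCt]
        exact hCm
    _ = C * ((∫⁻ y in cyl x r, ‖F y - h x‖ₑ ∂μ) / μ (cyl x r)) := by
        rw [div_eq_mul_inv, div_eq_mul_inv, ENNReal.mul_inv (Or.inl (by simpa using hCt))
            (Or.inl (by simpa using hC0)),
          inv_inv]
        ring
    _ ≤ C * ((∫⁻ y in cyl x r, (‖F y - h (base y)‖ₑ + ‖h (base y) - h x‖ₑ) ∂μ) / μ (cyl x r)) := by
        gcongr with y
        refine le_trans (le_of_eq ?_) (enorm_add_le _ _)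
        congr 1; ring
    _ = C * (T r + (∫⁻ y in cyl x r, ‖h (base y) - h x‖ₑ ∂μ) / μ (cyl x r)) := by
        rw [lintegral_add_right' _ hhb.restrict, ENNReal.add_div]
    _ = _ := by rw [hhx]; rfl

end Differentiation

/-! ### Sums of oscillations along towers of cubes -/

section Tail

variable {n : ℕ}

/-- The sum of a quantity over the cubes of level at least `k` that contain `x`. -/
noncomputable def tail (o : DyadicCube n → ℝ≥0∞) (k : ℕ) (x : E n) : ℝ≥0∞ :=
  ∑' i : ℕ, o (at' x ((k + i : ℕ) : ℤ))

lemma measurable_tail (o : DyadicCube n → ℝ≥0∞) (k : ℕ) : Measurable (tail o k) :=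
  Measurable.tsum fun _ => measurable_at' o _

lemma le_tail (o : DyadicCube n → ℝ≥0∞) (k : ℕ) (x : E n) : o (at' x (k : ℤ)) ≤ tail o k x :=
  ENNReal.le_tsum (f := fun i : ℕ => o (at' x ((k + i : ℕ) : ℤ))) 0

lemma tail_antitone (o : DyadicCube n → ℝ≥0∞) (x : E n) {k l : ℕ} (h : k ≤ l) :
    tail o l x ≤ tail o k x := by
  obtain ⟨m, rfl⟩ := Nat.exists_eq_add_of_le h
  unfold tail
  simp_rw [show ∀ i, k + m + i = k + (i + m) by intro i; ring]
  exact tsum_add_le (fun i => o (at' x ((k + i : ℕ) : ℤ))) m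

lemma tendsto_tail {o : DyadicCube n → ℝ≥0∞} {x : E n} (h : tail o 0 x ≠ ∞) :
    Tendsto (fun k => tail o k x) atTop (𝓝 0) := by
  refine (ENNReal.tendsto_sum_nat_add _ h).congr fun k => tsum_congr fun i => ?_
  rw [zero_add, add_comm]

lemma tsum_tail_le {p : ℝ} (hp : 1 ≤ p) {W : ℝ≥0∞} (hW : 1 < W) (hW' : W ≠ ∞) :
    ∃ C : ℝ≥0, ∀ (n : ℕ) (o : DyadicCube n → ℝ≥0∞),
      ∑' k : ℕ, W ^ k * ∫⁻ x, tail o k x ^ p ≤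
        C * ∑' k : ℕ, W ^ k * ∫⁻ x, o (at' x (k : ℤ)) ^ p := by
  obtain ⟨C, hC⟩ := hardy hp hW hW'
  refine ⟨C, fun n o => ?_⟩
  have hm : ∀ k : ℤ, Measurable fun x : E n => o (at' x k) := fun k => measurable_at' o k
  simp_rw [← lintegral_const_mul _ ((measurable_tail o _).pow_const p),
    ← lintegral_const_mul _ ((hm _).pow_const p)]
  rw [← lintegral_tsum fun k => (((measurable_tail o _).pow_const p).const_mul _).aemeasurable,
    ← lintegral_tsum fun k => (((hm _).pow_const p).const_mul _).aemeasurable,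
    ← lintegral_const_mul' _ _ ENNReal.coe_ne_top]
  exact lintegral_mono fun x => hC fun k => o (at' x (k : ℤ))

/-- The largest average of `g` over the neighbours of `Q`. -/
noncomputable def nbrSup (g : E n → ℝ≥0∞) (Q : DyadicCube n) : ℝ≥0∞ :=
  Q.nbrs.sup fun Q' => (∫⁻ y in Q'.toSet, g y) / volume Q'.toSet

lemma le_nbrSup (g : E n → ℝ≥0∞) {Q Q' : DyadicCube n} (h : Q.Neighbor Q') :
    (∫⁻ y in Q'.toSet, g y) / volume Q'.toSet ≤ nbrSup g Q :=
  Finset.le_sup (f := fun Q' : DyadicCube n => (∫⁻ y in Q'.toSet, g y) / volume Q'.toSet)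
    (mem_nbrs.2 h)

lemma lintegral_nbrSup_le (n : ℕ) {p : ℝ} (hp : 1 ≤ p) : ∃ C : ℝ≥0, ∀ (k : ℤ) (g : E n → ℝ≥0∞),
    AEMeasurable g → ∫⁻ x, nbrSup g (at' x k) ^ p ≤ C * ∫⁻ x, g x ^ p := by
  obtain ⟨C, hC⟩ := lintegral_sum_nbrs_le n
  refine ⟨C, fun k g hg => le_trans (lintegral_mono fun x => ?_) (hC k fun x => g x ^ p)⟩
  obtain ⟨Q', hQ', h⟩ := Finset.exists_mem_eq_sup (at' x k).nbrs
    ⟨at' x k, mem_nbrs.2 (neighbor_self _)⟩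
    fun Q' => (∫⁻ y in Q'.toSet, g y) / volume Q'.toSet
  simp only [nbrSup]
  rw [h]
  refine (rpow_setAverage_le hp (volume_toSet_pos _) (volume_toSet_ne_top _) hg).trans ?_
  exact Finset.single_le_sum
    (f := fun Q' : DyadicCube n => (∫⁻ y in Q'.toSet, g y ^ p) / volume Q'.toSet)
    (fun _ _ => zero_le) hQ'

/-- If `h` is approximated by constants `a Q'` near `Q`, then its oscillation is controlled by that
of the constants and the error of the approximation. -/
lemma osc_le_of_approx {h : E n → ℂ} (hh : LocallyIntegrable h) {a : DyadicCube n → ℂ}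
    {g : E n → ℝ≥0∞} {Q : DyadicCube n} {o : ℝ≥0∞}
    (ha : ∀ Q', Q.Neighbor Q' → ‖a Q - a Q'‖ₑ ≤ o)
    (hg : ∀ᵐ x, ∀ l : ℤ, Q.level - 1 ≤ l → l ≤ Q.level + 1 → ‖h x - a (at' x l)‖ₑ ≤ g x) :
    osc univ volume ∞ h Q ≤ o + 2 * nbrSup g Q := by
  have key : ∀ Q', Q.Neighbor Q' → ‖(⨍ y in Q'.toSet, h y) - a Q'‖ₑ ≤ nbrSup g Q := by
    intro Q' hQ'
    have hi : IntegrableOn h Q'.toSet :=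
      (hh.integrableOn_isCompact (Metric.isCompact_of_isClosed_isBounded isClosed_closure
        Q'.isBounded_toSet.closure)).mono_set subset_closure
    refine (enorm_setAverage_sub_le (volume_toSet_pos _) (volume_toSet_ne_top _) hi _).trans ?_
    refine le_trans ?_ (le_nbrSup g hQ')
    refine ENNReal.div_le_div_right (lintegral_mono_ae ?_) _
    filter_upwards [ae_restrict_of_ae hg, ae_restrict_mem (measurableSet_toSet _)] with x hx hxQ
    have hl := (neighbor_iff.1 hQ').1
    have := hx Q'.level hl.1 hl.2
    rwa [mem_toSet_iff.1 hxQ] at this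
  refine osc_top_le fun Q' hQ' _ => ?_
  have e : (⨍ y in Q.toSet, h y) - ⨍ y in Q'.toSet, h y =
      ((⨍ y in Q.toSet, h y) - a Q) + (a Q - a Q') - ((⨍ y in Q'.toSet, h y) - a Q') := by ring
  rw [e]
  calc _ ≤ ‖(⨍ y in Q.toSet, h y) - a Q‖ₑ + ‖a Q - a Q'‖ₑ + ‖(⨍ y in Q'.toSet, h y) - a Q'‖ₑ :=
        enorm_sub_le.trans (by gcongr; exact enorm_add_le _ _)
    _ ≤ nbrSup g Q + o + nbrSup g Q := by
        gcongr
        · exact key Q (neighbor_self Q)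
        · exact ha Q' hQ'
        · exact key Q' hQ'
    _ = _ := by ring

lemma neighbor_at'_succ (x : E n) (k : ℤ) : (at' x k).Neighbor (at' x (k + 1)) :=
  neighbor_of_mem (mem_at' x k) (mem_at' x _) (by simp; omega)

lemma edist_at'_succ_le {a : DyadicCube n → ℂ} {o : DyadicCube n → ℝ≥0∞}
    (ha : ∀ Q Q' : DyadicCube n, 0 ≤ Q.level → Q.Neighbor Q' → ‖a Q - a Q'‖ₑ ≤ o Q) (x : E n) (k : ℕ) :
    edist (a (at' x (k : ℤ))) (a (at' x ((k.succ : ℕ) : ℤ))) ≤ o (at' x (k : ℤ)) := by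
  rw [edist_eq_enorm_sub]
  have := neighbor_at'_succ x k
  exact ha _ _ (by simp) (by push_cast; exact this)

/-- A function that is the limit of the constants `a` along towers of cubes has a Besov seminorm
controlled by the differences of these constants at neighbouring cubes. -/
lemma besov_le_of_tower (n : ℕ) {p : ℝ} (hp : 1 ≤ p) {W : ℝ≥0∞} (hW : 1 < W) (hW' : W ≠ ∞) :
    ∃ C : ℝ≥0, ∀ (h : E n → ℂ) (a : DyadicCube n → ℂ) (o : DyadicCube n → ℝ≥0∞),
      LocallyIntegrable h →
      (∀ Q Q' : DyadicCube n, 0 ≤ Q.level → Q.Neighbor Q' → ‖a Q - a Q'‖ₑ ≤ o Q) →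
      (∀ᵐ x, ∀ k : ℕ, ‖h x - a (at' x (k : ℤ))‖ₑ ≤ tail o k x) →
      ∑' k : ℕ, W ^ k * ∫⁻ x, osc univ volume (ENNReal.ofReal p) h (at' x (k : ℤ)) ^ p ≤
        C * ∑' k : ℕ, W ^ k * ∫⁻ x, o (at' x (k : ℤ)) ^ p := by
  have hp0 : 0 < p := by linarith
  obtain ⟨C₁, h₁⟩ := osc_le_osc_top n (q := ENNReal.ofReal p) (by simpa using hp0)
  obtain ⟨C₂, h₂⟩ := lintegral_nbrSup_le n hp
  obtain ⟨C₃, h₃⟩ := tsum_tail_le hp hW hW'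
  obtain ⟨C₄, h₄⟩ := tsum_shift_le hW' 1
  set K : ℝ≥0∞ := (C₁ : ℝ≥0∞) ^ p * 2 ^ p * (1 + 2 ^ p * (C₂ * (2 ^ p * (C₄ * C₃)))) with hK
  have hKt : K ≠ ∞ := by rw [hK]; finiteness
  refine ⟨K.toNNReal, fun h a o hh ha hx => ?_⟩
  rw [ENNReal.coe_toNNReal hKt]
  set g : ℕ → E n → ℝ≥0∞ := fun k x => 2 * tail o (k - 1) x with hgdef
  have hgm : ∀ k, Measurable (g k) := fun k => (measurable_tail o _).const_mul 2
  have hg : ∀ k : ℕ, ∀ᵐ x, ∀ l : ℤ, (k : ℤ) - 1 ≤ l → l ≤ k + 1 → ‖h x - a (at' x l)‖ₑ ≤ g k x := by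
    intro k
    filter_upwards [hx] with x hx l hl hl'
    have h2 : ∀ t : ℝ≥0∞, t ≤ 2 * t := fun t => le_mul_of_one_le_left (by simp) (by norm_num)
    rcases lt_or_ge l 0 with hl0 | hl0
    -- The cubes of edge length `2` are neighbours of cubes of level `0`, and need a step more.
    · obtain ⟨rfl, rfl⟩ : k = 0 ∧ l = -1 := by omega
      have h5 := ha _ _ (by simp) (neighbor_at'_succ x (-1)).symm
      calc ‖h x - a (at' x (-1))‖ₑ
          = ‖(h x - a (at' x ((0 : ℕ) : ℤ))) + (a (at' x (-1 + 1)) - a (at' x (-1)))‖ₑ := by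
            congr 1; simp
        _ ≤ tail o 0 x + o (at' x ((0 : ℕ) : ℤ)) := by
            refine (enorm_add_le _ _).trans (add_le_add (hx 0) ?_)
            simpa using h5
        _ ≤ tail o 0 x + tail o 0 x := by gcongr; exact le_tail o 0 x
        _ = _ := by simp only [hgdef]; ring
    · obtain ⟨m, rfl⟩ := Int.eq_ofNat_of_zero_le hl0
      calc _ ≤ tail o m x := hx m
        _ ≤ tail o (k - 1) x := tail_antitone o x (by omega)
        _ ≤ _ := h2 _
  have hmo : ∀ k : ℤ, Measurable fun x : E n => o (at' x k) := fun k => measurable_at' o k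
  have step : ∀ k : ℕ, ∫⁻ x, osc univ volume (ENNReal.ofReal p) h (at' x (k : ℤ)) ^ p ≤
      (C₁ : ℝ≥0∞) ^ p * 2 ^ p * ((∫⁻ x, o (at' x (k : ℤ)) ^ p) +
        2 ^ p * (C₂ * (2 ^ p * ∫⁻ x, tail o (k - 1) x ^ p))) := by
    intro k
    calc ∫⁻ x, osc univ volume (ENNReal.ofReal p) h (at' x (k : ℤ)) ^ p
        ≤ ∫⁻ x, (C₁ : ℝ≥0∞) ^ p * 2 ^ p * (o (at' x (k : ℤ)) ^ p +
            2 ^ p * nbrSup (g k) (at' x (k : ℤ)) ^ p) := by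
          refine lintegral_mono fun x => ?_
          have h5 : osc univ volume ∞ h (at' x (k : ℤ)) ≤ _ :=
            osc_le_of_approx hh (fun Q' hQ' => ha (at' x (k : ℤ)) Q' (by simp) hQ') (hg k)
          calc _ ≤ (C₁ * (o (at' x (k : ℤ)) + 2 * nbrSup (g k) (at' x (k : ℤ)))) ^ p := by
                gcongr; exact (h₁ _ _ _ _).trans (by gcongr)
            _ ≤ _ := by
                rw [ENNReal.mul_rpow_of_nonneg _ _ hp0.le, mul_assoc]
                gcongr
                refine (rpow_add_le hp _ _).trans ?_
                rw [ENNReal.mul_rpow_of_nonneg _ _ hp0.le]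
      _ = (C₁ : ℝ≥0∞) ^ p * 2 ^ p * ((∫⁻ x, o (at' x (k : ℤ)) ^ p) +
            2 ^ p * ∫⁻ x, nbrSup (g k) (at' x (k : ℤ)) ^ p) := by
          rw [lintegral_const_mul' _ _ (by finiteness), lintegral_add_left ((hmo _).pow_const p),
            lintegral_const_mul' _ _ (by finiteness)]
      _ ≤ (C₁ : ℝ≥0∞) ^ p * 2 ^ p * ((∫⁻ x, o (at' x (k : ℤ)) ^ p) +
            2 ^ p * (C₂ * ∫⁻ x, g k x ^ p)) := by
          gcongr; exact h₂ _ _ (hgm k).aemeasurable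
      _ = _ := by
          simp only [hgdef, ENNReal.mul_rpow_of_nonneg _ _ hp0.le]
          rw [lintegral_const_mul' _ _ (by finiteness)]
  calc _ ≤ ∑' k : ℕ, W ^ k * ((C₁ : ℝ≥0∞) ^ p * 2 ^ p * ((∫⁻ x, o (at' x (k : ℤ)) ^ p) +
        2 ^ p * (C₂ * (2 ^ p * ∫⁻ x, tail o (k - 1) x ^ p)))) := by
        gcongr with k; exact step k
    _ = (C₁ : ℝ≥0∞) ^ p * 2 ^ p * ((∑' k : ℕ, W ^ k * ∫⁻ x, o (at' x (k : ℤ)) ^ p) +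
        2 ^ p * (C₂ * (2 ^ p * ∑' k : ℕ, W ^ k * ∫⁻ x, tail o (k - 1) x ^ p))) := by
        simp_rw [← ENNReal.tsum_mul_left]
        rw [← ENNReal.tsum_add, ← ENNReal.tsum_mul_left]
        refine tsum_congr fun k => ?_
        ring
    _ ≤ (C₁ : ℝ≥0∞) ^ p * 2 ^ p * ((∑' k : ℕ, W ^ k * ∫⁻ x, o (at' x (k : ℤ)) ^ p) +
        2 ^ p * (C₂ * (2 ^ p * (C₄ * (C₃ * ∑' k : ℕ, W ^ k * ∫⁻ x, o (at' x (k : ℤ)) ^ p))))) := by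
        gcongr
        refine (h₄ fun k => ∫⁻ x, tail o k x ^ p).trans ?_
        gcongr
        exact h₃ n o
    _ = _ := by rw [hK]; ring

end Tail

/-! ### Local integrability -/

lemma eLpNorm_ofReal {X : Type*} [MeasurableSpace X] {μ : Measure X} {p : ℝ} (hp : 0 < p)
    (f : X → ℂ) : eLpNorm f (ENNReal.ofReal p) μ = (∫⁻ x, ‖f x‖ₑ ^ p ∂μ) ^ (1 / p) := by
  rw [eLpNorm_eq_lintegral_rpow_enorm_toReal (by simpa using hp) ENNReal.ofReal_ne_top,
    ENNReal.toReal_ofReal hp.le]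

lemma locallyIntegrable_of_locInt {n : ℕ} {f : E n → ℂ} (h : LocInt univ f) :
    LocallyIntegrable f := fun x =>
  ⟨Metric.ball x 1, Metric.ball_mem_nhds x one_pos, h _ (subset_univ _) Metric.isBounded_ball⟩

lemma locInt_of_memLp {n : ℕ} {f : E n → ℂ} {p : ℝ} (hp : 1 ≤ p)
    (h : MemLp f (ENNReal.ofReal p) volume) : LocInt univ f := by
  intro A _ hA
  obtain ⟨r, hr⟩ := hA.subset_closedBall 0
  refine IntegrableOn.mono_set ?_ hr
  have : IsFiniteMeasure (volume.restrict (Metric.closedBall (0 : E n) r)) :=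
    ⟨by simpa using measure_closedBall_lt_top⟩
  exact (h.restrict _).integrable (by simpa using hp)

/-! ### Traces of Triebel-Lizorkin functions -/

/-- The heights in `(2^{-j}, 2^{1-j}]`. -/
def strip (j : ℕ) : Set ℝ := Ioc ((2 : ℝ) ^ (-(j : ℤ))) (2 * (2 : ℝ) ^ (-(j : ℤ)))

lemma exists_mem_strip {t : ℝ} (h0 : 0 < t) {m : ℕ} (ht : t ≤ 2 * (2 : ℝ) ^ (-(m : ℤ))) :
    ∃ j : ℕ, m ≤ j ∧ t ∈ strip j := by
  obtain ⟨l, hl1, hl2⟩ := exists_mem_Ioc_zpow h0 (by norm_num : (1 : ℝ) < 2)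
  have h1 : l < 1 + -(m : ℤ) := by
    have : (2 : ℝ) ^ l < 2 ^ (1 + -(m : ℤ)) := by
      rw [zpow_one_add₀ (by norm_num)]; exact hl1.trans_le ht
    exact (zpow_lt_zpow_iff_right₀ (by norm_num)).1 this
  obtain ⟨j, hj⟩ := Int.eq_ofNat_of_zero_le (show 0 ≤ -l by omega)
  have hlj : l = -(j : ℤ) := by omega
  refine ⟨j, by omega, ?_, ?_⟩
  · rwa [hlj] at hl1
  · rw [hlj, add_comm, zpow_one_add₀ (by norm_num)] at hl2
    exact hl2

lemma measurableSet_strip (j : ℕ) : MeasurableSet (strip j) := measurableSet_Ioc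

lemma strip_disjoint {j k : ℕ} (h : j ≠ k) : Disjoint (strip j) (strip k) := by
  wlog hjk : j < k generalizing j k
  · exact (this h.symm (by omega)).symm
  refine Set.disjoint_left.2 fun t ht ht' => ?_
  have h1 : 2 * (2 : ℝ) ^ (-(k : ℤ)) ≤ 2 ^ (-(j : ℤ)) := by
    rw [← zpow_one_add₀ (by norm_num)]
    exact zpow_le_zpow_right₀ (by norm_num) (by omega)
  linarith [ht.1, ht'.2]

section Trace

variable {d : ℕ} {α s p : ℝ}

lemma tsum_setLIntegral_strip_le (f : E (d + 1) → ℝ≥0∞) :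
    ∑' k : ℕ, ∫⁻ y in hgt ⁻¹' strip k, f y ∂(muAlpha d α) ≤ ∫⁻ y, f y ∂(muAlpha d α) := by
  rw [← lintegral_iUnion fun k => measurable_hgt (measurableSet_strip k)]
  · exact setLIntegral_le_lintegral _ _
  · exact fun j k h => (strip_disjoint h).preimage _

lemma setLIntegral_strip (k : ℕ) {g : E d → ℝ≥0∞} (hg : AEMeasurable g) :
    ∫⁻ y in hgt ⁻¹' strip k, g (base y) ∂(muAlpha d α) = (∫⁻ x, g x) * nu α (strip k) := by
  have := setLIntegral_base (α := α) MeasurableSet.univ (measurableSet_strip k) hg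
  simpa using this

lemma at'_of_mem_strip {y : E (d + 1)} {k : ℕ} (h : hgt y ∈ strip k) :
    at' y (k : ℤ) = (at' (base y) (k : ℤ)).whitney := at'_eq_whitney h

/-- The weak form (`q = ∞`) of the Triebel-Lizorkin maximal oscillation. -/
noncomputable def maxOsc (d : ℕ) (α s : ℝ) (F : E (d + 1) → ℂ) (y : E (d + 1)) : ℝ≥0∞ :=
  ⨆ k : ℕ, (2 : ℝ≥0∞) ^ ((k : ℝ) * s) * osc (upperHalf d) (muAlpha d α) ∞ F (at' y (k : ℤ))

lemma measurable_maxOsc (F : E (d + 1) → ℂ) : Measurable (maxOsc d α s F) :=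
  Measurable.iSup fun _ => (measurable_at' _ _).const_mul _

lemma le_maxOsc (F : E (d + 1) → ℂ) (y : E (d + 1)) (k : ℕ) :
    (2 : ℝ≥0∞) ^ ((k : ℝ) * s) * osc (upperHalf d) (muAlpha d α) ∞ F (at' y (k : ℤ)) ≤
      maxOsc d α s F y :=
  le_iSup (fun k : ℕ => (2 : ℝ≥0∞) ^ ((k : ℝ) * s) *
    osc (upperHalf d) (muAlpha d α) ∞ F (at' y (k : ℤ))) k

lemma osc_le_maxOsc (F : E (d + 1) → ℂ) (y : E (d + 1)) (k : ℕ) :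
    osc (upperHalf d) (muAlpha d α) ∞ F (at' y (k : ℤ)) ≤
      ((2 : ℝ≥0∞) ^ (-s)) ^ k * maxOsc d α s F y := by
  have h := le_maxOsc (α := α) (s := s) F y k
  have e : ((2 : ℝ≥0∞) ^ (-s)) ^ k * (2 : ℝ≥0∞) ^ ((k : ℝ) * s) = 1 := by
    rw [← ENNReal.rpow_natCast, ← ENNReal.rpow_mul, ← ENNReal.rpow_add _ _ (by norm_num) (by norm_num)]
    ring_nf
    simp
  calc _ = ((2 : ℝ≥0∞) ^ (-s)) ^ k * (2 : ℝ≥0∞) ^ ((k : ℝ) * s) *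
        osc (upperHalf d) (muAlpha d α) ∞ F (at' y (k : ℤ)) := by rw [e, one_mul]
    _ ≤ _ := by rw [mul_assoc]; gcongr

/-- The Whitney cubes are disjoint, so that the oscillations over them are controlled by the
`L^p` norm of the maximal oscillation, whatever the exponent `q` is. -/
lemma tsum_whitney_osc_le (hα : -1 < α) (hp : 0 < p) {σ : ℝ} (hσ : σ * p = s * p - (α + 1)) :
    ∃ C : ℝ≥0, ∀ F : E (d + 1) → ℂ,
      ∑' k : ℕ, ((2 : ℝ≥0∞) ^ (σ * p)) ^ k *
        ∫⁻ x, osc (upperHalf d) (muAlpha d α) ∞ F (at' x (k : ℤ)).whitney ^ p ≤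
      C * ∫⁻ y, maxOsc d α s F y ^ p ∂(muAlpha d α) := by
  obtain ⟨C, hC⟩ := le_nu_strip hα
  refine ⟨C, fun F => ?_⟩
  set o : DyadicCube d → ℝ≥0∞ := fun Q => osc (upperHalf d) (muAlpha d α) ∞ F Q.whitney
  have hm : ∀ k : ℤ, Measurable fun x : E d => o (at' x k) := fun k => measurable_at' o k
  refine le_trans ?_ (mul_le_mul_right (tsum_setLIntegral_strip_le fun y => maxOsc d α s F y ^ p) _)
  rw [← ENNReal.tsum_mul_left]
  refine ENNReal.tsum_le_tsum fun k => ?_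
  have hW : ((2 : ℝ≥0∞) ^ (σ * p)) ^ k = ((2 : ℝ≥0∞) ^ ((k : ℝ) * s)) ^ p *
      ((2 : ℝ≥0∞) ^ (-(α + 1))) ^ k := by
    rw [← ENNReal.rpow_natCast, ← ENNReal.rpow_natCast, ← ENNReal.rpow_mul, ← ENNReal.rpow_mul,
      ← ENNReal.rpow_mul, ← ENNReal.rpow_add _ _ (by norm_num) (by norm_num), hσ]
    congr 1; ring
  calc ((2 : ℝ≥0∞) ^ (σ * p)) ^ k * ∫⁻ x, o (at' x (k : ℤ)) ^ p
      ≤ ((2 : ℝ≥0∞) ^ ((k : ℝ) * s)) ^ p * (C * nu α (strip k)) * ∫⁻ x, o (at' x (k : ℤ)) ^ p := by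
        rw [hW]; gcongr; exact hC k
    _ = C * ((∫⁻ x, ((2 : ℝ≥0∞) ^ ((k : ℝ) * s) * o (at' x (k : ℤ))) ^ p) * nu α (strip k)) := by
        simp_rw [ENNReal.mul_rpow_of_nonneg _ _ hp.le]
        rw [lintegral_const_mul _ ((hm _).pow_const p)]
        ring
    _ ≤ _ := by
        gcongr
        rw [← setLIntegral_strip k (((hm k).const_mul _).pow_const p).aemeasurable]
        refine setLIntegral_mono' (measurable_hgt (measurableSet_strip k)) fun y hy => ?_
        gcongr
        have := le_maxOsc (α := α) (s := s) F y k
        rwa [at'_of_mem_strip hy] at this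

lemma integrableOn_of_memLp (hp : 1 ≤ p) {F : E (d + 1) → ℂ}
    (hF : MemLp F (ENNReal.ofReal p) (muAlpha d α)) {A : Set (E (d + 1))}
    (hA : muAlpha d α A ≠ ∞) : IntegrableOn F A (muAlpha d α) := by
  have : IsFiniteMeasure ((muAlpha d α).restrict A) := ⟨by simpa using hA.lt_top⟩
  exact (hF.restrict _).integrable (by simpa using hp)

lemma aestronglyMeasurable_of_locInt {F : E (d + 1) → ℂ} (hF : LocInt (upperHalf d) F) :
    AEStronglyMeasurable F (muAlpha d α) := by
  refine AEStronglyMeasurable.mono_ac muAlpha_absolutelyContinuous ?_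
  have : upperHalf d = ⋃ m : ℕ, (upperHalf d ∩ Metric.ball 0 m) := by
    rw [← inter_iUnion, Metric.iUnion_ball_nat, inter_univ]
  rw [this, aestronglyMeasurable_iUnion_iff]
  exact fun m => (hF _ inter_subset_left
    (Metric.isBounded_ball.subset inter_subset_right)).aestronglyMeasurable

/-- Members of the Triebel-Lizorkin space are approximated by their averages over the dyadic cubes
around a point. -/
lemma ae_enorm_sub_average_le (hα : -1 < α) (hs : 0 < s) (hp : 1 ≤ p) :
    ∃ K : ℝ≥0, ∀ F : E (d + 1) → ℂ, LocInt (upperHalf d) F →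
      MemLp F (ENNReal.ofReal p) (muAlpha d α) →
      ∀ᵐ y ∂(muAlpha d α), ∀ k : ℕ,
        ‖F y - ⨍ z in (at' y (k : ℤ)).toSet, F z ∂(muAlpha d α)‖ₑ ≤
          K * (((2 : ℝ≥0∞) ^ (-s)) ^ k * maxOsc d α s F y) := by
  have hr : (2 : ℝ≥0∞) ^ (-s) < 1 := ENNReal.rpow_lt_one_of_one_lt_of_neg (by norm_num) (by linarith)
  refine ⟨(∑' i : ℕ, ((2 : ℝ≥0∞) ^ (-s)) ^ i).toNNReal, fun F hF hFp => ?_⟩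
  rw [ENNReal.coe_toNNReal (tsum_pow_ne_top hr)]
  filter_upwards [ae_tendsto_cube_muAlpha hF, ae_muAlpha_mem] with y hy hyH k
  have hsub := fun k : ℕ => at'_subset_upperHalf hyH (k : ℤ)
  have hlim : Tendsto (fun k : ℕ => ⨍ z in (at' y (k : ℤ)).toSet, F z ∂(muAlpha d α)) atTop
      (𝓝 (F y)) := by
    rw [tendsto_iff_edist_tendsto_0]
    refine tendsto_of_tendsto_of_tendsto_of_le_of_le tendsto_const_nhds hy (fun _ => zero_le)
      fun k => ?_
    simp only [edist_eq_enorm_sub]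
    exact enorm_setAverage_sub_le (muAlpha_toSet_ne_zero (hsub k)) (muAlpha_toSet_ne_top hα (hsub k))
      (integrableOn_of_memLp hp hFp (muAlpha_toSet_ne_top hα (hsub k))) _
  have h := edist_le_tsum_of_edist_le_of_tendsto
    (fun k : ℕ => ((2 : ℝ≥0∞) ^ (-s)) ^ k * maxOsc d α s F y) (fun k => ?_) hlim k
  · rw [edist_comm, edist_eq_enorm_sub] at h
    refine h.trans (le_of_eq ?_)
    rw [← ENNReal.tsum_mul_right]
    refine tsum_congr fun i => ?_
    rw [pow_add]; ring
  · rw [edist_eq_enorm_sub]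
    refine le_trans (enorm_sub_le_osc (Ω := upperHalf d) (by simp) ?_ (hsub _)) (osc_le_maxOsc F y k)
    have := neighbor_at'_succ y k
    exact_mod_cast this

lemma lintegral_maxOsc_le {q : ℝ≥0∞} (hq : 0 < q) (hp : 0 < p) (F : E (d + 1) → ℂ) :
    (∫⁻ y, maxOsc d α s F y ^ p ∂(muAlpha d α)) ≤
      ∫⁻ x in upperHalf d, (lqNorm q (fun k : ℕ => (2 : ℝ≥0∞) ^ ((k : ℝ) * s) *
        osc (upperHalf d) (muAlpha d α) q F (DyadicCube.at' x (k : ℤ)))) ^ p ∂(muAlpha d α) := by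
  rw [restrict_muAlpha]
  refine lintegral_mono fun y => ?_
  gcongr
  refine iSup_le fun k => le_trans ?_ (le_lqNorm hq (fun k : ℕ => (2 : ℝ≥0∞) ^ ((k : ℝ) * s) *
        osc (upperHalf d) (muAlpha d α) q F (DyadicCube.at' y (k : ℤ))) k)
  gcongr
  exact osc_top_le_osc hq _

lemma lintegral_whitney_average_le (hα : -1 < α) (hp : 1 ≤ p) {F : E (d + 1) → ℂ}
    (hF : AEStronglyMeasurable F (muAlpha d α)) :
    ∫⁻ x, ‖⨍ z in (at' x (0 : ℤ)).whitney.toSet, F z ∂(muAlpha d α)‖ₑ ^ p ≤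
      ∫⁻ y, ‖F y‖ₑ ^ p ∂(muAlpha d α) := by
  rw [lintegral_at' volume 0 fun Q => ‖⨍ z in Q.whitney.toSet, F z ∂(muAlpha d α)‖ₑ ^ p,
    lintegral_eq_tsum_level _ 0]
  have hinj : Function.Injective (fun Q : {Q : DyadicCube d // Q.level = 0} =>
      (⟨Q.1.whitney, Q.2⟩ : {P : DyadicCube (d + 1) // P.level = 0})) := by
    intro Q Q' h
    have := congrArg (fun P => P.1.base) h
    simpa [Subtype.ext_iff] using this
  refine le_trans (ENNReal.tsum_le_tsum fun Q => ?_) (ENNReal.tsum_comp_le_tsum_of_injective hinj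
    fun P => ∫⁻ y in P.1.toSet, ‖F y‖ₑ ^ p ∂(muAlpha d α))
  have h0 := muAlpha_toSet_ne_zero (α := α) (whitney_subset_upperHalf Q.1)
  have ht := muAlpha_toSet_ne_top hα (whitney_subset_upperHalf Q.1)
  have hv : muAlpha d α Q.1.whitney.toSet = volume Q.1.toSet := by
    rw [muAlpha_toSet, base_whitney, vert, whitney_corner_last, whitney_len, len, Q.2]
    norm_num [nu_Ioc_of_one_le]
  calc _ ≤ ((∫⁻ y in Q.1.whitney.toSet, ‖F y‖ₑ ∂(muAlpha d α)) / muAlpha d α Q.1.whitney.toSet) ^ p *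
        volume Q.1.toSet := by gcongr; exact enorm_setAverage_le h0 ht F
    _ ≤ (∫⁻ y in Q.1.whitney.toSet, ‖F y‖ₑ ^ p ∂(muAlpha d α)) / muAlpha d α Q.1.whitney.toSet *
        volume Q.1.toSet := by gcongr; exact rpow_setAverage_le hp h0 ht hF.enorm
    _ = _ := by rw [← hv, ENNReal.div_mul_cancel h0 ht]

lemma rpow_one_div_le {C : ℝ≥0} (hp : 1 ≤ p) {x P₁ P₂ : ℝ≥0∞} (h : x ≤ C * (P₁ + P₂)) :
    x ^ (1 / p) ≤ (C ^ (1 / p) : ℝ≥0) * (P₁ ^ (1 / p) + P₂ ^ (1 / p)) := by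
  have hp1 : 1 / p ≤ 1 := by rw [div_le_one (by linarith)]; exact hp
  have hp0 : 0 ≤ 1 / p := by positivity
  calc x ^ (1 / p) ≤ (C * (P₁ + P₂)) ^ (1 / p) := by gcongr
    _ = (C : ℝ≥0∞) ^ (1 / p) * (P₁ + P₂) ^ (1 / p) := ENNReal.mul_rpow_of_nonneg _ _ hp0
    _ ≤ _ := by
      rw [ENNReal.coe_rpow_of_nonneg _ hp0]
      gcongr
      exact ENNReal.rpow_add_le_add_rpow _ _ hp0 hp1

/-- Existence of traces and the trace inequality. The trace is the limit of the averages over the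
Whitney cubes above the cubes that shrink to a point; the constant does not depend on `q`. -/
lemma exists_trace (hα : -1 < α) (hs : 0 < s) (hp : 1 ≤ p) {σ : ℝ} (hσ0 : 0 < σ)
    (hσ : σ * p = s * p - (α + 1)) :
    ∃ C : ℝ≥0, ∀ q : ℝ≥0∞, 0 < q → ∀ F ∈ triebelSpace (upperHalf d) (muAlpha d α) s p q,
      ∃ h : E d → ℂ, MemLp h (ENNReal.ofReal p) volume ∧
        (∀ᵐ x, Tendsto (halfBallAverage (muAlpha d α) F x) (𝓝[>] 0) (𝓝 (h x))) ∧
        besovNorm univ volume σ (ENNReal.ofReal p) (ENNReal.ofReal p) h ≤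
          C * triebelNorm (upperHalf d) (muAlpha d α) s p q F := by
  have hp0 : 0 < p := by linarith
  have hσp : 0 < σ * p := by positivity
  set W : ℝ≥0∞ := 2 ^ (σ * p) with hWdef
  have hW : 1 < W := ENNReal.one_lt_rpow (by norm_num) hσp
  have hW' : W ≠ ∞ := by rw [hWdef]; finiteness
  obtain ⟨C₁, hC₁⟩ := tsum_whitney_osc_le (d := d) hα hp0 hσ
  obtain ⟨C₂, hC₂⟩ := besov_le_of_tower d hp hW hW'
  obtain ⟨C₃, hC₃⟩ := tsum_tail_le hp hW hW'
  obtain ⟨K, hK⟩ := ae_enorm_sub_average_le (d := d) hα hs hp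
  set A : ℝ≥0∞ := 2 ^ p * (1 + C₃ * C₁) with hA
  have hAt : A ≠ ∞ := by rw [hA]; finiteness
  refine ⟨A.toNNReal ^ (1 / p) + (C₂ * C₁) ^ (1 / p), fun q hq F ⟨hFloc, hFn⟩ => ?_⟩
  set μ := muAlpha d α with hμ
  set G := maxOsc d α s F with hG
  -- The two parts of the norm.
  set P₁ : ℝ≥0∞ := ∫⁻ y, ‖F y‖ₑ ^ p ∂μ with hP₁
  set P₂ : ℝ≥0∞ := ∫⁻ x in upperHalf d, (lqNorm q (fun k : ℕ => (2 : ℝ≥0∞) ^ ((k : ℝ) * s) *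
        osc (upperHalf d) (muAlpha d α) q F (DyadicCube.at' x (k : ℤ)))) ^ p ∂μ with hP₂
  have hnorm : triebelNorm (upperHalf d) μ s p q F = P₁ ^ (1 / p) + P₂ ^ (1 / p) := by
    rw [triebelNorm, hP₁, hP₂, hμ, restrict_muAlpha, eLpNorm_ofReal hp0]
  have hG2 : ∫⁻ y, G y ^ p ∂μ ≤ P₂ := lintegral_maxOsc_le hq hp0 F
  rw [hnorm, ENNReal.add_lt_top] at hFn
  have hpp : 0 < 1 / p := by positivity
  have hP₁t : P₁ ≠ ∞ := ((ENNReal.rpow_lt_top_iff_of_pos hpp).1 hFn.1).ne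
  have hP₂t : P₂ ≠ ∞ := ((ENNReal.rpow_lt_top_iff_of_pos hpp).1 hFn.2).ne
  have hFm : AEStronglyMeasurable F μ := aestronglyMeasurable_of_locInt hFloc
  have hFp : MemLp F (ENNReal.ofReal p) μ := ⟨hFm, by rw [eLpNorm_ofReal hp0]; exact hFn.1⟩
  -- The averages over Whitney cubes, and their oscillations.
  set a : DyadicCube d → ℂ := fun Q => ⨍ z in Q.whitney.toSet, F z ∂μ with ha
  set o : DyadicCube d → ℝ≥0∞ := fun Q => osc (upperHalf d) μ ∞ F Q.whitney with ho
  have hao : ∀ Q Q' : DyadicCube d, 0 ≤ Q.level → Q.Neighbor Q' → ‖a Q - a Q'‖ₑ ≤ o Q :=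
    fun Q Q' _ h => enorm_sub_le_osc (by simp) h.whitney (whitney_subset_upperHalf _)
  have hS : ∑' k : ℕ, W ^ k * ∫⁻ x, o (at' x (k : ℤ)) ^ p ≤ C₁ * P₂ :=
    (hC₁ F).trans (by gcongr)
  have htail : ∑' k : ℕ, W ^ k * ∫⁻ x, tail o k x ^ p ≤ C₃ * (C₁ * P₂) :=
    (hC₃ d o).trans (by gcongr)
  have htailk : ∀ k : ℕ, ∫⁻ x, tail o k x ^ p ≤ C₃ * (C₁ * P₂) := by
    intro k
    refine le_trans ?_ ((ENNReal.le_tsum k).trans htail)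
    exact le_mul_of_one_le_left (by simp) (one_le_pow₀ hW.le)
  have htail0 : ∀ᵐ x, tail o 0 x ≠ ∞ := by
    have := ae_lt_top' ((measurable_tail o 0).pow_const p).aemeasurable
      (ne_top_of_le_ne_top (by finiteness) (htailk 0))
    filter_upwards [this] with x hx
    exact ((ENNReal.rpow_lt_top_iff_of_pos hp0).1 hx).ne
  -- The averages converge along almost every tower.
  have hconv : ∀ᵐ x, ∃ l, Tendsto (fun k : ℕ => a (at' x (k : ℤ))) atTop (𝓝 l) := by
    filter_upwards [htail0] with x hx
    refine cauchySeq_tendsto_of_complete (cauchySeq_of_edist_le_of_tsum_ne_top _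
      (fun k => edist_at'_succ_le hao x k) ?_)
    simpa [tail] using hx
  have ham : ∀ k : ℕ, AEMeasurable (fun x => a (at' x (k : ℤ))) volume :=
    fun k => (measurable_at' a _).aemeasurable
  obtain ⟨h, hhm, hh⟩ := measurable_limit_of_tendsto_metrizable_ae ham hconv
  have hhx : ∀ᵐ x, ∀ k : ℕ, ‖h x - a (at' x (k : ℤ))‖ₑ ≤ tail o k x := by
    filter_upwards [hh] with x hx k
    have := edist_le_tsum_of_edist_le_of_tendsto _ (fun k => edist_at'_succ_le hao x k) hx k
    rwa [edist_comm, edist_eq_enorm_sub] at this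
  have hh0 : ∫⁻ x, ‖h x‖ₑ ^ p ≤ A * (P₁ + P₂) := by
    calc ∫⁻ x, ‖h x‖ₑ ^ p ≤ ∫⁻ x, 2 ^ p * (‖a (at' x (0 : ℤ))‖ₑ ^ p + tail o 0 x ^ p) := by
          refine lintegral_mono_ae ?_
          filter_upwards [hhx] with x hx
          refine le_trans ?_ (rpow_add_le hp _ _)
          gcongr
          have e : h x = a (at' x (0 : ℤ)) + (h x - a (at' x (0 : ℤ))) := by ring
          rw [e]
          refine (enorm_add_le _ _).trans ?_
          gcongr
          exact hx 0
      _ = 2 ^ p * ((∫⁻ x, ‖a (at' x (0 : ℤ))‖ₑ ^ p) + ∫⁻ x, tail o 0 x ^ p) := by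
          rw [lintegral_const_mul' _ _ (by finiteness),
            lintegral_add_left ((measurable_at' (fun Q => ‖a Q‖ₑ) 0).pow_const p)]
      _ ≤ 2 ^ p * (P₁ + C₃ * (C₁ * P₂)) := by
          gcongr
          · exact lintegral_whitney_average_le hα hp hFm
          · exact htailk 0
      _ ≤ 2 ^ p * ((1 + C₃ * C₁) * P₁ + (1 + C₃ * C₁) * P₂) := by
          refine mul_le_mul_right (add_le_add ?_ ?_) _
          · exact le_mul_of_one_le_left (by simp) le_self_add
          · rw [← mul_assoc]; gcongr; exact le_add_self
      _ = _ := by rw [hA]; ring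
  have hhp : MemLp h (ENNReal.ofReal p) volume := by
    refine ⟨hhm.aestronglyMeasurable, ?_⟩
    rw [eLpNorm_ofReal hp0, ENNReal.rpow_lt_top_iff_of_pos hpp]
    refine lt_of_le_of_lt hh0 ?_
    finiteness
  have hhl : LocallyIntegrable h := locallyIntegrable_of_locInt (locInt_of_memLp hp hhp)
  refine ⟨h, hhp, ?_, ?_⟩
  · refine ae_tendsto_halfBallAverage (G := fun y => K * G y) (D := fun m x => tail o m x) hα hp hs.le
      (by linarith) (fun x r => integrableOn_of_memLp hp hFp (muAlpha_cyl_ne_top hα x r)) hhl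
      (fun m => (measurable_tail o m).aemeasurable)
      (fun m => ne_top_of_le_ne_top (by finiteness) (htailk m))
      (htail0.mono fun x hx => tendsto_tail hx) ((measurable_maxOsc F).const_mul _) ?_ ?_
    · simp_rw [ENNReal.mul_rpow_of_nonneg _ _ hp0.le]
      rw [lintegral_const_mul' _ _ (by finiteness)]
      exact ENNReal.mul_ne_top (by finiteness) (ne_top_of_le_ne_top hP₂t hG2)
    · filter_upwards [hK F hFloc hFp, ae_muAlpha_mem, ae_muAlpha_base hhx] with y hy hyH hyb m hm
      have hym : hgt y ≤ 2 * (2 : ℝ) ^ (-(m : ℤ)) :=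
        hm.trans (le_mul_of_one_le_left (by positivity) (by norm_num))
      obtain ⟨j, hmj, hj⟩ := exists_mem_strip hyH hym
      have h1 := hy j
      rw [at'_of_mem_strip hj] at h1
      have e : F y - h (base y) = (F y - a (at' (base y) (j : ℤ))) -
        (h (base y) - a (at' (base y) (j : ℤ))) := by ring
      rw [e]
      refine (enorm_sub_le).trans (add_le_add (h1.trans ?_) ((hyb j).trans (tail_antitone o _ hmj)))
      have h2 : ((2 : ℝ≥0∞) ^ (-s)) ^ j ≤ ENNReal.ofReal (hgt y) ^ s := by
        rw [← ofReal_zpow_neg_rpow, ENNReal.ofReal_rpow_of_pos (show 0 < hgt y from hyH)]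
        exact ENNReal.ofReal_le_ofReal (Real.rpow_le_rpow (by positivity) hj.1.le hs.le)
      calc _ ≤ K * (ENNReal.ofReal (hgt y) ^ s * G y) := by gcongr
        _ = _ := by ring
  · rw [besovNorm_eq hp0, eLpNorm_ofReal hp0, hnorm, ENNReal.coe_add, add_mul]
    gcongr
    · refine rpow_one_div_le hp ?_
      rwa [ENNReal.coe_toNNReal hAt]
    · refine rpow_one_div_le hp ?_
      refine (hC₂ h a o hhl hao hhx).trans ?_
      push_cast
      calc _ ≤ C₂ * (C₁ * P₂) := by gcongr
        _ ≤ C₂ * (C₁ * (P₁ + P₂)) := by gcongr; exact le_add_self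
        _ = _ := by ring

end Trace

/-! ### Pointwise estimates for the Whitney extension -/

lemma Neighbor.abs_sub_le {n : ℕ} {Q Q' : DyadicCube n} (h : Q.Neighbor Q') {x z : E n}
    (hx : x ∈ Q.toSet) (hz : z ∈ Q'.toSet) (l : Fin n) : |z l - x l| ≤ 3 * Q.len := by
  have h1 := (neighbor_iff.1 h).2 l
  have h2 := hx l
  have h3 := hz l
  have h4 := h.len_le
  rw [_root_.abs_le]
  constructor <;> nlinarith

section Ext

variable {d : ℕ} {ψ : SmallCube d → E (d + 1) → ℝ}

lemma exists_whitney_near (hψ : IsWhitneyBumps d ψ) {Q : SmallCube d} {z : E (d + 1)}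
    (h : ψ Q z ≠ 0) : ∃ w ∈ Q.1.whitney.toSet, ∀ l, |z l - w l| < Q.1.len / 4 := by
  have h1 := hψ.supp Q (subset_tsupport _ h)
  obtain ⟨w, hw, hd⟩ := Metric.mem_thickening_iff.1 h1
  exact ⟨w, hw, fun l => (abs_coord_le_dist z w l).trans_lt hd⟩

lemma hgt_bounds (hψ : IsWhitneyBumps d ψ) {Q : SmallCube d} {z : E (d + 1)} (h : ψ Q z ≠ 0) :
    3 / 4 * Q.1.len < hgt z ∧ hgt z < 9 / 4 * Q.1.len := by
  obtain ⟨w, hw, hzw⟩ := exists_whitney_near hψ h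
  have h1 := (mem_whitney.1 hw).2
  have h2 := abs_lt.1 (hzw (Fin.last d))
  have h3 : hgt z = z (Fin.last d) := rfl
  have h4 : hgt w = w (Fin.last d) := rfl
  constructor <;> linarith [h1.1, h1.2]

lemma small_len_le_one (Q : SmallCube d) : Q.1.len ≤ 1 :=
  zpow_le_one_of_nonpos₀ (by norm_num) (by have := Q.2; omega)

lemma ext_eq_zero_of_le (hψ : IsWhitneyBumps d ψ) (f : E d → ℂ) {z : E (d + 1)}
    (hz : 9 / 4 ≤ hgt z) : ext ψ f z = 0 := by
  refine (tsum_congr fun Q => ?_).trans tsum_zero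
  have : ψ Q z = 0 := by
    by_contra h
    have h1 := (hgt_bounds hψ h).2
    have h2 := small_len_le_one Q
    linarith
  simp [this]

/-- Only neighbours of the boundary cube below a point `x` contribute to the extension near `x`. -/
lemma neighbor_of_ne_zero (hψ : IsWhitneyBumps d ψ) {P : DyadicCube d} {Q : SmallCube d}
    {x z : E (d + 1)} (hx : base x ∈ P.toSet) (hx1 : P.len < hgt x)
    (hx2 : hgt x ≤ 2 * P.len ∨ P.level = 0) (hxz : ∀ l, |z l - x l| ≤ 3 / 16 * P.len)
    (h : ψ Q z ≠ 0) : P.Neighbor Q.1 := by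
  obtain ⟨w, hw, hzw⟩ := exists_whitney_near hψ h
  obtain ⟨hz1, hz2⟩ := hgt_bounds hψ h
  have hL := P.len_pos
  have hM := Q.1.len_pos
  have hxl := _root_.abs_le.1 (hxz (Fin.last d))
  have e1 : hgt z = z (Fin.last d) := rfl
  have e2 : hgt x = x (Fin.last d) := rfl
  have hl1 : P.level - 1 ≤ Q.1.level := by
    by_contra hc
    have hQ := Q.2
    have h3 : hgt x ≤ 2 * P.len := hx2.resolve_right (by omega)
    have h4 : 4 * P.len ≤ Q.1.len := by
      unfold len
      rw [show (4 : ℝ) = 2 ^ (2 : ℤ) by norm_num, ← zpow_add₀ (by norm_num)]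
      exact zpow_le_zpow_right₀ (by norm_num) (by omega)
    linarith
  have hl2 : Q.1.level ≤ P.level + 1 := by
    by_contra hc
    have h4 : 4 * Q.1.len ≤ P.len := by
      unfold len
      rw [show (4 : ℝ) = 2 ^ (2 : ℤ) by norm_num, ← zpow_add₀ (by norm_num)]
      exact zpow_le_zpow_right₀ (by norm_num) (by omega)
    linarith
  rw [neighbor_iff]
  refine ⟨⟨hl1, hl2⟩, fun l => ?_⟩
  have hxP := hx l
  have hwQ := (mem_whitney.1 hw).1 l
  rw [base_apply] at hxP hwQ
  have h5 := _root_.abs_le.1 (hxz l.castSucc)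
  have h6 := abs_lt.1 (hzw l.castSucc)
  -- Endpoints are multiples of the smaller edge length, which exceeds the distance of the points.
  have hcases : Q.1.len = 2 * P.len ∨ Q.1.len = P.len ∨ P.len = 2 * Q.1.len := by
    obtain h7 | h7 | h7 :
        P.level = Q.1.level + 1 ∨ P.level = Q.1.level ∨ Q.1.level = P.level + 1 := by omega
    · exact Or.inl (len_eq_two_mul h7)
    · exact Or.inr (Or.inl (by unfold len; rw [h7]))
    · exact Or.inr (Or.inr (len_eq_two_mul h7))
  have hint : ∀ (a b : ℤ), (a : ℝ) < b → (a : ℝ) + 1 ≤ b := fun a b hab => by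
    exact_mod_cast Int.add_one_le_iff.2 (Int.cast_lt.1 hab)
  constructor
  · by_contra! hc
    rcases hcases with h7 | h7 | h7
    · rw [h7] at hc h6 hwQ
      have h8 : ((2 * (Q.1.corner l + 1) : ℤ) : ℝ) < (P.corner l : ℤ) := by push_cast; nlinarith
      have h9 := hint _ _ h8
      push_cast at h9
      nlinarith
    · rw [h7] at hc h6 hwQ
      have h8 : ((Q.1.corner l + 1 : ℤ) : ℝ) < (P.corner l : ℤ) := by push_cast; nlinarith
      have h9 := hint _ _ h8
      push_cast at h9
      nlinarith
    · rw [h7] at hc h5 hxP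
      have h8 : ((Q.1.corner l + 1 : ℤ) : ℝ) < (2 * P.corner l : ℤ) := by push_cast; nlinarith
      have h9 := hint _ _ h8
      push_cast at h9
      nlinarith
  · by_contra! hc
    rcases hcases with h7 | h7 | h7
    · rw [h7] at hc h6 hwQ
      have h8 : ((P.corner l + 1 : ℤ) : ℝ) < (2 * Q.1.corner l : ℤ) := by push_cast; nlinarith
      have h9 := hint _ _ h8
      push_cast at h9
      nlinarith
    · rw [h7] at hc h6 hwQ
      have h8 : ((P.corner l + 1 : ℤ) : ℝ) < (Q.1.corner l : ℤ) := by push_cast; nlinarith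
      have h9 := hint _ _ h8
      push_cast at h9
      nlinarith
    · rw [h7] at hc h5 hxP
      have h8 : ((2 * (P.corner l + 1) : ℤ) : ℝ) < (Q.1.corner l : ℤ) := by push_cast; nlinarith
      have h9 := hint _ _ h8
      push_cast at h9
      nlinarith

/-- The neighbours of edge length at most one. -/
noncomputable def smallNbrs (P : DyadicCube d) : Finset (SmallCube d) :=
  P.nbrs.subtype fun Q => 0 ≤ Q.level

lemma mem_smallNbrs {P : DyadicCube d} {Q : SmallCube d} : Q ∈ smallNbrs P ↔ P.Neighbor Q.1 := by
  rw [smallNbrs, Finset.mem_subtype, mem_nbrs]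

lemma card_smallNbrs_le (P : DyadicCube d) : (smallNbrs P).card ≤ 3 * 4 ^ d := by
  rw [smallNbrs, Finset.card_subtype]
  exact (Finset.card_filter_le _ _).trans P.card_nbrs_le

/-- `x` lies above the cube `P` of edge length `2^{-i}`, at height about `2^{-i}`, where `i = 0`
comprises all heights above `1`. -/
def Above (x : E (d + 1)) (i : ℕ) : Prop :=
  (2 : ℝ) ^ (-(i : ℤ)) < hgt x ∧ (hgt x ≤ 2 * (2 : ℝ) ^ (-(i : ℤ)) ∨ i = 0)

lemma Above.of_mem_strip {x : E (d + 1)} {i : ℕ} (h : hgt x ∈ strip i) : Above x i :=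
  ⟨h.1, Or.inl h.2⟩

lemma Above.mem_smallNbrs (hψ : IsWhitneyBumps d ψ) {x z : E (d + 1)} {i : ℕ} (h : Above x i)
    (hxz : ∀ l, |z l - x l| ≤ 3 / 16 * (2 : ℝ) ^ (-(i : ℤ))) {Q : SmallCube d} (hQ : ψ Q z ≠ 0) :
    Q ∈ smallNbrs (at' (base x) (i : ℤ)) :=
  WhitneyTrace.mem_smallNbrs.2 (neighbor_of_ne_zero hψ (mem_at' _ _) h.1
    (h.2.imp_right fun h => by simp [h]) hxz hQ)

lemma Above.ext_eq_sum (hψ : IsWhitneyBumps d ψ) {x z : E (d + 1)} {i : ℕ} (h : Above x i)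
    (hxz : ∀ l, |z l - x l| ≤ 3 / 16 * (2 : ℝ) ^ (-(i : ℤ))) (f : E d → ℂ) :
    ext ψ f z = ∑ Q ∈ smallNbrs (at' (base x) (i : ℤ)), (⨍ y in Q.1.toSet, f y) * (ψ Q z : ℂ) := by
  unfold ext
  refine tsum_eq_sum fun Q hQ => ?_
  have : ψ Q z = 0 := by
    by_contra h'
    exact hQ (h.mem_smallNbrs hψ hxz h')
  simp [this]

lemma Above.sum_eq_one (hψ : IsWhitneyBumps d ψ) {x z : E (d + 1)} {i : ℕ} (h : Above x i)
    (hxz : ∀ l, |z l - x l| ≤ 3 / 16 * (2 : ℝ) ^ (-(i : ℤ))) (hz0 : 0 < hgt z) (hz : hgt z ≤ 2) :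
    ∑ Q ∈ smallNbrs (at' (base x) (i : ℤ)), ψ Q z = 1 := by
  obtain ⟨j, -, hj⟩ := exists_mem_strip hz0 (m := 0) (by simpa using hz)
  have hmem : z ∈ ⋃ Q : SmallCube d, Q.1.whitney.toSet :=
    mem_iUnion.2 ⟨⟨at' (base z) (j : ℤ), by simp⟩, mem_whitney.2 ⟨mem_at' _ _, hj⟩⟩
  rw [← hψ.sum_eq_one z hmem]
  refine (tsum_eq_sum fun Q hQ => ?_).symm
  by_contra h'
  exact hQ (h.mem_smallNbrs hψ hxz h')

lemma enorm_psi (hψ : IsWhitneyBumps d ψ) (Q : SmallCube d) (z : E (d + 1)) :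
    ‖(ψ Q z : ℂ)‖ₑ = ENNReal.ofReal (ψ Q z) := by
  rw [← ofReal_norm, Complex.norm_real, Real.norm_of_nonneg (hψ.mem_Icc Q z).1]

/-- Where the bumps form a partition of unity, the extension is a convex combination of averages. -/
lemma enorm_ext_sub_le (hψ : IsWhitneyBumps d ψ) {x : E (d + 1)} {i : ℕ} (h : hgt x ∈ strip i)
    (f : E d → ℂ) (c : ℂ) {B : ℝ≥0∞}
    (hB : ∀ Q, (at' (base x) (i : ℤ)).Neighbor Q → ‖(⨍ y in Q.toSet, f y) - c‖ₑ ≤ B) :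
    ‖ext ψ f x - c‖ₑ ≤ B := by
  have hA := Above.of_mem_strip h
  have hxx : ∀ l, |x l - x l| ≤ 3 / 16 * (2 : ℝ) ^ (-(i : ℤ)) := fun l => by
    rw [sub_self, abs_zero]; positivity
  have h0 : 0 < hgt x := lt_trans (by positivity) h.1
  have h2 : hgt x ≤ 2 := h.2.trans (by
    have : (2 : ℝ) ^ (-(i : ℤ)) ≤ 1 := zpow_le_one_of_nonpos₀ (by norm_num) (by omega)
    linarith)
  have hs := hA.sum_eq_one hψ hxx h0 h2
  have hs' : ∑ Q ∈ smallNbrs (at' (base x) (i : ℤ)), (ψ Q x : ℂ) = 1 := by exact_mod_cast hs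
  have e : ext ψ f x - c = ∑ Q ∈ smallNbrs (at' (base x) (i : ℤ)),
      ((⨍ y in Q.1.toSet, f y) - c) * (ψ Q x : ℂ) := by
    simp_rw [sub_mul]
    rw [Finset.sum_sub_distrib, ← Finset.mul_sum, hs', mul_one, hA.ext_eq_sum hψ hxx]
  rw [e]
  calc _ ≤ ∑ Q ∈ smallNbrs (at' (base x) (i : ℤ)), B * ENNReal.ofReal (ψ Q x) := by
        refine (enorm_sum_le _ _).trans (Finset.sum_le_sum fun Q hQ => ?_)
        rw [enorm_mul, enorm_psi hψ]
        gcongr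
        exact hB _ (mem_smallNbrs.1 hQ)
    _ = B := by
        rw [← Finset.mul_sum, ← ENNReal.ofReal_sum_of_nonneg fun Q _ => (hψ.mem_Icc Q x).1, hs]
        simp

lemma enorm_ext_le (hψ : IsWhitneyBumps d ψ) {x : E (d + 1)} {i : ℕ} (h : Above x i)
    (f : E d → ℂ) {B : ℝ≥0∞}
    (hB : ∀ Q, (at' (base x) (i : ℤ)).Neighbor Q → ‖(⨍ y in Q.toSet, f y)‖ₑ ≤ B) :
    ‖ext ψ f x‖ₑ ≤ (3 * 4 ^ d : ℕ) * B := by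
  have hxx : ∀ l, |x l - x l| ≤ 3 / 16 * (2 : ℝ) ^ (-(i : ℤ)) := fun l => by
    rw [sub_self, abs_zero]; positivity
  rw [h.ext_eq_sum hψ hxx]
  calc _ ≤ ∑ Q ∈ smallNbrs (at' (base x) (i : ℤ)), B := by
        refine (enorm_sum_le _ _).trans (Finset.sum_le_sum fun Q hQ => ?_)
        rw [enorm_mul, enorm_psi hψ]
        refine (mul_le_mul' (hB _ (mem_smallNbrs.1 hQ)) (ENNReal.ofReal_le_one.2
          (hψ.mem_Icc Q x).2)).trans (mul_one B).le
    _ ≤ _ := by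
        rw [Finset.sum_const, nsmul_eq_mul]
        gcongr
        exact card_smallNbrs_le _

/-- The Lipschitz estimate for the extension. A constant may be subtracted from the averages where
the bumps form a partition of unity. -/
lemma enorm_ext_sub_ext_le (hψ : IsWhitneyBumps d ψ) : ∃ C : ℝ≥0, ∀ {x y z : E (d + 1)} {i : ℕ}
    (_ : Above x i) (_ : ∀ l, |y l - x l| ≤ 3 / 16 * (2 : ℝ) ^ (-(i : ℤ)))
    (_ : ∀ l, |z l - x l| ≤ 3 / 16 * (2 : ℝ) ^ (-(i : ℤ))) (f : E d → ℂ) (c : ℂ)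
    (_ : c = 0 ∨ ∑ Q ∈ smallNbrs (at' (base x) (i : ℤ)), ψ Q y =
      ∑ Q ∈ smallNbrs (at' (base x) (i : ℤ)), ψ Q z) {B : ℝ≥0∞}
    (_ : ∀ Q, (at' (base x) (i : ℤ)).Neighbor Q → ‖(⨍ y in Q.toSet, f y) - c‖ₑ ≤ B),
    ‖ext ψ f y - ext ψ f z‖ₑ ≤ C * (ENNReal.ofReal ((2 : ℝ) ^ (i : ℤ) * dist y z) * B) := by
  obtain ⟨C₀, hC₀⟩ := hψ.lipschitz
  refine ⟨(3 * 4 ^ d : ℕ) * Real.toNNReal (2 * |C₀|), fun {x y z i} h hy hz f c hc {B} hB => ?_⟩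
  set t := smallNbrs (at' (base x) (i : ℤ))
  have e : ext ψ f y - ext ψ f z =
      ∑ Q ∈ t, ((⨍ y in Q.1.toSet, f y) - c) * ((ψ Q y - ψ Q z : ℝ) : ℂ) := by
    rw [h.ext_eq_sum hψ hy, h.ext_eq_sum hψ hz]
    change ∑ Q ∈ t, _ - ∑ Q ∈ t, _ = _
    have h0 : c * ∑ Q ∈ t, ((ψ Q y - ψ Q z : ℝ) : ℂ) = 0 := by
      rcases hc with hc | hc
      · rw [hc, zero_mul]
      · rw [← Complex.ofReal_sum, Finset.sum_sub_distrib, hc, sub_self]; simp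
    have h1 : ∀ Q : SmallCube d, ((⨍ y in Q.1.toSet, f y) - c) * ((ψ Q y - ψ Q z : ℝ) : ℂ) =
        (⨍ y in Q.1.toSet, f y) * ((ψ Q y - ψ Q z : ℝ) : ℂ) - c * ((ψ Q y - ψ Q z : ℝ) : ℂ) :=
      fun Q => sub_mul _ _ _
    rw [Finset.sum_congr rfl fun Q _ => h1 Q, Finset.sum_sub_distrib, ← Finset.mul_sum, h0, sub_zero,
      ← Finset.sum_sub_distrib]
    refine Finset.sum_congr rfl fun Q _ => ?_
    push_cast; ring
  rw [e]
  calc _ ≤ ∑ Q ∈ t, B * ENNReal.ofReal (2 * |C₀| * ((2 : ℝ) ^ (i : ℤ) * dist y z)) := by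
        refine (enorm_sum_le _ _).trans (Finset.sum_le_sum fun Q hQ => ?_)
        rw [enorm_mul]
        have hN := mem_smallNbrs.1 hQ
        gcongr
        · exact hB _ hN
        · rw [← ofReal_norm, Complex.norm_real, Real.norm_eq_abs]
          refine ENNReal.ofReal_le_ofReal ((hC₀ Q y z).trans ?_)
          have h3 : (1 : ℝ) / Q.1.len ≤ 2 * (2 : ℝ) ^ (i : ℤ) := by
            rw [div_le_iff₀ Q.1.len_pos]
            have h4 := hN.symm.len_le
            have h5 : (2 : ℝ) ^ (i : ℤ) * (at' (base x) (i : ℤ)).len = 1 := by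
              rw [len, at'_level, ← zpow_add₀ (by norm_num)]; simp
            have h6 : (0 : ℝ) < 2 ^ (i : ℤ) := by positivity
            nlinarith
          calc C₀ / Q.1.len * dist y z ≤ |C₀| * (1 / Q.1.len) * dist y z := by
                rw [mul_one_div]
                gcongr
                · exact Q.1.len_pos.le
                · exact le_abs_self _
            _ ≤ |C₀| * (2 * (2 : ℝ) ^ (i : ℤ)) * dist y z := by gcongr
            _ = _ := by ring
    _ ≤ (3 * 4 ^ d : ℕ) * (B * ENNReal.ofReal (2 * |C₀| * ((2 : ℝ) ^ (i : ℤ) * dist y z))) := by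
        rw [Finset.sum_const, nsmul_eq_mul]
        gcongr
        exact card_smallNbrs_le _
    _ = _ := by
        rw [ENNReal.ofReal_mul (by positivity)]
        push_cast
        rw [ENNReal.ofReal]
        ring

lemma summable_ext (hψ : IsWhitneyBumps d ψ) (f : E d → ℂ) (z : E (d + 1)) :
    Summable fun Q : SmallCube d => (⨍ y in Q.1.toSet, f y) * (ψ Q z : ℂ) := by
  by_cases hz : ∃ i, Above z i
  · obtain ⟨i, hi⟩ := hz
    refine summable_of_ne_finset_zero (s := smallNbrs (at' (base z) (i : ℤ))) fun Q hQ => ?_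
    have : ψ Q z = 0 := by
      by_contra h'
      exact hQ (hi.mem_smallNbrs hψ (fun l => by rw [sub_self, abs_zero]; positivity) h')
    simp [this]
  · refine (summable_zero).congr fun Q => ?_
    have : ψ Q z = 0 := by
      by_contra h'
      have h0 : 0 < hgt z := lt_trans (by have := Q.1.len_pos; positivity) (hgt_bounds hψ h').1
      rcases le_or_gt (hgt z) 2 with h2 | h2
      · obtain ⟨j, -, hj⟩ := exists_mem_strip h0 (m := 0) (by simpa using h2)
        exact hz ⟨j, Above.of_mem_strip hj⟩
      · exact hz ⟨0, by norm_num; linarith, Or.inr rfl⟩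
    simp [this]

lemma ext_sub (hψ : IsWhitneyBumps d ψ) {f g : E d → ℂ} (hf : LocInt univ f) (hg : LocInt univ g) :
    ext ψ (f - g) = ext ψ f - ext ψ g := by
  funext z
  simp only [ext, Pi.sub_apply]
  rw [← (summable_ext hψ f z).tsum_sub (summable_ext hψ g z)]
  refine tsum_congr fun Q => ?_
  rw [← sub_mul, ← setAverage_sub (hf _ (subset_univ _) (isBounded_toSet _))
    (hg _ (subset_univ _) (isBounded_toSet _))]

lemma measurable_ext (hψ : IsWhitneyBumps d ψ) (f : E d → ℂ) : Measurable (ext ψ f) := by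
  have : Countable (SmallCube d) := inferInstance
  refine measurable_of_tendsto_metrizable' (atTop : Filter (Finset (SmallCube d)))
    (f := fun t z => ∑ Q ∈ t, (⨍ y in Q.1.toSet, f y) * (ψ Q z : ℂ)) (fun t => ?_) ?_
  · refine Finset.measurable_sum _ fun Q _ => ?_
    have := (hψ.smooth Q).continuous.measurable
    fun_prop
  · rw [tendsto_pi_nhds]
    exact fun z => (summable_ext hψ f z).hasSum

end Ext

section Average

variable {X : Type*} [MeasurableSpace X] {μ : Measure X}

lemma enorm_setAverage_sub_le_of_forall {s : Set X} (hs : MeasurableSet s) (h0 : μ s ≠ 0)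
    (ht : μ s ≠ ∞) {f : X → ℂ} (hf : IntegrableOn f s μ) {c : ℂ} {B : ℝ≥0∞}
    (h : ∀ x ∈ s, ‖f x - c‖ₑ ≤ B) : ‖(⨍ x in s, f x ∂μ) - c‖ₑ ≤ B := by
  refine (enorm_setAverage_sub_le h0 ht hf c).trans ?_
  calc _ ≤ (∫⁻ _x in s, B ∂μ) / μ s := ENNReal.div_le_div_right (setLIntegral_mono' hs h) _
    _ = B := by rw [setLIntegral_const, ENNReal.mul_div_cancel_right h0 ht]

lemma enorm_setAverage_sub_setAverage_le {s t : Set X} (hs : MeasurableSet s) (hs0 : μ s ≠ 0)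
    (hst : μ s ≠ ∞) (ht : MeasurableSet t) (ht0 : μ t ≠ 0) (htt : μ t ≠ ∞) {f : X → ℂ}
    (hfs : IntegrableOn f s μ) (hft : IntegrableOn f t μ) {B : ℝ≥0∞}
    (h : ∀ x ∈ s, ∀ y ∈ t, ‖f x - f y‖ₑ ≤ B) :
    ‖(⨍ x in s, f x ∂μ) - ⨍ y in t, f y ∂μ‖ₑ ≤ B := by
  rw [enorm_sub_rev]
  refine enorm_setAverage_sub_le_of_forall ht ht0 htt hft fun y hy => ?_
  rw [enorm_sub_rev]
  exact enorm_setAverage_sub_le_of_forall hs hs0 hst hfs fun x hx => h x hx y hy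

end Average

/-! ### Oscillations of the Whitney extension -/

section ExtOsc

variable {d : ℕ} {ψ : SmallCube d → E (d + 1) → ℝ} {α p : ℝ}

lemma ae_enorm_sub_le_tail {n : ℕ} {f : E n → ℂ} (hf : LocallyIntegrable f) :
    ∀ᵐ x, ∀ k : ℕ, ‖f x - ⨍ y in (at' x (k : ℤ)).toSet, f y‖ₑ ≤
      tail (osc univ volume ∞ f) k x := by
  filter_upwards [ae_tendsto_cube hf] with x hx k
  have hlim : Tendsto (fun k : ℕ => ⨍ y in (at' x (k : ℤ)).toSet, f y) atTop (𝓝 (f x)) := by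
    rw [tendsto_iff_edist_tendsto_0]
    refine tendsto_of_tendsto_of_tendsto_of_le_of_le tendsto_const_nhds hx (fun _ => zero_le)
      fun k => ?_
    simp only [edist_eq_enorm_sub]
    refine enorm_setAverage_sub_le (volume_toSet_pos _) (volume_toSet_ne_top _) ?_ _
    exact (hf.integrableOn_isCompact (Metric.isCompact_of_isClosed_isBounded isClosed_closure
        (isBounded_toSet _).closure)).mono_set subset_closure
  have h := edist_le_tsum_of_edist_le_of_tendsto _ (fun k => edist_at'_succ_le
    (a := fun Q => ⨍ y in Q.toSet, f y) (o := osc univ volume ∞ f)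
    (fun Q Q' _ hQ => enorm_sub_le_osc (by simp) hQ (subset_univ _)) x k) hlim k
  rwa [edist_comm, edist_eq_enorm_sub] at h

/-- The error in approximating the extension of `f` by `f` itself at heights at most `2^{5-k}`; for
small `k` all heights are admitted. -/
noncomputable def extError (f : E d → ℂ) (k : ℕ) (x : E d) : ℝ≥0∞ :=
  tail (osc univ volume ∞ f) (k - 4) x + if k < 4 then ‖f x‖ₑ else 0

lemma aemeasurable_extError {f : E d → ℂ} (hf : AEStronglyMeasurable f) (k : ℕ) :
    AEMeasurable (extError f k) := by
  refine (measurable_tail _ _).aemeasurable.add ?_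
  split_ifs
  · exact hf.enorm
  · exact aemeasurable_const

lemma osc_le_extError (f : E d → ℂ) (k : ℕ) (x : E d) :
    osc univ volume ∞ f (at' x (k : ℤ)) ≤ extError f k x :=
  ((le_tail _ k x).trans (tail_antitone _ x (Nat.sub_le k 4))).trans le_self_add

/-- The points below which `f` is the limit of its averages, with control by oscillations. -/
def Good (f : E d → ℂ) (x : E d) : Prop :=
  ∀ k : ℕ, ‖f x - ⨍ y in (at' x (k : ℤ)).toSet, f y‖ₑ ≤ tail (osc univ volume ∞ f) k x

lemma Good.enorm_ext_sub_le_tail {f : E d → ℂ} (hψ : IsWhitneyBumps d ψ) {x : E (d + 1)}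
    (hx : Good f (base x)) {j : ℕ} (hj : hgt x ∈ strip j) :
    ‖ext ψ f x - f (base x)‖ₑ ≤ 2 * tail (osc univ volume ∞ f) j (base x) := by
  refine enorm_ext_sub_le hψ hj f _ fun Q hQ => ?_
  have e : (⨍ y in Q.toSet, f y) - f (base x) = -((⨍ y in (at' (base x) (j : ℤ)).toSet, f y) -
    (⨍ y in Q.toSet, f y)) - (f (base x) - ⨍ y in (at' (base x) (j : ℤ)).toSet, f y) := by ring
  rw [e, two_mul]
  refine enorm_sub_le.trans (add_le_add ?_ (hx j))
  rw [enorm_neg]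
  exact (enorm_sub_le_osc (Ω := univ) (by simp) hQ (subset_univ _)).trans (le_tail _ _ _)

lemma Good.enorm_average_le {f : E d → ℂ} {x : E d} (hx : Good f x) {Q : DyadicCube d}
    (hQ : (at' x ((0 : ℕ) : ℤ)).Neighbor Q) : ‖⨍ y in Q.toSet, f y‖ₑ ≤ 2 * extError f 0 x := by
  have e : (⨍ y in Q.toSet, f y) = f x - (f x - ⨍ y in (at' x ((0 : ℕ) : ℤ)).toSet, f y) -
    ((⨍ y in (at' x ((0 : ℕ) : ℤ)).toSet, f y) - (⨍ y in Q.toSet, f y)) := by ring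
  rw [e]
  calc _ ≤ ‖f x‖ₑ + tail (osc univ volume ∞ f) 0 x + osc univ volume ∞ f (at' x ((0 : ℕ) : ℤ)) :=
        enorm_sub_le.trans (add_le_add (enorm_sub_le.trans (add_le_add le_rfl (hx 0)))
          (enorm_sub_le_osc (Ω := univ) (by simp) hQ (subset_univ _)))
    _ ≤ extError f 0 x + extError f 0 x := by
        refine add_le_add (le_of_eq ?_) (osc_le_extError f 0 x)
        simp [extError, add_comm]
    _ = _ := by ring

lemma Good.enorm_ext_sub_le_extError {f : E d → ℂ} (hψ : IsWhitneyBumps d ψ) {x : E (d + 1)}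
    (hx : Good f (base x)) (hxH : 0 < hgt x) {k : ℕ}
    (hk : k < 4 ∨ hgt x ≤ 2 * (2 : ℝ) ^ (-((k - 4 : ℕ) : ℤ))) :
    ‖ext ψ f x - f (base x)‖ₑ ≤ (2 * (3 * 4 ^ d : ℕ) + 2) * extError f k (base x) := by
  by_cases hm : hgt x ≤ 2 * (2 : ℝ) ^ (-((k - 4 : ℕ) : ℤ))
  · obtain ⟨j, hkj, hj⟩ := exists_mem_strip hxH hm
    refine (hx.enorm_ext_sub_le_tail hψ hj).trans ?_
    gcongr
    · exact le_add_self
    · exact (tail_antitone _ _ hkj).trans le_self_add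
  · have hk4 : k < 4 := hk.resolve_right hm
    have h0 : k - 4 = 0 := by omega
    have he : extError f k = extError f 0 := by
      funext y; simp [extError, hk4, h0]
    rw [h0] at hm
    norm_num at hm
    have hA : Above x 0 := ⟨by norm_num; linarith, Or.inr rfl⟩
    have h1 := enorm_ext_le hψ hA f (fun Q hQ => hx.enorm_average_le hQ)
    rw [he]
    calc _ ≤ (3 * 4 ^ d : ℕ) * (2 * extError f 0 (base x)) + extError f 0 (base x) := by
          refine enorm_sub_le.trans (add_le_add h1 ?_)
          simp [extError]
      _ ≤ (3 * 4 ^ d : ℕ) * (2 * extError f 0 (base x)) + 2 * extError f 0 (base x) := by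
          gcongr
          exact le_mul_of_one_le_left (by simp) (by norm_num)
      _ = _ := by ring

lemma Good.enorm_ext_le {f : E d → ℂ} (hψ : IsWhitneyBumps d ψ) {x : E (d + 1)}
    (hx : Good f (base x)) (hxH : 0 < hgt x) :
    ‖ext ψ f x‖ₑ ≤ (2 * (3 * 4 ^ d : ℕ) + 3) * extError f 0 (base x) := by
  have h := hx.enorm_ext_sub_le_extError hψ hxH (k := 0) (Or.inl (by norm_num))
  have e : ext ψ f x = (ext ψ f x - f (base x)) + f (base x) := by ring
  rw [e]
  calc _ ≤ (2 * (3 * 4 ^ d : ℕ) + 2) * extError f 0 (base x) + extError f 0 (base x) := by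
        refine (enorm_add_le _ _).trans (add_le_add h ?_)
        simp [extError]
    _ = _ := by ring

lemma integrableOn_base (hα : -1 < α) {f : E d → ℂ} (hf : LocallyIntegrable f)
    {P : DyadicCube (d + 1)} (hP : P.toSet ⊆ upperHalf d) :
    IntegrableOn (fun y => f (base y)) P.toSet (muAlpha d α) := by
  have hq : Measure.QuasiMeasurePreserving (base : E (d + 1) → E d) (muAlpha d α) volume :=
    Measure.quasiMeasurePreserving_fst.comp (measurePreserving_split α).quasiMeasurePreserving
  have hfm : AEStronglyMeasurable f := hf.aestronglyMeasurable
  refine ⟨(hfm.comp_quasiMeasurePreserving hq).restrict, ?_⟩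
  rw [hasFiniteIntegral_iff_enorm, toSet_eq_box,
    setLIntegral_base (measurableSet_toSet _) (measurableSet_vert P) hfm.enorm]
  have h1 : IntegrableOn f P.base.toSet := (hf.integrableOn_isCompact
    (Metric.isCompact_of_isClosed_isBounded isClosed_closure
      (isBounded_toSet _).closure)).mono_set subset_closure
  exact ENNReal.mul_lt_top h1.2 (nu_vert_ne_top hα hP).lt_top

/-- At scales at least comparable to the height, the oscillation of the extension is controlled by
that of `f` and by the error between the extension and `f`. -/
lemma osc_ext_le_of_le (hψ : IsWhitneyBumps d ψ) (hα : -1 < α) {f : E d → ℂ}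
    (hf : LocallyIntegrable f) (hgood : ∀ᵐ x, Good f x)
    (hint : ∀ P : DyadicCube (d + 1), P.toSet ⊆ upperHalf d →
      IntegrableOn (ext ψ f) P.toSet (muAlpha d α))
    {x : E (d + 1)} {i k : ℕ} (hx : Above x i) (hk : k ≤ i + 3) :
    osc (upperHalf d) (muAlpha d α) ∞ (ext ψ f) (at' x (k : ℤ)) ≤
      osc univ volume ∞ f (at' (base x) (k : ℤ)) +
        2 * ((2 * (3 * 4 ^ d : ℕ) + 2) * nbrSup (extError f k) (at' (base x) (k : ℤ))) := by
  have hxH : x ∈ upperHalf d := lt_trans (by positivity) hx.1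
  set P := at' x (k : ℤ) with hPdef
  set K : ℝ≥0∞ := 2 * (3 * 4 ^ d : ℕ) + 2
  have hfm : AEStronglyMeasurable f := hf.aestronglyMeasurable
  have key : ∀ P', P.Neighbor P' → P'.toSet ⊆ upperHalf d →
      ‖(⨍ y in P'.toSet, ext ψ f y ∂(muAlpha d α)) - ⨍ y in P'.base.toSet, f y‖ₑ ≤
        K * nbrSup (extError f k) (at' (base x) (k : ℤ)) := by
    intro P' hP' hH
    have h0 := muAlpha_toSet_ne_zero (α := α) hH
    have ht := muAlpha_toSet_ne_top hα hH
    rw [← average_base hα hH hfm, ← setAverage_sub (hint P' hH) (integrableOn_base hα hf hH)]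
    refine (enorm_setAverage_le h0 ht _).trans ?_
    calc _ ≤ (∫⁻ y in P'.toSet, K * extError f k (base y) ∂(muAlpha d α)) / muAlpha d α P'.toSet := by
          refine ENNReal.div_le_div_right (lintegral_mono_ae ?_) _
          filter_upwards [ae_restrict_of_ae (ae_muAlpha_base hgood),
            ae_restrict_mem (measurableSet_toSet P')] with y hy hyP
          refine hy.enorm_ext_sub_le_extError hψ (hH hyP) ?_
          by_cases hk4 : k < 4
          · exact Or.inl hk4
          · right
            have hi : hgt x ≤ 2 * (2 : ℝ) ^ (-(i : ℤ)) := hx.2.resolve_right (by omega)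
            have h1 := abs_le.1 (Neighbor.abs_sub_le hP' (mem_at' x _) hyP (Fin.last d))
            have h2 : P.len = (2 : ℝ) ^ (-(k : ℤ)) := rfl
            have h3 : (2 : ℝ) ^ (-((k - 4 : ℕ) : ℤ)) = 16 * (2 : ℝ) ^ (-(k : ℤ)) := by
              rw [show (16 : ℝ) = 2 ^ (4 : ℤ) by norm_num, ← zpow_add₀ (by norm_num)]
              congr 1; omega
            have h4 : (2 : ℝ) ^ (-(i : ℤ)) ≤ 8 * (2 : ℝ) ^ (-(k : ℤ)) := by
              rw [show (8 : ℝ) = 2 ^ (3 : ℤ) by norm_num, ← zpow_add₀ (by norm_num)]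
              exact zpow_le_zpow_right₀ (by norm_num) (by omega)
            have h5 : (0 : ℝ) < (2 : ℝ) ^ (-(k : ℤ)) := by positivity
            have h6 : hgt y = y (Fin.last d) := rfl
            have h7 : hgt x = x (Fin.last d) := rfl
            rw [h3]
            linarith [h1.2]
      _ = K * ((∫⁻ x in P'.base.toSet, extError f k x) / volume P'.base.toSet) := by
          have hm := aemeasurable_extError hfm k
          have hK : K ≠ ∞ := by simp only [K]; finiteness
          rw [lintegral_const_mul' _ _ hK, mul_div_assoc, laverage_base hα hH hm]
      _ ≤ _ := by
          gcongr
          exact le_nbrSup _ hP'.base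
  have hPH : P.toSet ⊆ upperHalf d := at'_subset_upperHalf hxH _
  refine osc_top_le fun P' hP' hH => ?_
  have e : (⨍ y in P.toSet, ext ψ f y ∂(muAlpha d α)) - (⨍ y in P'.toSet, ext ψ f y ∂(muAlpha d α)) =
    ((⨍ y in P.base.toSet, f y) - (⨍ y in P'.base.toSet, f y)) +
    ((⨍ y in P.toSet, ext ψ f y ∂(muAlpha d α)) - ⨍ y in P.base.toSet, f y) -
    ((⨍ y in P'.toSet, ext ψ f y ∂(muAlpha d α)) - ⨍ y in P'.base.toSet, f y) := by ring
  rw [e, two_mul, ← add_assoc]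
  exact enorm_sub_le.trans (add_le_add ((enorm_add_le _ _).trans (add_le_add
    (enorm_sub_le_osc (Ω := univ) (by simp) hP'.base (subset_univ _))
    (key P (neighbor_self P) hPH))) (key P' hP' hH))

/-- At scales below the height, the extension is smooth and oscillates little. For `k ≥ i + 4` the
neighbours of the cube at scale `2^{-k}` stay within `3/16 · 2^{-i}` of `x` in each coordinate, where
only the bumps of the neighbours of the boundary cube below `x` contribute. -/
lemma osc_ext_le_of_ge (hψ : IsWhitneyBumps d ψ) (hα : -1 < α) : ∃ C : ℝ≥0, ∀ {f : E d → ℂ}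
    (_ : ∀ P : DyadicCube (d + 1), P.toSet ⊆ upperHalf d →
      IntegrableOn (ext ψ f) P.toSet (muAlpha d α))
    {x : E (d + 1)} (_ : Good f (base x)) {i k : ℕ} (_ : Above x i) (_ : i + 4 ≤ k),
    osc (upperHalf d) (muAlpha d α) ∞ (ext ψ f) (at' x (k : ℤ)) ≤
      C * ((2 : ℝ≥0∞)⁻¹ ^ (k - i) * extError f i (base x)) := by
  obtain ⟨C, hC⟩ := enorm_ext_sub_ext_le hψ
  refine ⟨C * (Real.toNNReal ((d + 1 : ℕ) * 3) * 2), fun {f} hint {x} hg {i k} hx hk => ?_⟩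
  have hxH : x ∈ upperHalf d := lt_trans (by positivity) hx.1
  set P := at' x (k : ℤ) with hPdef
  have hPlen : P.len = (2 : ℝ) ^ (-(k : ℤ)) := rfl
  have hPH : P.toSet ⊆ upperHalf d := at'_subset_upperHalf hxH _
  have hki : (2 : ℝ) ^ (-(k : ℤ)) ≤ 1 / 16 * (2 : ℝ) ^ (-(i : ℤ)) := by
    rw [show (1 / 16 : ℝ) = 2 ^ (-4 : ℤ) by norm_num, ← zpow_add₀ (by norm_num)]
    exact zpow_le_zpow_right₀ (by norm_num) (by omega)
  refine osc_top_le fun P' hP' hH => ?_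
  refine enorm_setAverage_sub_setAverage_le (measurableSet_toSet _) (muAlpha_toSet_ne_zero hPH)
    (muAlpha_toSet_ne_top hα hPH) (measurableSet_toSet _) (muAlpha_toSet_ne_zero hH)
    (muAlpha_toSet_ne_top hα hH) (hint P hPH) (hint P' hH) fun y hy z hz => ?_
  have hyx : ∀ l, |y l - x l| ≤ 3 / 16 * (2 : ℝ) ^ (-(i : ℤ)) := fun l => by
    have := abs_sub_le_of_mem hy (mem_at' x (k : ℤ)) l
    have h0 : (0 : ℝ) < (2 : ℝ) ^ (-(i : ℤ)) := by positivity
    linarith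
  have hzx : ∀ l, |z l - x l| ≤ 3 / 16 * (2 : ℝ) ^ (-(i : ℤ)) := fun l => by
    have := Neighbor.abs_sub_le hP' (mem_at' x (k : ℤ)) hz l
    linarith
  have hyz : dist y z ≤ (d + 1 : ℕ) * (3 * (2 : ℝ) ^ (-(k : ℤ))) :=
    dist_le_of_coord (by positivity) fun l => by
      rw [abs_sub_comm]
      exact Neighbor.abs_sub_le hP' hy hz l
  -- For `i = 0` heights above `2` occur, where the bumps need not sum to `1`; there `c = 0`.
  have hmain : ∃ c : ℂ, (c = 0 ∨ ∑ Q ∈ smallNbrs (at' (base x) (i : ℤ)), ψ Q y =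
      ∑ Q ∈ smallNbrs (at' (base x) (i : ℤ)), ψ Q z) ∧
      ∀ Q, (at' (base x) (i : ℤ)).Neighbor Q →
        ‖(⨍ y in Q.toSet, f y) - c‖ₑ ≤ 2 * extError f i (base x) := by
    rcases Nat.eq_zero_or_pos i with rfl | hi
    · exact ⟨0, Or.inl rfl, fun Q hQ => by rw [sub_zero]; exact hg.enorm_average_le hQ⟩
    · refine ⟨⨍ y in (at' (base x) (i : ℤ)).toSet, f y, Or.inr ?_, fun Q hQ => ?_⟩
      · have h1 : (2 : ℝ) ^ (-(i : ℤ)) ≤ 1 / 2 := by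
          rw [show (1 / 2 : ℝ) = 2 ^ (-1 : ℤ) by norm_num]
          exact zpow_le_zpow_right₀ (by norm_num) (by omega)
        have h2 : hgt x ≤ 2 * (2 : ℝ) ^ (-(i : ℤ)) := hx.2.resolve_right (by omega)
        have hle : ∀ w : E (d + 1), (∀ l, |w l - x l| ≤ 3 / 16 * (2 : ℝ) ^ (-(i : ℤ))) →
            hgt w ≤ 2 := fun w hw => by
          have h3 := (abs_le.1 (hw (Fin.last d))).2
          have h6 : hgt w = w (Fin.last d) := rfl
          have h7 : hgt x = x (Fin.last d) := rfl
          linarith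
        rw [hx.sum_eq_one hψ hyx (hPH hy) (hle y hyx), hx.sum_eq_one hψ hzx (hH hz) (hle z hzx)]
      · rw [enorm_sub_rev]
        refine (enorm_sub_le_osc (Ω := univ) (by simp) hQ (subset_univ _)).trans
          ((osc_le_extError f i _).trans ?_)
        exact le_mul_of_one_le_left (by simp) (by norm_num)
  obtain ⟨c, hc, hB⟩ := hmain
  refine (hC hx hyx hzx f c hc hB).trans ?_
  have e1 : ENNReal.ofReal ((2 : ℝ) ^ (i : ℤ) * dist y z) ≤
      Real.toNNReal ((d + 1 : ℕ) * 3) * (2 : ℝ≥0∞)⁻¹ ^ (k - i) := by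
    have e2 : (2 : ℝ≥0∞)⁻¹ ^ (k - i) = ENNReal.ofReal ((2 : ℝ) ^ (i : ℤ) * (2 : ℝ) ^ (-(k : ℤ))) := by
      rw [← zpow_add₀ (by norm_num), show (i : ℤ) + -(k : ℤ) = -((k - i : ℕ) : ℤ) by omega,
        zpow_neg, zpow_natCast, ← inv_pow, ENNReal.ofReal_pow (by norm_num),
        ENNReal.ofReal_inv_of_pos (by norm_num)]
      norm_num
    rw [e2]
    change _ ≤ ENNReal.ofReal _ * _
    rw [← ENNReal.ofReal_mul (by positivity)]
    refine ENNReal.ofReal_le_ofReal ?_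
    have h0 : (0 : ℝ) < 2 ^ (i : ℤ) := by positivity
    nlinarith
  calc _ ≤ C * (Real.toNNReal ((d + 1 : ℕ) * 3) * (2 : ℝ≥0∞)⁻¹ ^ (k - i) *
        (2 * extError f i (base x))) := by gcongr
    _ = _ := by push_cast; ring

lemma osc_ext_eq_zero (hψ : IsWhitneyBumps d ψ) {f : E d → ℂ} {x : E (d + 1)} (hx : 8 < hgt x)
    (k : ℕ) :
    osc (upperHalf d) (muAlpha d α) ∞ (ext ψ f) (at' x (k : ℤ)) = 0 := by
  have hl : (at' x (k : ℤ)).len ≤ 1 := zpow_le_one_of_nonpos₀ (by norm_num) (by simp)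
  have h0 : ∀ P', (at' x (k : ℤ)).Neighbor P' → ⨍ y in P'.toSet, ext ψ f y ∂(muAlpha d α) = 0 := by
    intro P' hP'
    rw [setAverage_eq, setIntegral_eq_zero_of_forall_eq_zero, smul_zero]
    intro y hy
    refine ext_eq_zero_of_le hψ f ?_
    have h1 := (abs_le.1 (Neighbor.abs_sub_le hP' (mem_at' x _) hy (Fin.last d))).1
    have h6 : hgt y = y (Fin.last d) := rfl
    have h7 : hgt x = x (Fin.last d) := rfl
    linarith
  refine le_antisymm (osc_top_le fun P' hP' _ => ?_) zero_le
  rw [h0 _ (neighbor_self _), h0 _ hP']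
  simp

end ExtOsc

/-! ### Summation of the oscillations of the extension -/

/-- If the terms at scales `k ≤ i + 3` are bounded by `R k`, and those at finer scales by `R i` with
geometric decay, then the `ℓ^q`-quasinorm of the weighted terms is bounded by an `ℓ^p`-sum over the
coarse scales, at the price of a slightly growing weight. This is where the exponent `q` disappears. -/
lemma lqNorm_rpow_le_of_decay {q : ℝ≥0∞} (hq : 0 < q) {s ε p : ℝ} (hp : 0 < p) (hε : 0 < ε)
    (hεs : ε ≤ 1 - s) : ∃ C : ℝ≥0, ∀ (i : ℕ) (o R : ℕ → ℝ≥0∞), (∀ k, k ≤ i + 3 → o k ≤ R k) →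
    (∀ k, i + 4 ≤ k → o k ≤ (2 : ℝ≥0∞)⁻¹ ^ (k - i) * R i) →
    lqNorm q (fun k : ℕ => (2 : ℝ≥0∞) ^ ((k : ℝ) * s) * o k) ^ p ≤
      C * ∑' k : ℕ, if k ≤ i + 3 then
        ((2 : ℝ≥0∞) ^ (ε * p)) ^ (i + 3 - k) * (((2 : ℝ≥0∞) ^ (s * p)) ^ k * R k ^ p) else 0 := by
  set r : ℝ≥0∞ := 2 ^ (-ε) with hr
  have hr1 : r < 1 := ENNReal.rpow_lt_one_of_one_lt_of_neg (by norm_num) (by linarith)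
  have hr0 : r ≠ 0 := (ENNReal.rpow_pos (by norm_num) (by norm_num)).ne'
  have hrt : r ≠ ∞ := (hr1.trans ENNReal.one_lt_top).ne
  obtain ⟨C, hC⟩ := lqNorm_geom_le hq hr1
  have hCt : (C * r⁻¹ ^ 3 : ℝ≥0∞) ^ p ≠ ∞ := by
    have : r⁻¹ ≠ ∞ := ENNReal.inv_ne_top.2 hr0
    finiteness
  refine ⟨((C * r⁻¹ ^ 3 : ℝ≥0∞) ^ p).toNNReal, fun i o R h1 h2 => ?_⟩
  rw [ENNReal.coe_toNNReal hCt]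
  set S := ∑' k : ℕ, if k ≤ i + 3 then
        ((2 : ℝ≥0∞) ^ (ε * p)) ^ (i + 3 - k) * (((2 : ℝ≥0∞) ^ (s * p)) ^ k * R k ^ p) else 0
  -- Each single term of the sum.
  have hR : ∀ k, k ≤ i + 3 → (2 : ℝ≥0∞) ^ ((k : ℝ) * s) * R k ≤ r ^ (i + 3 - k) * S ^ (1 / p) := by
    intro k hk
    have h := ENNReal.le_tsum (f := fun k : ℕ => if k ≤ i + 3 then
        ((2 : ℝ≥0∞) ^ (ε * p)) ^ (i + 3 - k) * (((2 : ℝ≥0∞) ^ (s * p)) ^ k * R k ^ p) else 0) k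
    simp only [if_pos hk] at h
    have e : ((2 : ℝ≥0∞) ^ (ε * p)) ^ (i + 3 - k) * (((2 : ℝ≥0∞) ^ (s * p)) ^ k * R k ^ p) =
        (r⁻¹ ^ (i + 3 - k) * ((2 : ℝ≥0∞) ^ ((k : ℝ) * s) * R k)) ^ p := by
      rw [ENNReal.mul_rpow_of_nonneg _ _ hp.le, ENNReal.mul_rpow_of_nonneg _ _ hp.le, hr,
        ENNReal.rpow_neg, inv_inv]
      simp only [← ENNReal.rpow_natCast, ← ENNReal.rpow_mul]
      congr 2
      · ring_nf
      · ring_nf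
    rw [e, ← ENNReal.le_rpow_inv_iff hp] at h
    calc (2 : ℝ≥0∞) ^ ((k : ℝ) * s) * R k
        = r ^ (i + 3 - k) * (r⁻¹ ^ (i + 3 - k) * ((2 : ℝ≥0∞) ^ ((k : ℝ) * s) * R k)) := by
          rw [← mul_assoc, ← mul_pow, ENNReal.mul_inv_cancel hr0 hrt, one_pow, one_mul]
      _ ≤ _ := by
          rw [one_div]
          gcongr
  have hshift : ∀ m : ℕ, r ^ m = r⁻¹ ^ 3 * r ^ (m + 3) := fun m => by
    rw [add_comm m, pow_add, ← mul_assoc, ← mul_pow, ENNReal.inv_mul_cancel hr0 hrt, one_pow, one_mul]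
  have hterm : ∀ k : ℕ, (2 : ℝ≥0∞) ^ ((k : ℝ) * s) * o k ≤
      r ^ ((k - i) + (i - k)) * (r⁻¹ ^ 3 * S ^ (1 / p)) := by
    intro k
    rcases le_or_gt k (i + 3) with hk | hk
    · calc _ ≤ (2 : ℝ≥0∞) ^ ((k : ℝ) * s) * R k := by gcongr; exact h1 k hk
        _ ≤ r⁻¹ ^ 3 * r ^ (i + 3 - k + 3) * S ^ (1 / p) := by rw [← hshift]; exact hR k hk
        _ ≤ r⁻¹ ^ 3 * r ^ ((k - i) + (i - k)) * S ^ (1 / p) := by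
            refine mul_le_mul_left (mul_le_mul_right ?_ _) _
            exact pow_le_pow_right_of_le_one' hr1.le (by omega)
        _ = _ := by ring
    · have e : (2 : ℝ≥0∞) ^ ((k : ℝ) * s) * (2 : ℝ≥0∞)⁻¹ ^ (k - i) ≤
          r ^ (k - i) * (2 : ℝ≥0∞) ^ ((i : ℝ) * s) := by
        rw [hr, ← ENNReal.rpow_neg_one, ← ENNReal.rpow_natCast, ← ENNReal.rpow_natCast,
          ← ENNReal.rpow_mul, ← ENNReal.rpow_mul, ← ENNReal.rpow_add _ _ (by norm_num) (by norm_num),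
          ← ENNReal.rpow_add _ _ (by norm_num) (by norm_num)]
        refine ENNReal.rpow_le_rpow_of_exponent_le (by norm_num) ?_
        have hik : i ≤ k := by omega
        rw [Nat.cast_sub hik]
        have hik' : (0 : ℝ) ≤ (k : ℝ) - i := by
          have : (i : ℝ) ≤ k := by exact_mod_cast hik
          linarith
        nlinarith
      calc _ ≤ (2 : ℝ≥0∞) ^ ((k : ℝ) * s) * ((2 : ℝ≥0∞)⁻¹ ^ (k - i) * R i) := by
            gcongr; exact h2 k (by omega)
        _ = ((2 : ℝ≥0∞) ^ ((k : ℝ) * s) * (2 : ℝ≥0∞)⁻¹ ^ (k - i)) * R i := by ring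
        _ ≤ (r ^ (k - i) * (2 : ℝ≥0∞) ^ ((i : ℝ) * s)) * R i := by gcongr
        _ = r ^ (k - i) * ((2 : ℝ≥0∞) ^ ((i : ℝ) * s) * R i) := by ring
        _ ≤ r ^ (k - i) * (r ^ 0 * S ^ (1 / p)) := by
            refine mul_le_mul_right ((hR i (by omega)).trans (mul_le_mul_left ?_ _)) _
            exact pow_le_pow_right_of_le_one' hr1.le (by omega)
        _ ≤ r ^ ((k - i) + (i - k)) * (r⁻¹ ^ 3 * S ^ (1 / p)) := by
            rw [show i - k = 0 by omega, add_zero]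
            refine mul_le_mul_right (mul_le_mul_left ?_ _) _
            rw [hshift]
            exact mul_le_of_le_one_right (by simp) (pow_le_one₀ (by simp) hr1.le)
  calc _ ≤ (lqNorm q (fun k : ℕ => r ^ ((k - i) + (i - k))) * (r⁻¹ ^ 3 * S ^ (1 / p))) ^ p := by
        gcongr; exact lqNorm_le_mul hq hterm
    _ ≤ (C * (r⁻¹ ^ 3 * S ^ (1 / p))) ^ p := by gcongr; exact hC i
    _ = _ := by
        rw [← mul_assoc, ENNReal.mul_rpow_of_nonneg _ _ hp.le, ← ENNReal.rpow_mul,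
          one_div_mul_cancel hp.ne', ENNReal.rpow_one]

/-- The double sum over the scales `k` and the heights `i`, obtained by
integrating over the layers of heights comparable to `2^{-i}`. -/
lemma tsum_layers_le {V τ X : ℝ≥0∞} (hV0 : V ≠ 0) (hV : V ≠ ∞) (hVτ : V * τ < 1) :
    ∃ C : ℝ≥0, ∀ x : ℕ → ℝ≥0∞, ∑' i : ℕ, V ^ i * ∑' k : ℕ,
      (if k ≤ i + 3 then τ ^ (i + 3 - k) * (X ^ k * x k) else 0) ≤ C * ∑' k, (V * X) ^ k * x k := by
  have hC : V⁻¹ ^ 3 * ∑' m : ℕ, (V * τ) ^ m ≠ ∞ := by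
    have := tsum_pow_ne_top hVτ
    have : V⁻¹ ≠ ∞ := ENNReal.inv_ne_top.2 hV0
    finiteness
  refine ⟨(V⁻¹ ^ 3 * ∑' m : ℕ, (V * τ) ^ m).toNNReal, fun x => ?_⟩
  rw [ENNReal.coe_toNNReal hC]
  have e : ∀ i : ℕ, V ^ i = V⁻¹ ^ 3 * V ^ (i + 3) := fun i => by
    rw [add_comm i, pow_add, ← mul_assoc, ← mul_pow, ENNReal.inv_mul_cancel hV0 hV, one_pow, one_mul]
  calc _ = V⁻¹ ^ 3 * ∑' i : ℕ, (V ^ (i + 3) * ∑' k : ℕ,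
          (if k ≤ i + 3 then τ ^ (i + 3 - k) * (X ^ k * x k) else 0)) := by
        rw [← ENNReal.tsum_mul_left]
        exact tsum_congr fun i => by rw [← mul_assoc, ← e]
    _ ≤ V⁻¹ ^ 3 * ∑' j : ℕ, (V ^ j * ∑' k : ℕ,
          (if k ≤ j then τ ^ (j - k) * (X ^ k * x k) else 0)) := by
        refine mul_le_mul_right ?_ _
        exact tsum_add_le (fun j => V ^ j * ∑' k : ℕ,
          (if k ≤ j then τ ^ (j - k) * (X ^ k * x k) else 0)) 3
    _ = V⁻¹ ^ 3 * ∑' j : ℕ, ∑' k : ℕ,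
          (if k ≤ j then (V * τ) ^ (j - k) * ((V * X) ^ k * x k) else 0) := by
        congr 1
        refine tsum_congr fun j => ?_
        rw [← ENNReal.tsum_mul_left]
        refine tsum_congr fun k => ?_
        split_ifs with h
        · obtain ⟨m, rfl⟩ := Nat.exists_eq_add_of_le h
          rw [Nat.add_sub_cancel_left]
          ring
        · simp
    _ = V⁻¹ ^ 3 * ∑' k : ℕ, ∑' m : ℕ, (V * τ) ^ m * ((V * X) ^ k * x k) := by
        rw [tsum_conv fun k m => (V * τ) ^ m * ((V * X) ^ k * x k)]
    _ = _ := by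
        simp_rw [ENNReal.tsum_mul_right]
        rw [ENNReal.tsum_mul_left, mul_assoc]

section ExtBound

variable {d : ℕ} {ψ : SmallCube d → E (d + 1) → ℝ} {α p : ℝ}

lemma tsum_extError_le (d : ℕ) (hp : 1 ≤ p) {W : ℝ≥0∞} (hW : 1 < W) (hW' : W ≠ ∞) :
    ∃ C : ℝ≥0, ∀ f : E d → ℂ,
      ∑' k : ℕ, W ^ k * ∫⁻ x, extError f k x ^ p ≤ C * ((∫⁻ x, ‖f x‖ₑ ^ p) +
        ∑' k : ℕ, W ^ k * ∫⁻ x, osc univ volume ∞ f (at' x (k : ℤ)) ^ p) := by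
  have hp0 : 0 < p := by linarith
  obtain ⟨C₁, h₁⟩ := tsum_tail_le hp hW hW'
  obtain ⟨C₂, h₂⟩ := tsum_shift_le hW' 4
  set A : ℝ≥0∞ := ∑ k ∈ Finset.range 4, W ^ k with hA
  set B : ℝ≥0∞ := 2 ^ p * (C₂ * C₁ + A) with hB
  have hBt : B ≠ ∞ := by
    have : A ≠ ∞ := ENNReal.sum_ne_top.2 fun k _ => by finiteness
    rw [hB]; finiteness
  refine ⟨B.toNNReal, fun f => ?_⟩
  rw [ENNReal.coe_toNNReal hBt]
  set N := ∫⁻ x, ‖f x‖ₑ ^ p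
  set S := ∑' k : ℕ, W ^ k * ∫⁻ x, osc univ volume ∞ f (at' x (k : ℤ)) ^ p
  set o := osc univ volume ∞ f with ho
  have hk : ∀ k : ℕ, ∫⁻ x, extError f k x ^ p ≤
      2 ^ p * ((∫⁻ x, tail o (k - 4) x ^ p) + if k < 4 then N else 0) := by
    intro k
    calc _ ≤ ∫⁻ x, 2 ^ p * (tail o (k - 4) x ^ p + (if k < 4 then ‖f x‖ₑ else 0) ^ p) :=
          lintegral_mono fun x => rpow_add_le hp _ _
      _ = _ := by
          rw [lintegral_const_mul' _ _ (by finiteness),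
            lintegral_add_left ((measurable_tail o _).pow_const p)]
          split_ifs
          · rfl
          · simp [hp0]
  calc _ ≤ ∑' k : ℕ, W ^ k * (2 ^ p * ((∫⁻ x, tail o (k - 4) x ^ p) + if k < 4 then N else 0)) := by
        gcongr with k; exact hk k
    _ = 2 ^ p * ((∑' k : ℕ, W ^ k * ∫⁻ x, tail o (k - 4) x ^ p) +
          ∑' k : ℕ, W ^ k * if k < 4 then N else 0) := by
        rw [← ENNReal.tsum_add, ← ENNReal.tsum_mul_left]
        exact tsum_congr fun k => by ring
    _ ≤ 2 ^ p * (C₂ * (C₁ * S) + A * N) := by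
        gcongr
        · refine (h₂ fun k => ∫⁻ x, tail o k x ^ p).trans ?_
          gcongr
          exact h₁ d o
        · rw [tsum_eq_sum (s := Finset.range 4) (fun k hk => by
            rw [if_neg (by simpa using hk), mul_zero]), hA, Finset.sum_mul]
          refine Finset.sum_le_sum fun k hk => ?_
          rw [if_pos (by simpa using hk)]
    _ ≤ 2 ^ p * ((C₂ * C₁ + A) * S + (C₂ * C₁ + A) * N) := by
        rw [← mul_assoc (C₂ : ℝ≥0∞)]
        gcongr
        · exact le_self_add
        · exact le_add_self
    _ = _ := by rw [hB]; ring

/-- The layers of heights comparable to `2^{-i}`; the layer `i = 0` extends up to the height above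
which all oscillations of an extension vanish. -/
def layer (i : ℕ) : Set ℝ := if i = 0 then Ioc 1 8 else strip i

lemma measurableSet_layer (i : ℕ) : MeasurableSet (layer i) := by
  unfold layer
  split_ifs
  exacts [measurableSet_Ioc, measurableSet_strip i]

lemma exists_mem_layer {t : ℝ} (h0 : 0 < t) (h8 : t ≤ 8) : ∃ i, t ∈ layer i := by
  rcases le_or_gt t 1 with h1 | h1
  · obtain ⟨j, hj, htj⟩ := exists_mem_strip h0 (m := 1) (by norm_num; exact h1)
    exact ⟨j, by rwa [layer, if_neg (by omega)]⟩
  · exact ⟨0, h1, h8⟩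

lemma Above.of_mem_layer {x : E (d + 1)} {i : ℕ} (h : hgt x ∈ layer i) : Above x i := by
  unfold layer at h
  split_ifs at h with hi
  · subst hi
    exact ⟨by simpa using h.1, Or.inr rfl⟩
  · exact .of_mem_strip h

lemma nu_layer_le (hα : -1 < α) : ∃ C : ℝ≥0, ∀ i : ℕ,
    nu α (layer i) ≤ C * ((2 : ℝ≥0∞) ^ (-(α + 1))) ^ i := by
  obtain ⟨C, hC⟩ := nu_strip_le hα
  refine ⟨C + 7, fun i => ?_⟩
  unfold layer
  split_ifs with hi
  · subst hi
    rw [nu_Ioc_of_one_le le_rfl, pow_zero, mul_one]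
    norm_num
  · refine (hC i).trans ?_
    gcongr
    simp

/-- The bound, in terms of `f`, for the oscillation at scale `2^{-k}` of the extension. -/
noncomputable def extBound (f : E d → ℂ) (k : ℕ) (x : E d) : ℝ≥0∞ :=
  extError f k x + nbrSup (extError f k) (at' x (k : ℤ))

lemma aemeasurable_extBound {f : E d → ℂ} (hf : AEStronglyMeasurable f) (k : ℕ) :
    AEMeasurable (extBound f k) :=
  (aemeasurable_extError hf k).add (measurable_at' (nbrSup (extError f k)) _).aemeasurable

lemma lintegral_extBound_le (d : ℕ) (hp : 1 ≤ p) : ∃ C : ℝ≥0, ∀ {f : E d → ℂ}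
    (_ : AEStronglyMeasurable f) (k : ℕ),
    ∫⁻ x, extBound f k x ^ p ≤ C * ∫⁻ x, extError f k x ^ p := by
  obtain ⟨C, hC⟩ := lintegral_nbrSup_le d hp
  refine ⟨(2 : ℝ≥0) ^ p * (1 + C), fun {f} hf k => ?_⟩
  calc _ ≤ ∫⁻ x, 2 ^ p * (extError f k x ^ p + nbrSup (extError f k) (at' x (k : ℤ)) ^ p) :=
        lintegral_mono fun x => rpow_add_le hp _ _
    _ = 2 ^ p * ((∫⁻ x, extError f k x ^ p) +
          ∫⁻ x, nbrSup (extError f k) (at' x (k : ℤ)) ^ p) := by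
        rw [lintegral_const_mul' _ _ (by finiteness),
          lintegral_add_left' ((aemeasurable_extError hf k).pow_const p)]
    _ ≤ 2 ^ p * ((∫⁻ x, extError f k x ^ p) + C * ∫⁻ x, extError f k x ^ p) := by
        gcongr
        exact hC k _ (aemeasurable_extError hf k)
    _ = _ := by
        rw [ENNReal.coe_mul, ENNReal.coe_rpow_of_nonneg _ (by linarith)]
        push_cast
        ring

/-- The `L^p`-part of the norm of the extension. -/
lemma lintegral_ext_le (hψ : IsWhitneyBumps d ψ) (hα : -1 < α) (hp : 0 < p) : ∃ C : ℝ≥0,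
    ∀ {f : E d → ℂ} (_ : AEStronglyMeasurable f) (_ : ∀ᵐ x, Good f x),
    ∫⁻ y, ‖ext ψ f y‖ₑ ^ p ∂(muAlpha d α) ≤ C * ∫⁻ x, extError f 0 x ^ p := by
  set K : ℝ≥0∞ := 2 * (3 * 4 ^ d : ℕ) + 3
  have hK : K ≠ ∞ := by simp only [K]; finiteness
  have hC : K ^ p * nu α (Ioc 0 3) ≠ ∞ :=
    ENNReal.mul_ne_top (by finiteness) (nu_Ioc_ne_top hα le_rfl)
  refine ⟨(K ^ p * nu α (Ioc 0 3)).toNNReal, fun {f} hf hg => ?_⟩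
  rw [ENNReal.coe_toNNReal hC]
  have hm : MeasurableSet (hgt ⁻¹' Ioc 0 3 : Set (E (d + 1))) := measurable_hgt measurableSet_Ioc
  calc _ ≤ ∫⁻ y, (hgt ⁻¹' Ioc 0 3).indicator (fun y => (K * extError f 0 (base y)) ^ p) y
          ∂(muAlpha d α) := by
        refine lintegral_mono_ae ?_
        filter_upwards [ae_muAlpha_base hg, ae_muAlpha_mem] with y hy hyH
        rcases le_or_gt (hgt y) 3 with h3 | h3
        · rw [indicator_of_mem (show y ∈ hgt ⁻¹' Ioc 0 3 from ⟨hyH, h3⟩)]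
          gcongr
          exact hy.enorm_ext_le hψ hyH
        · rw [ext_eq_zero_of_le hψ f (by linarith)]
          simp [hp]
    _ = K ^ p * ∫⁻ y in base ⁻¹' univ ∩ hgt ⁻¹' Ioc 0 3, extError f 0 (base y) ^ p
          ∂(muAlpha d α) := by
        rw [lintegral_indicator hm, preimage_univ, univ_inter]
        simp_rw [ENNReal.mul_rpow_of_nonneg _ _ hp.le]
        rw [lintegral_const_mul' _ _ (by finiteness)]
    _ = _ := by
        rw [setLIntegral_base MeasurableSet.univ measurableSet_Ioc
          (g := fun x => extError f 0 x ^ p) ((aemeasurable_extError hf 0).pow_const p),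
          Measure.restrict_univ]
        ring

end ExtBound

/-! ### Boundedness of the extension -/

section Extension

variable {d : ℕ} {ψ : SmallCube d → E (d + 1) → ℝ} {α s p : ℝ}

lemma ae_good {f : E d → ℂ} (hf : LocInt univ f) : ∀ᵐ x, Good f x :=
  ae_enorm_sub_le_tail (locallyIntegrable_of_locInt hf)

/-- All oscillations of an extension in terms of the boundary function. -/
lemma osc_ext_le (hψ : IsWhitneyBumps d ψ) (hα : -1 < α) {q : ℝ≥0∞} (hq : 0 < q) :
    ∃ C : ℝ≥0, ∀ {f : E d → ℂ} (_ : LocInt univ f)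
    (_ : ∀ P : DyadicCube (d + 1), P.toSet ⊆ upperHalf d →
      IntegrableOn (ext ψ f) P.toSet (muAlpha d α))
    {x : E (d + 1)} (_ : Good f (base x)) {i : ℕ} (_ : Above x i),
    (∀ k, k ≤ i + 3 → osc (upperHalf d) (muAlpha d α) q (ext ψ f) (at' x (k : ℤ)) ≤
      C * extBound f k (base x)) ∧
    ∀ k, i + 4 ≤ k → osc (upperHalf d) (muAlpha d α) q (ext ψ f) (at' x (k : ℤ)) ≤
      (2 : ℝ≥0∞)⁻¹ ^ (k - i) * (C * extBound f i (base x)) := by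
  obtain ⟨C₁, h₁⟩ := osc_le_osc_top (d + 1) hq
  obtain ⟨C₂, h₂⟩ := osc_ext_le_of_ge hψ hα
  set K : ℝ≥0 := 2 * (2 * (3 * 4 ^ d : ℕ) + 2) with hK
  refine ⟨C₁ * (C₂ + 1 + K), fun {f} hf hint {x} hg {i} hx => ⟨fun k hk => ?_, fun k hk => ?_⟩⟩
  · refine (h₁ _ _ _ _).trans ?_
    rw [ENNReal.coe_mul, mul_assoc]
    gcongr
    refine (osc_ext_le_of_le hψ hα (locallyIntegrable_of_locInt hf) (ae_good hf) hint hx hk).trans ?_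
    calc _ ≤ 1 * extError f k (base x) + K * nbrSup (extError f k) (at' (base x) (k : ℤ)) := by
          rw [one_mul]
          refine add_le_add (osc_le_extError f k _) (le_of_eq ?_)
          rw [hK]; push_cast; ring
      _ ≤ (C₂ + 1 + K : ℝ≥0) * extError f k (base x) +
            (C₂ + 1 + K : ℝ≥0) * nbrSup (extError f k) (at' (base x) (k : ℤ)) := by
          push_cast
          gcongr
          · exact le_add_self.trans le_self_add
          · exact le_add_self
      _ = _ := (mul_add _ _ _).symm
  · refine (h₁ _ _ _ _).trans ?_
    calc _ ≤ C₁ * (C₂ * ((2 : ℝ≥0∞)⁻¹ ^ (k - i) * extError f i (base x))) := by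
          gcongr
          exact h₂ hint hg hx hk
      _ ≤ C₁ * ((C₂ + 1 + K : ℝ≥0) * ((2 : ℝ≥0∞)⁻¹ ^ (k - i) * extBound f i (base x))) := by
          gcongr
          · exact (le_self_add : C₂ ≤ C₂ + 1).trans le_self_add
          · exact le_self_add
      _ = _ := by push_cast; ring

/-- The oscillation part of the norm of the extension. -/
lemma lintegral_osc_ext_le (hψ : IsWhitneyBumps d ψ) (hα : -1 < α) (hs1 : s < 1) (hp : 1 ≤ p)
    {σ : ℝ} (hσ : σ * p = s * p - (α + 1)) {q : ℝ≥0∞} (hq : 0 < q) :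
    ∃ C : ℝ≥0, ∀ {f : E d → ℂ} (_ : LocInt univ f)
    (_ : ∀ P : DyadicCube (d + 1), P.toSet ⊆ upperHalf d →
      IntegrableOn (ext ψ f) P.toSet (muAlpha d α)),
    ∫⁻ y, lqNorm q (fun k : ℕ => (2 : ℝ≥0∞) ^ ((k : ℝ) * s) *
      osc (upperHalf d) (muAlpha d α) q (ext ψ f) (at' y (k : ℤ))) ^ p ∂(muAlpha d α) ≤
      C * ∑' k : ℕ, ((2 : ℝ≥0∞) ^ (σ * p)) ^ k * ∫⁻ x, extError f k x ^ p := by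
  have hp0 : 0 < p := by linarith
  -- Any positive `ε` with `ε ≤ 1 - s` and `ε p < α + 1` would do.
  obtain ⟨ε, hε, hε1, hε2⟩ : ∃ ε : ℝ, 0 < ε ∧ ε ≤ 1 - s ∧ ε * p < α + 1 := by
    refine ⟨min (1 - s) ((α + 1) / (2 * p)), lt_min (by linarith) (div_pos (by linarith)
      (by linarith)), min_le_left _ _, ?_⟩
    calc _ ≤ (α + 1) / (2 * p) * p := by gcongr; exact min_le_right _ _
      _ = (α + 1) / 2 := by field_simp
      _ < α + 1 := by linarith
  obtain ⟨C₁, h₁⟩ := osc_ext_le hψ hα hq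
  obtain ⟨C₂, h₂⟩ := lqNorm_rpow_le_of_decay hq hp0 hε hε1
  obtain ⟨C₃, h₃⟩ := nu_layer_le hα
  set V : ℝ≥0∞ := 2 ^ (-(α + 1)) with hV
  set τ : ℝ≥0∞ := 2 ^ (ε * p) with hτ
  set X : ℝ≥0∞ := 2 ^ (s * p) with hX
  have hVτ : V * τ < 1 := by
    rw [hV, hτ, ← ENNReal.rpow_add _ _ (by norm_num) (by norm_num)]
    exact ENNReal.rpow_lt_one_of_one_lt_of_neg (by norm_num) (by linarith)
  have hVX : V * X = 2 ^ (σ * p) := by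
    rw [hV, hX, ← ENNReal.rpow_add _ _ (by norm_num) (by norm_num), hσ]
    congr 1; ring
  obtain ⟨C₄, h₄⟩ := tsum_layers_le (V := V) (X := X) (ENNReal.rpow_pos (by norm_num) (by norm_num)).ne'
    (by rw [hV]; finiteness) hVτ
  obtain ⟨C₅, h₅⟩ := lintegral_extBound_le d hp
  refine ⟨C₂ * C₃ * C₄ * (C₁ ^ p * C₅), fun {f} hf hint => ?_⟩
  have hfm : AEStronglyMeasurable f := (locallyIntegrable_of_locInt hf).aestronglyMeasurable
  set R : ℕ → E d → ℝ≥0∞ := fun k x => C₁ * extBound f k x with hR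
  have hRm : ∀ k, AEMeasurable (R k) := fun k => (aemeasurable_extBound hfm k).const_mul _
  have hRp : ∀ k, ∫⁻ x, R k x ^ p ≤ (C₁ ^ p * C₅ : ℝ≥0) * ∫⁻ x, extError f k x ^ p := fun k => by
    simp_rw [hR, ENNReal.mul_rpow_of_nonneg _ _ hp0.le]
    rw [lintegral_const_mul' _ _ (by finiteness), ENNReal.coe_mul,
      ENNReal.coe_rpow_of_nonneg _ hp0.le, mul_assoc]
    gcongr
    exact h₅ hfm k
  set T : ℕ → E d → ℝ≥0∞ := fun i x => ∑' k : ℕ, if k ≤ i + 3 then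
    τ ^ (i + 3 - k) * (X ^ k * R k x ^ p) else 0 with hT
  have hTk : ∀ i k, AEMeasurable fun x => if k ≤ i + 3 then
      τ ^ (i + 3 - k) * (X ^ k * R k x ^ p) else 0 := fun i k => by
    split_ifs
    · exact (((hRm k).pow_const p).const_mul _).const_mul _
    · exact aemeasurable_const
  have hTm : ∀ i, AEMeasurable (T i) := fun i => AEMeasurable.tsum (hTk i)
  have hTi : ∀ i, ∫⁻ x, T i x = ∑' k : ℕ, if k ≤ i + 3 then
      τ ^ (i + 3 - k) * (X ^ k * ∫⁻ x, R k x ^ p) else 0 := fun i => by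
    rw [hT, lintegral_tsum (hTk i)]
    refine tsum_congr fun k => ?_
    split_ifs
    · rw [lintegral_const_mul'' _ (((hRm k).pow_const p).const_mul _),
        lintegral_const_mul'' _ ((hRm k).pow_const p)]
    · simp
  set N : E (d + 1) → ℝ≥0∞ := fun y => lqNorm q (fun k : ℕ => (2 : ℝ≥0∞) ^ ((k : ℝ) * s) *
      osc (upperHalf d) (muAlpha d α) q (ext ψ f) (at' y (k : ℤ))) ^ p with hN
  obtain ⟨C₀, h₀⟩ := osc_le_osc_top (d + 1) hq
  have hN0 : ∀ y, 8 < hgt y → N y = 0 := fun y hy => by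
    have h : ∀ k : ℕ, osc (upperHalf d) (muAlpha d α) q (ext ψ f) (at' y (k : ℤ)) = 0 := fun k => by
      have := h₀ (upperHalf d) (muAlpha d α) (ext ψ f) (at' y (k : ℤ))
      rw [osc_ext_eq_zero hψ hy, mul_zero] at this
      exact le_antisymm this zero_le
    have h' := lqNorm_le_mul hq (a := fun k : ℕ => (2 : ℝ≥0∞) ^ ((k : ℝ) * s) *
      osc (upperHalf d) (muAlpha d α) q (ext ψ f) (at' y (k : ℤ))) (w := fun _ => 0) (M := 0)
      fun k => by rw [h k, mul_zero, mul_zero]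
    rw [mul_zero] at h'
    simp only [hN]
    rw [le_antisymm h' zero_le, ENNReal.zero_rpow_of_pos hp0]
  have hlm : ∀ i, MeasurableSet (hgt ⁻¹' layer i : Set (E (d + 1))) :=
    fun i => measurable_hgt (measurableSet_layer i)
  have hlayer : ∀ i, ∫⁻ y in hgt ⁻¹' layer i, N y ∂(muAlpha d α) ≤
      C₂ * C₃ * (V ^ i * ∫⁻ x, T i x) := fun i => by
    calc _ ≤ ∫⁻ y in hgt ⁻¹' layer i, C₂ * T i (base y) ∂(muAlpha d α) := by
          refine lintegral_mono_ae ?_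
          filter_upwards [ae_restrict_of_ae (ae_muAlpha_base (ae_good hf)),
            ae_restrict_mem (hlm i)] with y hy hyi
          obtain ⟨h1, h2⟩ := h₁ hf hint hy (Above.of_mem_layer hyi)
          exact h₂ i _ (fun k => R k (base y)) h1 h2
      _ = C₂ * ((∫⁻ x, T i x) * nu α (layer i)) := by
          have := setLIntegral_base (α := α) MeasurableSet.univ (measurableSet_layer i) (hTm i)
          rw [lintegral_const_mul' _ _ ENNReal.coe_ne_top, ← Measure.restrict_univ (μ := volume),
            ← this, preimage_univ, univ_inter]
      _ ≤ C₂ * ((∫⁻ x, T i x) * (C₃ * V ^ i)) := by gcongr; exact h₃ i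
      _ = _ := by ring
  calc ∫⁻ y, N y ∂(muAlpha d α) ≤ ∫⁻ y in ⋃ i, hgt ⁻¹' layer i, N y ∂(muAlpha d α) := by
        rw [← lintegral_indicator (MeasurableSet.iUnion hlm)]
        refine lintegral_mono_ae ?_
        filter_upwards [ae_muAlpha_mem] with y hyH
        rcases le_or_gt (hgt y) 8 with h8 | h8
        · obtain ⟨i, hi⟩ := exists_mem_layer hyH h8
          have hy : y ∈ ⋃ i, hgt ⁻¹' layer i := mem_iUnion.2 ⟨i, hi⟩
          rw [indicator_of_mem hy]
        · rw [hN0 y h8]; exact zero_le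
    _ ≤ ∑' i, ∫⁻ y in hgt ⁻¹' layer i, N y ∂(muAlpha d α) := lintegral_iUnion_le _ _
    _ ≤ ∑' i, C₂ * C₃ * (V ^ i * ∫⁻ x, T i x) := by gcongr with i; exact hlayer i
    _ ≤ C₂ * C₃ * (C₄ * ∑' k, (V * X) ^ k * ∫⁻ x, R k x ^ p) := by
        rw [ENNReal.tsum_mul_left]
        gcongr
        simp_rw [hTi]
        exact h₄ fun k => ∫⁻ x, R k x ^ p
    _ ≤ C₂ * C₃ * (C₄ * ∑' k : ℕ, (2 ^ (σ * p)) ^ k *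
          ((C₁ ^ p * C₅ : ℝ≥0) * ∫⁻ x, extError f k x ^ p)) := by
        rw [hVX]
        gcongr with k
        exact hRp k
    _ = _ := by
        have : ∀ k : ℕ, ((2 : ℝ≥0∞) ^ (σ * p)) ^ k *
          ((C₁ ^ p * C₅ : ℝ≥0) * ∫⁻ x, extError f k x ^ p) = (C₁ ^ p * C₅ : ℝ≥0) *
          (((2 : ℝ≥0∞) ^ (σ * p)) ^ k * ∫⁻ x, extError f k x ^ p) := fun k => by ring
        simp_rw [this]
        rw [ENNReal.tsum_mul_left]
        push_cast
        ring

/-- Local integrability with respect to Lebesgue measure. The relevant integrals are those of the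
unweighted measure, that is, of the case `α = 0`. -/
lemma locInt_ext (hψ : IsWhitneyBumps d ψ) (hp : 1 ≤ p) {f : E d → ℂ} (hf : LocInt univ f)
    (hE : ∫⁻ x, extError f 0 x ^ p ≠ ∞) : LocInt (upperHalf d) (ext ψ f) := by
  have hp0 : 0 < p := by linarith
  have hvol : muAlpha d 0 = volume.restrict (upperHalf d) := by
    simp [muAlpha]
  obtain ⟨C, hC⟩ := lintegral_ext_le hψ (α := 0) (by norm_num) hp0
  have hmem : MemLp (ext ψ f) (ENNReal.ofReal p) (muAlpha d 0) := by
    refine ⟨(measurable_ext hψ f).aestronglyMeasurable, ?_⟩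
    rw [eLpNorm_ofReal hp0, ENNReal.rpow_lt_top_iff_of_pos (by positivity)]
    refine lt_of_le_of_lt (hC (locallyIntegrable_of_locInt hf).aestronglyMeasurable (ae_good hf)) ?_
    finiteness
  intro A hA hAb
  have hAt : muAlpha d 0 A ≠ ∞ := by
    rw [hvol]
    exact ((Measure.restrict_apply_le _ _).trans_lt hAb.measure_lt_top).ne
  have h := integrableOn_of_memLp hp hmem hAt
  rwa [hvol, IntegrableOn, Measure.restrict_restrict_of_subset hA] at h

/-- The extension is bounded from the Besov space to the Triebel-Lizorkin space. The last two
clauses serve to identify its trace. -/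
lemma exists_ext_bound (hψ : IsWhitneyBumps d ψ) (hα : -1 < α) (hs1 : s < 1) (hp : 1 ≤ p)
    {σ : ℝ} (hσ0 : 0 < σ) (hσ : σ * p = s * p - (α + 1)) {q : ℝ≥0∞} (hq : 0 < q) :
    ∃ C : ℝ≥0, ∀ f ∈ besovSpace univ volume σ (ENNReal.ofReal p) (ENNReal.ofReal p),
      ext ψ f ∈ triebelSpace (upperHalf d) (muAlpha d α) s p q ∧
      triebelNorm (upperHalf d) (muAlpha d α) s p q (ext ψ f) ≤
        C * besovNorm univ volume σ (ENNReal.ofReal p) (ENNReal.ofReal p) f ∧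
      (∀ x r, IntegrableOn (ext ψ f) (cyl x r) (muAlpha d α)) ∧
      ∀ m : ℕ, ∫⁻ x, extError f m x ^ p ≠ ∞ := by
  have hp0 : 0 < p := by linarith
  have hpp : 0 < 1 / p := by positivity
  have hσp : 0 < σ * p := by positivity
  set W : ℝ≥0∞ := 2 ^ (σ * p) with hWdef
  have hW : 1 < W := ENNReal.one_lt_rpow (by norm_num) hσp
  have hW' : W ≠ ∞ := by rw [hWdef]; finiteness
  obtain ⟨C₁, h₁⟩ := tsum_extError_le d hp hW hW'
  obtain ⟨C₂, h₂⟩ := lintegral_ext_le hψ hα hp0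
  obtain ⟨C₃, h₃⟩ := lintegral_osc_ext_le (d := d) hψ hα hs1 hp hσ hq
  refine ⟨(C₂ * C₁) ^ (1 / p) + (C₃ * C₁) ^ (1 / p), fun f ⟨hf, hfn⟩ => ?_⟩
  have hfm : AEStronglyMeasurable f := (locallyIntegrable_of_locInt hf).aestronglyMeasurable
  set N := ∫⁻ x, ‖f x‖ₑ ^ p with hN
  set S := ∑' k : ℕ, W ^ k * ∫⁻ x, osc univ volume (ENNReal.ofReal p) f (at' x (k : ℤ)) ^ p with hS
  have hnorm : besovNorm univ volume σ (ENNReal.ofReal p) (ENNReal.ofReal p) f =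
      N ^ (1 / p) + S ^ (1 / p) := by rw [besovNorm_eq hp0, eLpNorm_ofReal hp0]
  have hNS : N ≠ ∞ ∧ S ≠ ∞ := by
    rw [hnorm, ENNReal.add_lt_top] at hfn
    exact ⟨((ENNReal.rpow_lt_top_iff_of_pos hpp).1 hfn.1).ne,
      ((ENNReal.rpow_lt_top_iff_of_pos hpp).1 hfn.2).ne⟩
  have hsum : ∑' k : ℕ, W ^ k * ∫⁻ x, extError f k x ^ p ≤ C₁ * (N + S) := by
    refine (h₁ f).trans ?_
    refine mul_le_mul_right (add_le_add_right (ENNReal.tsum_le_tsum fun k =>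
      mul_le_mul_right (lintegral_mono fun x => ?_) _) _) _
    gcongr
    exact osc_top_le_osc (ENNReal.ofReal_pos.2 hp0) _
  have hE : ∀ m : ℕ, ∫⁻ x, extError f m x ^ p ≤ C₁ * (N + S) := fun m => by
    refine le_trans ?_ ((ENNReal.le_tsum m).trans hsum)
    exact le_mul_of_one_le_left (by simp) (one_le_pow₀ hW.le)
  have hEt : ∀ m : ℕ, ∫⁻ x, extError f m x ^ p ≠ ∞ := fun m => by
    have := hNS.1
    have := hNS.2
    exact ne_top_of_le_ne_top (by finiteness) (hE m)
  have hLp : ∫⁻ y, ‖ext ψ f y‖ₑ ^ p ∂(muAlpha d α) ≤ (C₂ * C₁ : ℝ≥0) * (N + S) := by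
    refine (h₂ hfm (ae_good hf)).trans ?_
    rw [ENNReal.coe_mul, mul_assoc]
    gcongr
    exact hE 0
  have hmem : MemLp (ext ψ f) (ENNReal.ofReal p) (muAlpha d α) := by
    refine ⟨(measurable_ext hψ f).aestronglyMeasurable, ?_⟩
    rw [eLpNorm_ofReal hp0, ENNReal.rpow_lt_top_iff_of_pos hpp]
    have := hNS.1
    have := hNS.2
    exact lt_of_le_of_lt hLp (by finiteness)
  have hint : ∀ P : DyadicCube (d + 1), P.toSet ⊆ upperHalf d →
      IntegrableOn (ext ψ f) P.toSet (muAlpha d α) :=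
    fun P hP => integrableOn_of_memLp hp hmem (muAlpha_toSet_ne_top hα hP)
  have hbound : triebelNorm (upperHalf d) (muAlpha d α) s p q (ext ψ f) ≤
      ((C₂ * C₁) ^ (1 / p) + (C₃ * C₁) ^ (1 / p) : ℝ≥0) * (N ^ (1 / p) + S ^ (1 / p)) := by
    rw [triebelNorm, restrict_muAlpha, eLpNorm_ofReal hp0, ENNReal.coe_add, add_mul]
    refine add_le_add (rpow_one_div_le hp hLp) (rpow_one_div_le hp ((h₃ hf hint).trans ?_))
    rw [ENNReal.coe_mul, mul_assoc]
    gcongr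
  refine ⟨⟨locInt_ext hψ hp hf (hEt 0), lt_of_le_of_lt hbound ?_⟩, hnorm ▸ hbound,
    fun x r => integrableOn_of_memLp hp hmem (muAlpha_cyl_ne_top hα x r), hEt⟩
  rw [← hnorm]
  exact ENNReal.mul_lt_top ENNReal.coe_lt_top hfn

/-- The trace of the extension of `f` is `f`. -/
lemma trace_ext_ae_eq (hψ : IsWhitneyBumps d ψ) (hα : -1 < α) (hs : 0 < s) (hp : 1 ≤ p)
    (hsp : α + 1 < s * p) {f : E d → ℂ} (hf : LocInt univ f)
    (hF : ∀ x r, IntegrableOn (ext ψ f) (cyl x r) (muAlpha d α))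
    (hE : ∫⁻ x, extError f 0 x ^ p ≠ ∞) : trace (muAlpha d α) (ext ψ f) =ᵐ[volume] f := by
  have hp0 : 0 < p := by linarith
  set o := osc univ volume ∞ f with ho
  have hle : ∀ m x, tail o m x ≤ extError f 0 x := fun m x =>
    (tail_antitone o x (Nat.zero_le m)).trans le_self_add
  have hfin : ∀ᵐ x, tail o 0 x ≠ ∞ := by
    have := ae_lt_top' ((measurable_tail o 0).pow_const p).aemeasurable
      (ne_top_of_le_ne_top hE (lintegral_mono fun x => by gcongr; exact hle 0 x))
    filter_upwards [this] with x hx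
    exact ((ENNReal.rpow_lt_top_iff_of_pos hp0).1 hx).ne
  have h := ae_tendsto_halfBallAverage (F := ext ψ f) (h := f) (G := fun _ => 0)
    (D := fun m x => 2 * tail o m x) hα hp hs.le hsp hF (locallyIntegrable_of_locInt hf)
    (fun m => ((measurable_tail o m).const_mul 2).aemeasurable) (fun m => ?_) ?_ measurable_const
    (by simp [hp0]) ?_
  · filter_upwards [h] with x hx using hx.limUnder_eq
  · simp_rw [ENNReal.mul_rpow_of_nonneg _ _ hp0.le]
    rw [lintegral_const_mul' _ _ (by finiteness)]
    exact ENNReal.mul_ne_top (by finiteness)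
      (ne_top_of_le_ne_top hE (lintegral_mono fun x => by gcongr; exact hle m x))
  · filter_upwards [hfin] with x hx
    simpa using ENNReal.Tendsto.const_mul (a := 2) (tendsto_tail hx) (Or.inr (by norm_num))
  · filter_upwards [ae_muAlpha_mem, ae_muAlpha_base (ae_good hf)] with y hyH hy m hm
    obtain ⟨j, hmj, hj⟩ := exists_mem_strip hyH
      (hm.trans (le_mul_of_one_le_left (by positivity) (by norm_num)))
    rw [mul_zero, zero_add]
    refine (hy.enorm_ext_sub_le_tail hψ hj).trans ?_
    gcongr
    exact tail_antitone o _ hmj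

end Extension

/-! ### The trace-extension pair -/

section Pair

variable {d : ℕ} {ψ : SmallCube d → E (d + 1) → ℝ} {α s p : ℝ}

lemma LocInt.sub {n : ℕ} {Ω : Set (E n)} {f g : E n → ℂ} (hf : LocInt Ω f) (hg : LocInt Ω g) :
    LocInt Ω (f - g) := fun A hA hAb => (hf A hA hAb).sub (hg A hA hAb)

lemma LocInt.congr {n : ℕ} {Ω : Set (E n)} {f g : E n → ℂ} (hf : LocInt Ω f) (h : f =ᵐ[volume] g) :
    LocInt Ω g := fun A hA hAb => (hf A hA hAb).congr (ae_restrict_of_ae h)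

lemma besovNorm_congr {n : ℕ} {σ : ℝ} (hp : 0 < p) {f g : E n → ℂ} (h : f =ᵐ[volume] g) :
    besovNorm univ volume σ (ENNReal.ofReal p) (ENNReal.ofReal p) f =
      besovNorm univ volume σ (ENNReal.ofReal p) (ENNReal.ofReal p) g := by
  simp_rw [besovNorm_eq hp, eLpNorm_congr_ae h, osc_congr h]

lemma besovSpace_congr {n : ℕ} {σ : ℝ} (hp : 0 < p) {f g : E n → ℂ} (h : f =ᵐ[volume] g)
    (hf : f ∈ besovSpace univ volume σ (ENNReal.ofReal p) (ENNReal.ofReal p)) :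
    g ∈ besovSpace univ volume σ (ENNReal.ofReal p) (ENNReal.ofReal p) :=
  ⟨hf.1.congr h, besovNorm_congr hp h ▸ hf.2⟩

lemma halfBallAverage_sub (hα : -1 < α) (hp : 1 ≤ p) {q : ℝ≥0∞} {F G : E (d + 1) → ℂ}
    (hF : F ∈ triebelSpace (upperHalf d) (muAlpha d α) s p q)
    (hG : G ∈ triebelSpace (upperHalf d) (muAlpha d α) s p q) (x : E d) (r : ℝ) :
    halfBallAverage (muAlpha d α) (F - G) x r =
      halfBallAverage (muAlpha d α) F x r - halfBallAverage (muAlpha d α) G x r := by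
  have hint : ∀ F ∈ triebelSpace (upperHalf d) (muAlpha d α) s p q,
      IntegrableOn F (Metric.ball (bdryPoint x) r ∩ upperHalf d) (muAlpha d α) := fun F hF => by
    have hFn := lt_of_le_of_lt (le_self_add) hF.2
    rw [restrict_muAlpha] at hFn
    exact (integrableOn_of_memLp hp ⟨aestronglyMeasurable_of_locInt hF.1, hFn⟩
      (muAlpha_cyl_ne_top hα x r)).mono_set (halfBall_subset_cyl x r)
  exact setAverage_sub (hint F hF) (hint G hG)

lemma isWhitneyTraceExtensionPair (hψ : IsWhitneyBumps d ψ) (hα : -1 < α) (hs : 0 < s) (hs1 : s < 1)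
    (hp : 1 ≤ p) {σ : ℝ} (hσ0 : 0 < σ) (hσ : σ * p = s * p - (α + 1)) {q : ℝ≥0∞} (hq : 0 < q) :
    IsWhitneyTraceExtensionPair ψ (muAlpha d α)
      (besovSpace univ volume σ (ENNReal.ofReal p) (ENNReal.ofReal p))
      (besovNorm univ volume σ (ENNReal.ofReal p) (ENNReal.ofReal p))
      (triebelSpace (upperHalf d) (muAlpha d α) s p q)
      (triebelNorm (upperHalf d) (muAlpha d α) s p q) := by
  have hp0 : 0 < p := by linarith
  have hσp : 0 < σ * p := by positivity
  obtain ⟨C₁, h₁⟩ := exists_ext_bound hψ hα hs1 hp hσ0 hσ hq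
  obtain ⟨C₂, h₂⟩ := exists_trace (d := d) hα hs hp hσ0 hσ
  -- The trace agrees almost everywhere with the limit function.
  have htr : ∀ {F : E (d + 1) → ℂ} {h : E d → ℂ},
      (∀ᵐ x, Tendsto (halfBallAverage (muAlpha d α) F x) (𝓝[>] 0) (𝓝 (h x))) →
      trace (muAlpha d α) F =ᵐ[volume] h := fun hlim => by
    filter_upwards [hlim] with x hx using hx.limUnder_eq
  have htrace : ∀ F ∈ triebelSpace (upperHalf d) (muAlpha d α) s p q,
      trace (muAlpha d α) F ∈ besovSpace univ volume σ (ENNReal.ofReal p) (ENNReal.ofReal p) ∧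
      besovNorm univ volume σ (ENNReal.ofReal p) (ENNReal.ofReal p) (trace (muAlpha d α) F) ≤
        C₂ * triebelNorm (upperHalf d) (muAlpha d α) s p q F := fun F hF => by
    obtain ⟨h, hh, hlim, hb⟩ := h₂ q hq F hF
    refine ⟨besovSpace_congr hp0 (htr hlim).symm ⟨locInt_of_memLp hp hh,
      hb.trans_lt (ENNReal.mul_lt_top ENNReal.coe_lt_top hF.2)⟩, ?_⟩
    rwa [besovNorm_congr hp0 (htr hlim)]
  -- Positive constants make the bounds trivial where the norm of a difference is infinite.
  refine ⟨⟨fun f hf => (h₁ f hf).1, C₁ + 1, fun f hf => ?_, fun f hf g hg => ?_⟩, fun F hF => ?_,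
    fun F hF => (htrace F hF).1.1, ⟨fun F hF => (htrace F hF).1, C₂ + 1, fun F hF => ?_,
      fun F hF G hG => ?_⟩, fun f hf => ?_⟩
  · refine (h₁ f hf).2.1.trans ?_
    gcongr
    exact le_self_add
  · rw [← ext_sub hψ hf.1 hg.1]
    by_cases hfg : besovNorm univ volume σ (ENNReal.ofReal p) (ENNReal.ofReal p) (f - g) = ∞
    · rw [hfg, ENNReal.mul_top (by simp)]
      exact le_top
    · refine (h₁ (f - g) ⟨hf.1.sub hg.1, lt_top_iff_ne_top.2 hfg⟩).2.1.trans ?_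
      gcongr
      exact le_self_add
  · obtain ⟨h, -, hlim, -⟩ := h₂ q hq F hF
    exact hlim.mono fun x hx => ⟨h x, hx⟩
  · refine (htrace F hF).2.trans ?_
    gcongr
    exact le_self_add
  · by_cases hFG : triebelNorm (upperHalf d) (muAlpha d α) s p q (F - G) = ∞
    · rw [hFG, ENNReal.mul_top (by simp)]
      exact le_top
    · have hFG' : F - G ∈ triebelSpace (upperHalf d) (muAlpha d α) s p q :=
        ⟨hF.1.sub hG.1, lt_top_iff_ne_top.2 hFG⟩
      obtain ⟨f, -, hf, -⟩ := h₂ q hq F hF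
      obtain ⟨g, -, hg, -⟩ := h₂ q hq G hG
      have hsub : trace (muAlpha d α) F - trace (muAlpha d α) G =ᵐ[volume]
          trace (muAlpha d α) (F - G) := by
        refine ((htr hf).sub (htr hg)).trans (htr ?_).symm
        filter_upwards [hf, hg] with x hfx hgx
        exact (hfx.sub hgx).congr fun r => (halfBallAverage_sub hα hp hF hG x r).symm
      rw [besovNorm_congr hp0 hsub]
      refine (htrace _ hFG').2.trans ?_
      gcongr
      exact le_self_add
  · obtain ⟨-, -, hF, hE⟩ := h₁ f hf
    exact trace_ext_ae_eq hψ hα hs hp (by linarith) hf.1 hF (hE 0)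

lemma traceSpace_eq {q : ℝ≥0∞} {σ : ℝ} (hp : 0 < p)
    (h : IsWhitneyTraceExtensionPair ψ (muAlpha d α)
      (besovSpace univ volume σ (ENNReal.ofReal p) (ENNReal.ofReal p))
      (besovNorm univ volume σ (ENNReal.ofReal p) (ENNReal.ofReal p))
      (triebelSpace (upperHalf d) (muAlpha d α) s p q)
      (triebelNorm (upperHalf d) (muAlpha d α) s p q)) :
    traceSpace (muAlpha d α) (triebelSpace (upperHalf d) (muAlpha d α) s p q) =
      besovSpace univ volume σ (ENNReal.ofReal p) (ENNReal.ofReal p) := by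
  refine Subset.antisymm ?_ fun g hg => ⟨ext ψ g, h.ext_continuous.1 g hg, h.trace_ext g hg⟩
  rintro g ⟨F, hF, hFg⟩
  exact besovSpace_congr hp hFg (h.trace_continuous.1 F hF)

end Pair

end WhitneyTrace

theorem mainTheorem3 (d : ℕ) (hd : 1 ≤ d) (s p α : ℝ) (hs0 : 0 < s) (hs1 : s < 1) (hp : 1 ≤ p)
    (hα0 : -1 < α) (hα1 : α < s * p - 1)
    (ψ : WhitneyTrace.SmallCube d → WhitneyTrace.E (d + 1) → ℝ)
    (hψ : WhitneyTrace.IsWhitneyBumps d ψ) :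
    (∀ q : ℝ≥0∞, 0 < q →
      WhitneyTrace.IsWhitneyTraceExtensionPair ψ (WhitneyTrace.muAlpha d α)
        (WhitneyTrace.besovSpace univ volume (s - (α + 1) / p)
          (ENNReal.ofReal p) (ENNReal.ofReal p))
        (WhitneyTrace.besovNorm univ volume (s - (α + 1) / p)
          (ENNReal.ofReal p) (ENNReal.ofReal p))
        (WhitneyTrace.triebelSpace (WhitneyTrace.upperHalf d) (WhitneyTrace.muAlpha d α) s p q)
        (WhitneyTrace.triebelNorm (WhitneyTrace.upperHalf d) (WhitneyTrace.muAlpha d α) s p q)) ∧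
    (∀ q : ℝ≥0∞, 0 < q →
      WhitneyTrace.traceSpace (WhitneyTrace.muAlpha d α)
          (WhitneyTrace.triebelSpace (WhitneyTrace.upperHalf d) (WhitneyTrace.muAlpha d α) s p q) =
        WhitneyTrace.besovSpace univ volume (s - (α + 1) / p)
          (ENNReal.ofReal p) (ENNReal.ofReal p)) := by
  have hp0 : 0 < p := by linarith
  have hσ : (s - (α + 1) / p) * p = s * p - (α + 1) := by field_simp
  have hσ0 : 0 < s - (α + 1) / p := by
    rw [sub_pos, div_lt_iff₀ hp0]
    linarith
  have h := fun (q : ℝ≥0∞) (hq : 0 < q) =>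
    WhitneyTrace.isWhitneyTraceExtensionPair hψ hα0 hs0 hs1 hp hσ0 hσ hq
  exact ⟨h, fun q hq => WhitneyTrace.traceSpace_eq hp0 (h q hq)⟩
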